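/- Let $d\in\mathbb N$ and write $x=(x_1,x_2)\in\mathbb R^d\times\mathbb R^d=\mathbb R^{2d}$. Put $|x|_{a}=|x_1|+|x_2|^{1/3}$ and $2^{sa}x=(2^{s}x_1,2^{3s}x_2)$. Let $F$ be a finite-dimensional complex normed space and $\mathcal S'(\mathbb R^{2d};F)$ the space of $F$-valued tempered distributions (real scalar or $\mathbb R^m$-valued distributions are included by complexification). *Littlewood–Paley norm ($\alpha=2$).* Let $\chi_0:\mathbb R^{2d}\to\mathbb R$ be $C^\infty$ and symmetric ($\chi_0(-\xi)=\chi_0(\xi)$), with $\chi_0(\xi)=1$ if $|\xi|_a\le 1$ and $\chi_0(\xi)=0$ if $|\xi|_a>2$. Set $\phi_0=\chi_0$, $\phi_j(\xi)=\chi_0(2^{-ja}\xi)-\chi_0(2^{-(j-1)a}\xi)$ for $j\ge1$, $\check\phi_j(z)=(2\pi)^{-2d}\int_{\mathbb R^{2d}} e^{i\langle z,\xi\rangle}\phi_j(\xi)\,d\xi$ and $\mathcal R_jf=\check\phi_j*f$. For $\vartheta\in\mathbb R$ and $p,q\in[1,\infty]$ put $$\|f\|_{\mathbb B^{\vartheta,q}_{p;a}}=\Big(\sum_{j\ge0}\big(2^{j\vartheta}\|\mathcal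 R_jf\|_{L^p(\mathbb R^{2d})}\big)^q\Big)^{1/q}\in[0,\infty]$$ if $q<\infty$, and $\|f\|_{\mathbb B^{\vartheta,\infty}_{p;a}}=\sup_{j\ge0}2^{j\vartheta}\|\mathcal R_jf\|_{L^p}$. *Thermic norm.* For $v>0$ let $$g(v,x)=\frac1{(2\pi)^d v^{2d}}\exp\Big(-\frac{|x_1|^2}{v}-\frac{|x_2|^2}{v^3}\Big).$$ For a non-negative integer $n>\vartheta/2$ put $$\|f\|_{\mathcal H^{\vartheta}_{p,q,\mathbf d}}=\|g(1,\cdot)*f\|_{L^p}+\Big(\int_0^1\frac{dv}{v}\,v^{(n-\vartheta/2)q}\,\|\partial_v^ng(v,\cdot)*f\|_{L^p}^q\Big)^{1/q}\in[0,\infty]$$ if $q<\infty$, the second term being $\sup_{v\in(0,1]}v^{n-\vartheta/2}\|\partial_v^ng(v,\cdot)*f\|_{L^p}$ if $q=\infty$. **Lemma (equivalence of the norms in the anisotropic case).** For all $\vartheta\in\mathbb R$, all $p,q\in[1,\infty]$, every such $\chi_0$ and every integer $n\ge0$ with $n>\vartheta/2$, there is a constant $C\in(0,\infty)$ such that for every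 $f\in\mathcal S'(\mathbb R^{2d};F)$ $$\|f\|_{\mathbb B^{\vartheta,q}_{p;a}}\le C\,\|f\|_{\mathcal H^{\vartheta}_{p,q,\mathbf d}}\qquad\text{and}\qquad \|f\|_{\mathcal H^{\vartheta}_{p,q,\mathbf d}}\le C\,\|f\|_{\mathbb B^{\vartheta,q}_{p;a}} .$$ In particular one norm is finite if and only if the other one is. -/

import Mathlib

open scoped ENNReal NNReal ContDiff SchwartzMap FourierTransform
open MeasureTheory

noncomputable section

namespace Kinetic

/-- The phase space `ℝ^{2d} = ℝ^d × ℝ^d` with its Euclidean structure. A point is written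
`x = (x₁, x₂)`, where `x₁ = x.fst` is the nondegenerate variable (scaling weight `1`) and
`x₂ = x.snd` is the degenerate one (scaling weight `3`). -/
abbrev Phase (d : ℕ) : Type :=
  WithLp 2 (EuclideanSpace ℝ (Fin d) × EuclideanSpace ℝ (Fin d))

/-! ### Littlewood-Paley side (with `α = 2`, so that `1 + α = 3`) -/

/-- The homogeneous (anisotropic) norm `|x|_a = |x₁| + |x₂|^{1/3}`. -/
def anisoNorm {d : ℕ} (x : Phase d) : ℝ :=
  ‖x.fst‖ + ‖x.snd‖ ^ (1 / 3 : ℝ)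

/-- The dilation `2^{s a} x = (2^s x₁, 2^{3 s} x₂)`. -/
def dil {d : ℕ} (s : ℝ) (x : Phase d) : Phase d :=
  WithLp.toLp 2 ((2 : ℝ) ^ s • x.fst, (2 : ℝ) ^ (3 * s) • x.snd)

/-- The functions `χ₀` from which the dyadic partition is built: smooth, symmetric, equal to
`1` on the closed anisotropic unit ball and to `0` off the closed anisotropic ball of radius
`2`. -/
structure IsCutoff {d : ℕ} (χ : Phase d → ℝ) : Prop where
  contDiff : ContDiff ℝ ∞ χ
  symm : ∀ ξ, χ (-ξ) = χ ξ
  eq_one : ∀ ξ, anisoNorm ξ ≤ 1 → χ ξ = 1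
  eq_zero : ∀ ξ, 2 < anisoNorm ξ → χ ξ = 0

/-- The dyadic partition: `φ_0 = χ₀`, `φ_j(ξ) = χ₀(2^{-j a} ξ) - χ₀(2^{-(j-1) a} ξ)`. -/
def dyadic {d : ℕ} (χ : Phase d → ℝ) : ℕ → Phase d → ℝ
  | 0 => χ
  | j + 1 => fun ξ => χ (dil (-((j : ℝ) + 1)) ξ) - χ (dil (-(j : ℝ)) ξ)

theorem dil_eq {d : ℕ} (s : ℝ) : (dil s : Phase d → Phase d) =
    fun x => (WithLp.prodContinuousLinearEquiv 2 ℝ _ _).symm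
      ((2 : ℝ) ^ s • (WithLp.prodContinuousLinearEquiv 2 ℝ _ _ x).1,
        (2 : ℝ) ^ (3 * s) • (WithLp.prodContinuousLinearEquiv 2 ℝ _ _ x).2) := rfl

theorem contDiff_dil {d : ℕ} (s : ℝ) : ContDiff ℝ ∞ (dil s : Phase d → Phase d) := by
  rw [dil_eq]
  fun_prop

theorem norm_le_of_anisoNorm_le {d : ℕ} {x : Phase d} (h : anisoNorm x ≤ 2) : ‖x‖ ≤ 10 := by
  have h1 : 0 ≤ ‖x.fst‖ := norm_nonneg _
  have h2 : 0 ≤ ‖x.snd‖ ^ (1 / 3 : ℝ) := by positivity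
  unfold anisoNorm at h
  have h3 : ‖x.snd‖ ≤ 8 := by
    have : (‖x.snd‖ ^ (1 / 3 : ℝ)) ^ (3 : ℕ) = ‖x.snd‖ := by
      rw [← Real.rpow_natCast, ← Real.rpow_mul (norm_nonneg _)]; norm_num
    rw [← this]
    calc (‖x.snd‖ ^ (1 / 3 : ℝ)) ^ (3 : ℕ) ≤ 2 ^ 3 := by gcongr; linarith
      _ = 8 := by norm_num
  have h4 := WithLp.prod_norm_sq_eq_of_L2 x
  have h5 : ‖x.fst‖ ≤ 2 := by linarith
  nlinarith [norm_nonneg x, norm_nonneg x.snd]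

theorem IsCutoff.hasCompactSupport_dil {d : ℕ} {χ : Phase d → ℝ} (hχ : IsCutoff χ) (s : ℝ) :
    HasCompactSupport fun ξ => χ (dil s ξ) := by
  refine HasCompactSupport.intro
    (K := (dil (-s)) '' Metric.closedBall 0 10) ?_ ?_
  · exact (isCompact_closedBall _ _).image (contDiff_dil (-s)).continuous
  · intro x hx
    apply hχ.eq_zero
    by_contra! hcon
    apply hx
    refine ⟨dil s x, by simpa using norm_le_of_anisoNorm_le hcon, ?_⟩
    have e1 : (2 : ℝ) ^ (-s) * 2 ^ s = 1 := by
      rw [← Real.rpow_add two_pos]; simp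
    have e2 : (2 : ℝ) ^ (3 * -s) * 2 ^ (3 * s) = 1 := by
      rw [← Real.rpow_add two_pos]; ring_nf; simp
    change WithLp.toLp 2 ((2 : ℝ) ^ (-s) • (2 : ℝ) ^ s • x.fst,
      (2 : ℝ) ^ (3 * -s) • (2 : ℝ) ^ (3 * s) • x.snd) = x
    rw [smul_smul, smul_smul, e1, e2, one_smul, one_smul]
    rfl

theorem IsCutoff.hasCompactSupport {d : ℕ} {χ : Phase d → ℝ} (hχ : IsCutoff χ) :
    HasCompactSupport χ := by
  have h0 : ∀ ξ : Phase d, dil 0 ξ = ξ := by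
    intro ξ
    change WithLp.toLp 2 ((2 : ℝ) ^ (0 : ℝ) • ξ.fst, (2 : ℝ) ^ (3 * (0 : ℝ)) • ξ.snd) = ξ
    rw [mul_zero, Real.rpow_zero, one_smul, one_smul]
    rfl
  have := hχ.hasCompactSupport_dil 0
  simpa only [h0] using this

theorem IsCutoff.hasCompactSupport_dyadic {d : ℕ} {χ : Phase d → ℝ} (hχ : IsCutoff χ) (j : ℕ) :
    HasCompactSupport (dyadic χ j) := by
  cases j with
  | zero => exact hχ.hasCompactSupport
  | succ j => exact (hχ.hasCompactSupport_dil _).sub (hχ.hasCompactSupport_dil _)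

theorem IsCutoff.contDiff_dyadic {d : ℕ} {χ : Phase d → ℝ} (hχ : IsCutoff χ) (j : ℕ) :
    ContDiff ℝ ∞ (dyadic χ j) := by
  cases j with
  | zero => exact hχ.contDiff
  | succ j => exact (hχ.contDiff.comp (contDiff_dil _)).sub (hχ.contDiff.comp (contDiff_dil _))

/-- The Schwartz function `ξ ↦ φ_j(2π ξ)`. -/
def dyadicSchwartz {d : ℕ} {χ : Phase d → ℝ} (hχ : IsCutoff χ) (j : ℕ) : 𝓢(Phase d, ℂ) :=
  HasCompactSupport.toSchwartzMap (f := fun ξ => ((dyadic χ j ((2 * Real.pi) • ξ) : ℝ) : ℂ))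
    (((hχ.hasCompactSupport_dyadic j).comp_smul (by positivity)).comp_left Complex.ofReal_zero)
    (Complex.ofRealCLM.contDiff.comp ((hχ.contDiff_dyadic j).comp (contDiff_const_smul _)))

/-- The kernel of the `j`-th dyadic block, that is the inverse Fourier transform
`z ↦ (2π)^{-2d} ∫ exp(i ⟨z, ξ⟩) φ_j(ξ) dξ` of `φ_j`. As Mathlib's Fourier transform has the
phase `2π i ⟨z, ξ⟩`, the frequency variable is rescaled by `2π`; see `blockKernel_apply`. -/
def blockKernel {d : ℕ} {χ : Phase d → ℝ} (hχ : IsCutoff χ) (j : ℕ) : 𝓢(Phase d, ℂ) :=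
  𝓕⁻ (dyadicSchwartz hχ j)

theorem blockKernel_apply {d : ℕ} {χ : Phase d → ℝ} (hχ : IsCutoff χ) (j : ℕ) (z : Phase d) :
    blockKernel hχ j z = (1 / (2 * Real.pi) ^ (2 * d) : ℝ) •
      ∫ ξ : Phase d, Complex.exp (Complex.I * (inner ℝ z ξ : ℝ)) * (dyadic χ j ξ : ℂ) := by
  have h := Measure.integral_comp_smul (volume : Measure (Phase d))
    (fun ξ : Phase d => Complex.exp (Complex.I * (inner ℝ z ξ : ℝ)) * (dyadic χ j ξ : ℂ))
    (2 * Real.pi)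
  have hdim : Module.finrank ℝ (Phase d) = 2 * d := by
    rw [(WithLp.linearEquiv 2 ℝ
      (EuclideanSpace ℝ (Fin d) × EuclideanSpace ℝ (Fin d))).finrank_eq]
    simp [two_mul]
  rw [hdim, abs_of_pos (by positivity)] at h
  rw [one_div, ← h, blockKernel, SchwartzMap.fourierInv_coe, Real.fourierInv_eq']
  congr 1
  ext ξ
  have e : dyadicSchwartz hχ j ξ = ((dyadic χ j ((2 * Real.pi) • ξ) : ℝ) : ℂ) := rfl
  simp only [e, smul_eq_mul, inner_smul_right, real_inner_comm z ξ]
  congr 2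
  push_cast
  ring

/-- The convolution `u * f` of a Schwartz function `u` with a tempered distribution `f`, which
is the (smooth) function `x ↦ ⟨f, u(x - ·)⟩`. -/
def conv {d : ℕ} {F : Type*} [NormedAddCommGroup F] [NormedSpace ℂ F]
    (u : 𝓢(Phase d, ℂ)) (f : 𝓢'(Phase d, F)) (x : Phase d) : F :=
  f (SchwartzMap.compCLMOfContinuousLinearEquiv ℂ (ContinuousLinearEquiv.neg ℝ)
    (SchwartzMap.compSubConstCLM ℂ (-x) u))


theorem conv_kernel_apply {d : ℕ} (u : 𝓢(Phase d, ℂ)) (x y : Phase d) :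
    SchwartzMap.compCLMOfContinuousLinearEquiv ℂ (ContinuousLinearEquiv.neg ℝ)
      (SchwartzMap.compSubConstCLM ℂ (-x) u) y = u (x - y) := by
  simp [SchwartzMap.compSubConstCLM_apply, sub_eq_add_neg, add_comm]

/-- The Littlewood-Paley norm `‖f‖_{B^{ϑ,q}_{p;a}}`, as an element of `[0, ∞]`. -/
def lpBesovNorm {d : ℕ} {F : Type*} [NormedAddCommGroup F] [NormedSpace ℂ F]
    {χ : Phase d → ℝ} (hχ : IsCutoff χ) (θ : ℝ) (p q : ℝ≥0∞) (f : 𝓢'(Phase d, F)) : ℝ≥0∞ :=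
  if q = ⊤ then
    ⨆ j : ℕ, ENNReal.ofReal (2 ^ (j * θ)) * eLpNorm (conv (blockKernel hχ j) f) p volume
  else
    (∑' j : ℕ, (ENNReal.ofReal (2 ^ (j * θ)) *
      eLpNorm (conv (blockKernel hχ j) f) p volume) ^ q.toReal) ^ (1 / q.toReal)

/-! ### Thermic side -/

/-- The anisotropic Gaussian kernel
`g_λ(u, z) = (2πλ)^{-d} u^{-2d} exp(-(|z₁|² / (λ u) + |z₂|² / (λ u³)))`. -/
def kolmogorovGaussian (d : ℕ) (lam u : ℝ) (z : Phase d) : ℝ :=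
  1 / ((2 * Real.pi * lam) ^ d * u ^ (2 * d)) *
    Real.exp (-(‖z.fst‖ ^ 2 / (lam * u) + ‖z.snd‖ ^ 2 / (lam * u ^ 3)))

/-- `∂_v^n g_1(v, z)`. -/
def gaussianTimeDeriv (d n : ℕ) (v : ℝ) (z : Phase d) : ℝ :=
  iteratedDeriv n (fun u => kolmogorovGaussian d 1 u z) v

/-- Building blocks of the time derivatives of the Gaussian kernel. -/
def gaussMonomial (d : ℕ) (t : ℕ × ℕ × ℕ) (u : ℝ) (z : Phase d) : ℝ :=
  u⁻¹ ^ t.1 * ((‖z.fst‖ ^ 2) ^ t.2.1 * (‖z.snd‖ ^ 2) ^ t.2.2) *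
    Real.exp (-(‖z.fst‖ ^ 2 * u⁻¹ + ‖z.snd‖ ^ 2 * u⁻¹ ^ 3))

/-- Linear combinations of Gaussian monomials. -/
def gaussSpan (d : ℕ) : Submodule ℝ (ℝ → Phase d → ℝ) :=
  Submodule.span ℝ (Set.range (gaussMonomial d))

theorem hasDerivAt_gaussMonomial (d : ℕ) (t : ℕ × ℕ × ℕ) {u : ℝ} (hu : 0 < u) (z : Phase d) :
    HasDerivAt (fun u => gaussMonomial d t u z)
      (-(t.1 : ℝ) * gaussMonomial d (t.1 + 1, t.2.1, t.2.2) u z +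
        gaussMonomial d (t.1 + 2, t.2.1 + 1, t.2.2) u z +
        3 * gaussMonomial d (t.1 + 4, t.2.1, t.2.2 + 1) u z) u := by
  obtain ⟨i, j, k⟩ := t
  have h1 : HasDerivAt (fun u : ℝ => u⁻¹) (-(u⁻¹) ^ 2) u := by
    simpa using hasDerivAt_inv hu.ne'
  have h2 := h1.pow 3
  have h3 := h1.pow i
  have h4 := (((h1.const_mul (‖z.fst‖ ^ 2)).add (h2.const_mul (‖z.snd‖ ^ 2))).neg).exp
  have h5 := (h3.mul_const ((‖z.fst‖ ^ 2) ^ j * (‖z.snd‖ ^ 2) ^ k)).mul h4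
  refine h5.congr_deriv ?_
  simp only [gaussMonomial, Pi.add_apply, Pi.pow_apply, Pi.neg_apply]
  rcases i with _ | i
  · simp; ring
  · simp; ring

theorem exists_deriv_mem_gaussSpan {d : ℕ} {h : ℝ → Phase d → ℝ} (hh : h ∈ gaussSpan d) :
    ∃ h' ∈ gaussSpan d, ∀ u, 0 < u → ∀ z, HasDerivAt (fun u => h u z) (h' u z) u := by
  induction hh using Submodule.span_induction with
  | mem x hx =>
    obtain ⟨t, rfl⟩ := hx
    refine ⟨-(t.1 : ℝ) • gaussMonomial d (t.1 + 1, t.2.1, t.2.2) +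
        gaussMonomial d (t.1 + 2, t.2.1 + 1, t.2.2) +
        (3 : ℝ) • gaussMonomial d (t.1 + 4, t.2.1, t.2.2 + 1), ?_,
        fun u hu z => hasDerivAt_gaussMonomial d t hu z⟩
    have hm : ∀ t, gaussMonomial d t ∈ gaussSpan d :=
      fun t => Submodule.subset_span ⟨t, rfl⟩
    exact add_mem (add_mem (Submodule.smul_mem _ _ (hm _)) (hm _)) (Submodule.smul_mem _ _ (hm _))
  | zero => exact ⟨0, zero_mem _, fun u _ z => hasDerivAt_const u (0 : ℝ)⟩
  | add x y _ _ hx hy =>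
    obtain ⟨x', hx', hx⟩ := hx
    obtain ⟨y', hy', hy⟩ := hy
    exact ⟨x' + y', add_mem hx' hy', fun u hu z => (hx u hu z).add (hy u hu z)⟩
  | smul a x _ hx =>
    obtain ⟨x', hx', hx⟩ := hx
    exact ⟨a • x', Submodule.smul_mem _ _ hx', fun u hu z => (hx u hu z).const_mul a⟩

theorem exists_gaussianTimeDeriv_eq (d n : ℕ) :
    ∃ h ∈ gaussSpan d, ∀ v, 0 < v → ∀ z, gaussianTimeDeriv d n v z = h v z := by
  induction n with
  | zero =>
    refine ⟨((2 * Real.pi) ^ d)⁻¹ • gaussMonomial d (2 * d, 0, 0),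
      Submodule.smul_mem _ _ (Submodule.subset_span ⟨_, rfl⟩), fun v hv z => ?_⟩
    simp only [gaussianTimeDeriv, iteratedDeriv_zero, kolmogorovGaussian, gaussMonomial,
      Pi.smul_apply, smul_eq_mul, pow_zero, mul_one, one_mul, inv_pow, div_eq_mul_inv, mul_inv]
    ring
  | succ n ih =>
    obtain ⟨h, hh, he⟩ := ih
    obtain ⟨h', hh', hd⟩ := exists_deriv_mem_gaussSpan hh
    refine ⟨h', hh', fun v hv z => ?_⟩
    rw [gaussianTimeDeriv, iteratedDeriv_succ, ← (hd v hv z).deriv]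
    apply Filter.EventuallyEq.deriv_eq
    filter_upwards [lt_mem_nhds hv] with u hu using he u hu z

/-- The exponential of minus a definite quadratic expression is a Schwartz function. -/
theorem exists_schwartz_exp {E : Type*} [NormedAddCommGroup E] [NormedSpace ℝ E] {Q : E → ℝ}
    (hQ : Q.HasTemperateGrowth) {c : ℝ} (hc : 0 < c) (hle : ∀ z, c * ‖z‖ ^ 2 ≤ Q z) :
    ∃ s : 𝓢(E, ℝ), ∀ z, s z = Real.exp (-Q z) := by
  refine ⟨⟨fun z => Real.exp (-Q z), Real.contDiff_exp.comp hQ.1.neg, fun k n => ?_⟩,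
    fun z => rfl⟩
  obtain ⟨m, C, hC0, hC⟩ := hQ.neg.norm_iteratedFDeriv_le_uniform n
  set D : E → ℝ := fun z => (1 + C) * (1 + ‖z‖) ^ m with hD
  obtain ⟨B, hB⟩ : ∃ B : ℝ, ∀ r : ℝ, 0 ≤ r →
      r ^ k * (n.factorial * Real.exp (-(c * r ^ 2)) * ((1 + C) * (1 + r) ^ m) ^ n) ≤ B := by
    set N := k + m * n with hN
    refine ⟨n.factorial * (1 + C) ^ n * (N.factorial * Real.exp (1 + 1 / (4 * c))), fun r hr => ?_⟩
    have a1 : (1 + r) ^ N ≤ N.factorial * Real.exp (1 + r) := by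
      have := Real.pow_div_factorial_le_exp (1 + r) (by linarith) N
      rwa [div_le_iff₀' (by positivity)] at this
    have a2 : r ^ k ≤ (1 + r) ^ k := by gcongr; linarith
    have a3 : r - 1 / (4 * c) ≤ c * r ^ 2 := by
      have : c * r ^ 2 - r + 1 / (4 * c) = c * (r - 1 / (2 * c)) ^ 2 := by
        field_simp; ring
      nlinarith [mul_nonneg hc.le (sq_nonneg (r - 1 / (2 * c)))]
    have a4 : Real.exp (1 + r) * Real.exp (-(c * r ^ 2)) ≤ Real.exp (1 + 1 / (4 * c)) := by
      rw [← Real.exp_add]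
      exact Real.exp_le_exp.2 (by linarith)
    calc r ^ k * (n.factorial * Real.exp (-(c * r ^ 2)) * ((1 + C) * (1 + r) ^ m) ^ n)
        ≤ (1 + r) ^ k *
          (n.factorial * Real.exp (-(c * r ^ 2)) * ((1 + C) * (1 + r) ^ m) ^ n) := by gcongr
      _ = n.factorial * (1 + C) ^ n * ((1 + r) ^ N * Real.exp (-(c * r ^ 2))) := by
        rw [hN, pow_add, pow_mul, mul_pow]; ring
      _ ≤ n.factorial * (1 + C) ^ n *
          (N.factorial * Real.exp (1 + r) * Real.exp (-(c * r ^ 2))) := by gcongr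
      _ ≤ n.factorial * (1 + C) ^ n * (N.factorial * Real.exp (1 + 1 / (4 * c))) := by
        rw [mul_assoc (N.factorial : ℝ)]; gcongr
  refine ⟨B, fun z => ?_⟩
  refine le_trans ?_ (hB ‖z‖ (norm_nonneg z))
  refine mul_le_mul_of_nonneg_left ?_ (by positivity)
  have key := norm_iteratedFDeriv_comp_le (𝕜 := ℝ) (g := Real.exp) (f := -Q) (n := n)
    (N := ∞) Real.contDiff_exp hQ.neg.1 (mod_cast le_top) z
    (C := Real.exp (-(c * ‖z‖ ^ 2))) (D := D z) ?_ ?_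
  · exact key
  · intro i _
    rw [norm_iteratedFDeriv_eq_norm_iteratedDeriv, iteratedDeriv_eq_iterate, Real.iter_deriv_exp]
    rw [Real.norm_eq_abs, Real.abs_exp]
    exact Real.exp_le_exp.2 (neg_le_neg (hle z))
  · intro i hi hin
    have h1 : 1 ≤ D z := by
      have : 1 ≤ (1 + ‖z‖) ^ m := one_le_pow₀ (by linarith [norm_nonneg z])
      simp only [hD]; nlinarith
    calc _ ≤ C * (1 + ‖z‖) ^ m := hC i hin z
      _ ≤ D z := by simp only [hD]; gcongr; linarith
      _ ≤ D z ^ i := le_self_pow₀ h1 (by omega)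

theorem exists_schwartz_of_mem_gaussSpan {d : ℕ} {h : ℝ → Phase d → ℝ} (hh : h ∈ gaussSpan d)
    {v : ℝ} (hv : 0 < v) : ∃ s : 𝓢(Phase d, ℂ), ∀ z, s z = (h v z : ℝ) := by
  suffices H : ∃ s : 𝓢(Phase d, ℝ), ∀ z, s z = h v z by
    obtain ⟨s, hs⟩ := H
    exact ⟨SchwartzMap.postcompCLM (𝕜 := ℝ) (F := ℝ) (G := ℂ) Complex.ofRealCLM s, fun z => by
      rw [← hs z]; rfl⟩
  have g1 : (fun z : Phase d => (‖z.fst‖ ^ 2 : ℝ)).HasTemperateGrowth :=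
    (Function.hasTemperateGrowth_norm_sq (H := EuclideanSpace ℝ (Fin d))).comp
      ((ContinuousLinearMap.fst ℝ _ _).comp (WithLp.prodContinuousLinearEquiv 2 ℝ
        (EuclideanSpace ℝ (Fin d)) (EuclideanSpace ℝ (Fin d))).toContinuousLinearMap
        ).hasTemperateGrowth
  have g2 : (fun z : Phase d => ‖z.snd‖ ^ 2).HasTemperateGrowth :=
    (Function.hasTemperateGrowth_norm_sq (H := EuclideanSpace ℝ (Fin d))).comp
      ((ContinuousLinearMap.snd ℝ _ _).comp (WithLp.prodContinuousLinearEquiv 2 ℝ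
        (EuclideanSpace ℝ (Fin d)) (EuclideanSpace ℝ (Fin d))).toContinuousLinearMap
        ).hasTemperateGrowth
  have hv' : 0 < v⁻¹ := by positivity
  obtain ⟨s, hs⟩ := exists_schwartz_exp (E := Phase d)
    (Q := fun z => ‖z.fst‖ ^ 2 * v⁻¹ + ‖z.snd‖ ^ 2 * v⁻¹ ^ 3) (c := min v⁻¹ (v⁻¹ ^ 3))
    ((g1.mul (.const _)).add (g2.mul (.const _))) (by positivity) (fun z => by
      rw [WithLp.prod_norm_sq_eq_of_L2, mul_add]
      refine add_le_add ?_ ?_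
      · rw [mul_comm]; gcongr; exact min_le_left _ _
      · rw [mul_comm]; gcongr; exact min_le_right _ _)
  induction hh using Submodule.span_induction with
  | mem x hx =>
    obtain ⟨t, rfl⟩ := hx
    have hg : (fun z : Phase d => v⁻¹ ^ t.1 *
        ((‖z.fst‖ ^ 2) ^ t.2.1 * (‖z.snd‖ ^ 2) ^ t.2.2)).HasTemperateGrowth :=
      (Function.HasTemperateGrowth.const (v⁻¹ ^ t.1)).mul ((g1.pow _).mul (g2.pow _))
    refine ⟨SchwartzMap.smulLeftCLM ℝ (fun z : Phase d => v⁻¹ ^ t.1 *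
      ((‖z.fst‖ ^ 2) ^ t.2.1 * (‖z.snd‖ ^ 2) ^ t.2.2)) s, fun z => ?_⟩
    rw [SchwartzMap.smulLeftCLM_apply_apply hg, hs z, smul_eq_mul]
    rfl
  | zero => exact ⟨0, fun z => rfl⟩
  | add x y _ _ hx hy =>
    obtain ⟨a, ha⟩ := hx
    obtain ⟨b, hb⟩ := hy
    exact ⟨a + b, fun z => by simp [ha z, hb z]⟩
  | smul r x _ hx =>
    obtain ⟨a, ha⟩ := hx
    exact ⟨r • a, fun z => by simp [ha z]⟩

theorem exists_schwartz_gaussianTimeDeriv (d n : ℕ) {v : ℝ} (hv : 0 < v) :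
    ∃ s : 𝓢(Phase d, ℂ), ∀ z, s z = (gaussianTimeDeriv d n v z : ℝ) := by
  obtain ⟨h, hh, he⟩ := exists_gaussianTimeDeriv_eq d n
  obtain ⟨s, hs⟩ := exists_schwartz_of_mem_gaussSpan hh hv
  exact ⟨s, fun z => by rw [hs z, he v hv z]⟩

open Classical in
/-- For `v > 0`, the Schwartz function `∂_v^n g_1(v, ·)` (see `thermicKernel_apply`); only
values `v ∈ (0, 1]` are used below. -/
def thermicKernel (d n : ℕ) (v : ℝ) : 𝓢(Phase d, ℂ) :=
  if hv : 0 < v then (exists_schwartz_gaussianTimeDeriv d n hv).choose else 0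

theorem thermicKernel_apply (d n : ℕ) {v : ℝ} (hv : 0 < v) (z : Phase d) :
    thermicKernel d n v z = (gaussianTimeDeriv d n v z : ℝ) := by
  rw [thermicKernel, dif_pos hv]
  exact (exists_schwartz_gaussianTimeDeriv d n hv).choose_spec z

/-- The part `T^ϑ_{p,q,d}[f]` of the thermic norm, computed with `n` time derivatives. -/
def thermicPart {d : ℕ} {F : Type*} [NormedAddCommGroup F] [NormedSpace ℂ F]
    (n : ℕ) (θ : ℝ) (p q : ℝ≥0∞) (f : 𝓢'(Phase d, F)) : ℝ≥0∞ :=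
  if q = ⊤ then
    ⨆ v ∈ Set.Ioc (0 : ℝ) 1,
      ENNReal.ofReal (v ^ (n - θ / 2)) * eLpNorm (conv (thermicKernel d n v) f) p volume
  else
    (∫⁻ v in Set.Ioc (0 : ℝ) 1, ENNReal.ofReal (1 / v) *
      (ENNReal.ofReal (v ^ ((n - θ / 2) * q.toReal)) *
        eLpNorm (conv (thermicKernel d n v) f) p volume ^ q.toReal)) ^ (1 / q.toReal)

/-- The thermic norm `‖f‖_{H^ϑ_{p,q,d}}` (computed with `n` time derivatives), as an element of
`[0, ∞]`. -/
def thermicNorm {d : ℕ} {F : Type*} [NormedAddCommGroup F] [NormedSpace ℂ F]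
    (n : ℕ) (θ : ℝ) (p q : ℝ≥0∞) (f : 𝓢'(Phase d, F)) : ℝ≥0∞ :=
  eLpNorm (conv (thermicKernel d 0 1) f) p volume + thermicPart n θ p q f

end Kinetic

end

-- Both norms test `f` with Fourier multipliers that are anisotropic dilates `(σ ξ₁, σ³ ξ₂)` of
-- fixed symbols. The block `φ_j` with `j ≥ 1` is a fixed annular symbol dilated by `2^{-j}`. The
-- symbol of `∂_v^n g(v, ·)` is `v^{-n} G_n` dilated by `√v`, where `G_n` is a polynomial `p_n` in
-- `(π²|ξ₁|², π²|ξ₂|²)` times a Gaussian. Time `v` therefore corresponds to frequency `v^{-1/2}`,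
-- and everything depends on `r = v 4^j`.
--
-- If a symbol factors as `k = h m`, Young's inequality bounds the `L^p` norm of the `k`-part of `f`
-- by that of the `m`-part, with constant the `L¹` norm of the inverse transform of `h`
-- (`eLpNorm_conv_mul_le`). This constant, `kernelNorm h`, is submultiplicative and invariant under
-- dilations (`kernelNorm_symMul_le`, `kernelNorm_scaleSymbol`), hence all bounds are uniform in `j`
-- and `v`.
--
-- Thermic norm by Besov norm: `∂_v^n g(v, ·) * f` is dominated by the sum of its dyadic pieces, and
-- the `j`-th piece costs `v^{-n} min(r^n, r^{-N})` (`exists_eLpNorm_thermic_block_le`). The factor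
-- `r^n` holds because every monomial `s^i t^k` of `p_n` has weight `i + 3k ≥ n`; the factor
-- `r^{-N}` is Gaussian decay on an annulus. After inserting the weights this becomes a discrete
-- convolution with `w^{|j-i|}`, `w = 4^{-(n-ϑ/2)}`, which is summable because `n > ϑ/2`. Young's
-- inequality in `ℓ^q` concludes.
--
-- Besov norm by thermic norm: `φ_j` is divided by the symbol of `∂_v^n g(v, ·)`. Since `p_n` may
-- have zeros (`p_2 = (s+3t)² - 6t`), the time `v ≈ 4^{-j}` is not always suitable; with `v ≈
-- 4^{m-j}` and `m` large the leading part `(-(s+3t))^n` prevails and the quotient is smooth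
-- (`exists_eLpNorm_block_le`). As `v` runs over `(0, 1]` this reaches all but finitely many blocks,
-- and those are divided by the symbol of `g(1, ·)`, which never vanishes.
--
-- For a tempered distribution the factorisation `k = h m` requires `f` to commute with an integral
-- of translates of a Schwartz function (`integral_smul_map_translate`). This follows by factoring
-- `f` through finitely many Banach spaces of bounded continuous functions.

universe u

/-! ### Translations of Schwartz functions. -/

namespace SchwartzMap

section Translation

variable {E V : Type*} [NormedAddCommGroup E] [NormedSpace ℝ E]
  [NormedAddCommGroup V] [NormedSpace ℝ V]

theorem pow_norm_mul_iteratedFDeriv_sub_le (u : 𝓢(E, V)) (k l : ℕ) (x y : E) :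
    ‖x‖ ^ k * ‖iteratedFDeriv ℝ l u (x - y)‖ ≤
      2 ^ k * (SchwartzMap.seminorm ℝ k l u + ‖y‖ ^ k * SchwartzMap.seminorm ℝ 0 l u) := by
  have h1 : ‖x‖ ^ k ≤ 2 ^ k * (‖x - y‖ ^ k + ‖y‖ ^ k) := by
    have h2 : ‖x‖ ≤ ‖x - y‖ + ‖y‖ := by simpa using norm_add_le (x - y) y
    calc ‖x‖ ^ k ≤ (‖x - y‖ + ‖y‖) ^ k := by gcongr
      _ ≤ 2 ^ (k - 1) * (‖x - y‖ ^ k + ‖y‖ ^ k) := add_pow_le (norm_nonneg _) (norm_nonneg _) k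
      _ ≤ _ := by gcongr <;> simp
  have h3 := le_seminorm ℝ k l u (x - y)
  have h4 := le_seminorm ℝ 0 l u (x - y)
  rw [pow_zero, one_mul] at h4
  calc _ ≤ 2 ^ k * (‖x - y‖ ^ k + ‖y‖ ^ k) * ‖iteratedFDeriv ℝ l u (x - y)‖ := by gcongr
    _ = 2 ^ k * (‖x - y‖ ^ k * ‖iteratedFDeriv ℝ l u (x - y)‖ +
        ‖y‖ ^ k * ‖iteratedFDeriv ℝ l u (x - y)‖) := by ring
    _ ≤ _ := by gcongr

/-- Mean value inequality in the translation parameter, at the price of one more derivative; the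
weight `‖x‖ ^ k` is moved to `‖x - z‖ ^ k` and `‖z‖ ^ k`, and `z` stays in the unit ball about `y₀`.
-/
theorem seminorm_sub_translate_le (u : 𝓢(E, V)) (k l : ℕ) {y y₀ : E} (hy : ‖y - y₀‖ ≤ 1) :
    SchwartzMap.seminorm ℝ k l (compSubConstCLM ℝ y u - compSubConstCLM ℝ y₀ u) ≤
      2 ^ k * (SchwartzMap.seminorm ℝ k (l + 1) u +
        (‖y₀‖ + 1) ^ k * SchwartzMap.seminorm ℝ 0 (l + 1) u) * ‖y - y₀‖ := by
  refine seminorm_le_bound ℝ k l _ (by positivity) fun x => ?_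
  have e : iteratedFDeriv ℝ l (compSubConstCLM ℝ y u - compSubConstCLM ℝ y₀ u) x =
      iteratedFDeriv ℝ l u (x - y) - iteratedFDeriv ℝ l u (x - y₀) := by
    have h := iteratedFDeriv_sub_apply (𝕜 := ℝ) (i := l) (x := x)
      ((compSubConstCLM ℝ y u).smooth l).contDiffAt ((compSubConstCLM ℝ y₀ u).smooth l).contDiffAt
    refine Eq.trans ?_ (h.trans ?_)
    · rfl
    · congr 1
      · exact iteratedFDeriv_comp_sub l y x
      · exact iteratedFDeriv_comp_sub l y₀ x
  rw [e]
  have key := (convex_closedBall y₀ ‖y - y₀‖).norm_image_sub_le_of_norm_hasFDerivWithin_le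
    (f := fun z => ‖x‖ ^ k • iteratedFDeriv ℝ l u (x - z))
    (f' := fun z => -(‖x‖ ^ k • fderiv ℝ (iteratedFDeriv ℝ l u) (x - z)))
    (C := 2 ^ k * (SchwartzMap.seminorm ℝ k (l + 1) u +
        (‖y₀‖ + 1) ^ k * SchwartzMap.seminorm ℝ 0 (l + 1) u))
    (x := y₀) (y := y) ?_ ?_ (by simp) (by simp [dist_eq_norm])
  · rwa [← smul_sub, norm_smul, norm_pow, norm_norm] at key
  · intro z _
    have h1 : HasFDerivAt (iteratedFDeriv ℝ l u) (fderiv ℝ (iteratedFDeriv ℝ l u) (x - z))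
        (x - z) := by
      refine DifferentiableAt.hasFDerivAt ?_
      exact ((u.smooth (l + 1)).differentiable_iteratedFDeriv
        (by exact_mod_cast Nat.lt_succ_self l)).differentiableAt
    have h2 : HasFDerivAt (fun z => x - z) (-ContinuousLinearMap.id ℝ E) z := by
      simpa using (hasFDerivAt_id z).const_sub x
    have h3 := (h1.comp z h2).const_smul (‖x‖ ^ k)
    refine (h3.congr_fderiv ?_).hasFDerivWithinAt
    ext; simp
  · intro z hz
    rw [norm_neg, norm_smul, norm_pow, norm_norm, norm_fderiv_iteratedFDeriv]
    refine (pow_norm_mul_iteratedFDeriv_sub_le u k (l + 1) x z).trans ?_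
    have hz' : ‖z‖ ≤ ‖y₀‖ + 1 := by
      rw [mem_closedBall_iff_norm] at hz
      have : ‖z‖ ≤ ‖z - y₀‖ + ‖y₀‖ := by simpa using norm_add_le (z - y₀) y₀
      linarith
    gcongr

theorem continuous_translate (u : 𝓢(E, ℂ)) :
    Continuous fun y : E => compSubConstCLM ℂ y u := by
  rw [continuous_iff_continuousAt]
  intro y₀
  rw [ContinuousAt, (schwartz_withSeminorms ℝ E ℂ).tendsto_nhds _ _]
  rintro ⟨k, l⟩ ε hε
  set M := 2 ^ k * (SchwartzMap.seminorm ℝ k (l + 1) u +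
        (‖y₀‖ + 1) ^ k * SchwartzMap.seminorm ℝ 0 (l + 1) u) with hM
  have hM0 : 0 ≤ M := by positivity
  have : Filter.Tendsto (fun y => M * ‖y - y₀‖) (nhds y₀) (nhds 0) := by
    have : Continuous fun y => M * ‖y - y₀‖ := by fun_prop
    simpa using this.tendsto y₀
  filter_upwards [this.eventually_lt_const hε, Metric.closedBall_mem_nhds y₀ one_pos] with y h1 h2
  rw [mem_closedBall_iff_norm] at h2
  exact (seminorm_sub_translate_le u k l h2).trans_lt h1

end Translation

/-! ### Tempered distributions commute with superpositions of translates. -/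

section Superposition

set_option linter.unusedSectionVars false

variable {E V : Type*} [NormedAddCommGroup E] [NormedSpace ℝ E] [FiniteDimensional ℝ E]
  [MeasurableSpace E] [BorelSpace E] {μ : Measure E}
  [NormedAddCommGroup V] [NormedSpace ℝ V] [NormedSpace ℂ V] [SMulCommClass ℝ ℂ V]

theorem _root_.MeasureTheory.Integrable.smul_translate {g : E → ℂ} (hg : Integrable g μ)
    {u : E → V} (hu : Continuous u) {C : ℝ} (hC : ∀ x, ‖u x‖ ≤ C) (x : E) :
    Integrable (fun y => g y • u (x - y)) μ := by
  refine (hg.norm.mul_const C).mono' (hg.aestronglyMeasurable.smul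
    (hu.comp (by fun_prop)).aestronglyMeasurable) (.of_forall fun y => ?_)
  rw [norm_smul]
  gcongr
  exact hC _

theorem hasFDerivAt_integral_smul_translate {g : E → ℂ} (hg : Integrable g μ) (u : 𝓢(E, V))
    (x : E) :
    HasFDerivAt (fun x => ∫ y, g y • u (x - y) ∂μ)
      (∫ y, g y • fderivCLM ℝ E V u (x - y) ∂μ) x := by
  have hC : ∀ z, ‖fderivCLM ℝ E V u z‖ ≤ SchwartzMap.seminorm ℝ 0 0 (fderivCLM ℝ E V u) :=
    fun z => norm_le_seminorm ℝ _ z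
  refine hasFDerivAt_integral_of_dominated_of_fderiv_le (𝕜 := ℝ) (s := Set.univ)
    (bound := fun y => ‖g y‖ * SchwartzMap.seminorm ℝ 0 0 (fderivCLM ℝ E V u))
    (F' := fun x y => g y • fderivCLM ℝ E V u (x - y)) Filter.univ_mem
    (.of_forall fun x => ?_) ?_ ?_ ?_ (hg.norm.mul_const _) ?_
  · exact (hg.smul_translate u.continuous (norm_le_seminorm ℝ u) x).aestronglyMeasurable
  · exact hg.smul_translate u.continuous (norm_le_seminorm ℝ u) x
  · exact (hg.smul_translate (fderivCLM ℝ E V u).continuous hC x).aestronglyMeasurable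
  · refine .of_forall fun y x _ => ?_
    rw [norm_smul]
    gcongr
    exact hC _
  · refine .of_forall fun y x _ => ?_
    have h2 : HasFDerivAt (fun x => x - y) (ContinuousLinearMap.id ℝ E) x := by
      simpa using (hasFDerivAt_id x).sub_const y
    exact ((u.hasFDerivAt (x - y)).comp x h2).const_smul (g y)

/-- Differentiation under the integral sign, iterated. The target `V` is quantified inside the
induction because each step replaces `V` by `E →L[ℝ] V`; `E` and `V` share a universe so that this
space stays in it. For `V = ℂ` this forces `E : Type`. -/
theorem iteratedFDeriv_integral_smul_translate {E : Type u} [NormedAddCommGroup E]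
    [NormedSpace ℝ E] [FiniteDimensional ℝ E] [MeasurableSpace E] [BorelSpace E] {μ : Measure E}
    {g : E → ℂ} (hg : Integrable g μ) (l : ℕ) :
    ∀ {V : Type u} [NormedAddCommGroup V] [NormedSpace ℝ V] [NormedSpace ℂ V]
      [SMulCommClass ℝ ℂ V] (u : 𝓢(E, V)) (x : E),
    iteratedFDeriv ℝ l (fun x => ∫ y, g y • u (x - y) ∂μ) x =
      ∫ y, g y • iteratedFDeriv ℝ l u (x - y) ∂μ := by
  induction l with
  | zero =>
    intro V _ _ _ _ u x
    rw [iteratedFDeriv_zero_eq_comp, Function.comp_apply]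
    have := (continuousMultilinearCurryFin0 ℝ E V).symm.toContinuousLinearEquiv.integral_comp_comm
      (μ := μ) (fun y => g y • u (x - y))
    refine this.symm.trans (integral_congr_ae (.of_forall fun y => ?_))
    ext m
    simp
  | succ l ih =>
    intro V _ _ _ _ u x
    rw [iteratedFDeriv_succ_eq_comp_right, Function.comp_apply]
    have h1 : (fun x => fderiv ℝ (fun x => ∫ y, g y • u (x - y) ∂μ) x) =
        fun x => ∫ y, g y • fderivCLM ℝ E V u (x - y) ∂μ :=
      funext fun x => (hasFDerivAt_integral_smul_translate hg u x).fderiv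
    rw [h1, ih (fderivCLM ℝ E V u) x]
    have := (continuousMultilinearCurryRightEquiv' ℝ l E
      V).symm.toContinuousLinearEquiv.integral_comp_comm (μ := μ)
      (fun y => g y • iteratedFDeriv ℝ l (fderivCLM ℝ E V u) (x - y))
    refine this.symm.trans (integral_congr_ae (.of_forall fun y => ?_))
    ext m
    simp [iteratedFDeriv_succ_apply_right]
    rfl

/-- The normed space of `l`-linear forms. -/
def MultForm (E : Type*) [NormedAddCommGroup E] [NormedSpace ℝ E] (l : ℕ) : Type _ := E [×l]→L[ℝ] ℂ

noncomputable instance {E : Type*} [NormedAddCommGroup E] [NormedSpace ℝ E] (l : ℕ) :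
    NormedAddCommGroup (MultForm E l) :=
  inferInstanceAs (NormedAddCommGroup (E [×l]→L[ℝ] ℂ))

noncomputable instance {E : Type*} [NormedAddCommGroup E] [NormedSpace ℝ E] (l : ℕ) :
    NormedSpace ℂ (MultForm E l) :=
  inferInstanceAs (NormedSpace ℂ (E [×l]→L[ℝ] ℂ))

instance {E : Type*} [NormedAddCommGroup E] [NormedSpace ℝ E] (l : ℕ) :
    CompleteSpace (MultForm E l) :=
  inferInstanceAs (CompleteSpace (E [×l]→L[ℝ] ℂ))

/-- The `l`-th derivative of a Schwartz function. -/
noncomputable def derivForm {E : Type*} [NormedAddCommGroup E] [NormedSpace ℝ E] (l : ℕ)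
    (u : 𝓢(E, ℂ)) (x : E) : MultForm E l := iteratedFDeriv ℝ l u x

/-- The weighted derivative `x ↦ ‖x‖ ^ k • D ^ l u x`, as a bounded continuous function. -/
noncomputable def weightedDeriv (E : Type*) [NormedAddCommGroup E] [NormedSpace ℝ E] (k l : ℕ) :
    𝓢(E, ℂ) →ₗ[ℂ] BoundedContinuousFunction E (MultForm E l) where
  toFun u := BoundedContinuousFunction.ofNormedAddCommGroup
    (fun x => ((‖x‖ ^ k : ℝ) : ℂ) • derivForm l u x)
    ((Complex.continuous_ofReal.comp (continuous_norm.pow k)).smul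
      ((u.smooth l).continuous_iteratedFDeriv le_rfl))
    (SchwartzMap.seminorm ℝ k l u) (fun x => by
      rw [norm_smul, Complex.norm_real, norm_pow, norm_norm]; exact le_seminorm ℝ k l u x)
  map_add' u w := by
    ext1 x
    have := iteratedFDeriv_add_apply (𝕜 := ℝ) (i := l) (x := x)
      (u.smooth l).contDiffAt (w.smooth l).contDiffAt
    have h : iteratedFDeriv ℝ l (⇑(u + w)) x =
      iteratedFDeriv ℝ l u x + iteratedFDeriv ℝ l w x := this
    change ((‖x‖ ^ k : ℝ) : ℂ) • derivForm l (u + w) x = _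
    have h' : derivForm l (u + w) x = derivForm l u x + derivForm l w x := h
    rw [h', smul_add]
    rfl
  map_smul' c u := by
    ext1 x
    have := iteratedFDeriv_const_smul_apply (𝕜 := ℝ) (i := l) (x := x) (a := c)
      (u.smooth l).contDiffAt
    have h : iteratedFDeriv ℝ l (⇑(c • u)) x = c • iteratedFDeriv ℝ l u x := this
    change ((‖x‖ ^ k : ℝ) : ℂ) • derivForm l (c • u) x = _
    have h' : derivForm l (c • u) x = c • derivForm l u x := h
    rw [h', smul_comm]
    rfl

theorem weightedDeriv_apply {E : Type*} [NormedAddCommGroup E] [NormedSpace ℝ E] (k l : ℕ)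
    (u : 𝓢(E, ℂ)) (x : E) : weightedDeriv E k l u x = ((‖x‖ ^ k : ℝ) : ℂ) • derivForm l u x := rfl

theorem norm_weightedDeriv {E : Type*} [NormedAddCommGroup E] [NormedSpace ℝ E] (k l : ℕ)
    (u : 𝓢(E, ℂ)) : ‖weightedDeriv E k l u‖ = SchwartzMap.seminorm ℂ k l u := by
  refine le_antisymm ?_ ?_
  · refine (BoundedContinuousFunction.norm_le (apply_nonneg _ _)).2 fun x => ?_
    rw [weightedDeriv_apply, norm_smul, Complex.norm_real, norm_pow, norm_norm]; exact le_seminorm ℂ k l u x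
  · refine seminorm_le_bound ℂ k l _ (norm_nonneg (weightedDeriv E k l u)) fun x => ?_
    have := (weightedDeriv E k l u).norm_coe_le_norm x
    rwa [weightedDeriv_apply, norm_smul, Complex.norm_real, norm_pow, norm_norm] at this

/-- The bound makes `f` vanish on `ker ι`, so `f` descends to a bounded map on the range of `ι`;
Hahn–Banach for finite-dimensional targets extends it to all of `B`. -/
theorem _root_.LinearMap.exists_eq_comp_of_norm_le {S B F : Type*} [AddCommGroup S] [Module ℂ S]
    [NormedAddCommGroup B] [NormedSpace ℂ B] [NormedAddCommGroup F] [NormedSpace ℂ F]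
    [FiniteDimensional ℂ F] (ι : S →ₗ[ℂ] B) (f : S →ₗ[ℂ] F) {C : ℝ}
    (hle : ∀ u, ‖f u‖ ≤ C * ‖ι u‖) : ∃ φ : B →L[ℂ] F, ∀ u, f u = φ (ι u) := by
  have hker : LinearMap.ker ι ≤ LinearMap.ker f := by
    intro u hu
    rw [LinearMap.mem_ker] at hu ⊢
    have := hle u
    rw [hu, norm_zero, mul_zero] at this
    exact norm_le_zero_iff.1 this
  let e := (ι.quotKerEquivRange).symm
  let g₀ : LinearMap.range ι →ₗ[ℂ] F := ((LinearMap.ker ι).liftQ f hker).comp e.toLinearMap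
  have hg₀ : ∀ u, g₀ ⟨ι u, u, rfl⟩ = f u := by
    intro u
    have : e ⟨ι u, u, rfl⟩ = (LinearMap.ker ι).mkQ u := by
      rw [LinearEquiv.symm_apply_eq]; rfl
    change (LinearMap.ker ι).liftQ f hker (e ⟨ι u, u, rfl⟩) = f u
    rw [this]; simp
  let g : LinearMap.range ι →L[ℂ] F := g₀.mkContinuous C (by
    rintro ⟨_, u, rfl⟩
    rw [hg₀]; exact hle u)
  obtain ⟨φ, hφ⟩ := g.exist_extension_of_finiteDimensional_range
  refine ⟨φ, fun u => ?_⟩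
  rw [← hg₀ u]
  exact DFunLike.congr_fun hφ ⟨ι u, u, rfl⟩

/-- A continuous linear map from the Schwartz space to a finite dimensional space factors through
finitely many weighted derivatives. -/
theorem exists_eq_sum_weightedDeriv {E F : Type*} [NormedAddCommGroup E] [NormedSpace ℝ E]
    [NormedAddCommGroup F] [NormedSpace ℂ F] [FiniteDimensional ℂ F] (f : 𝓢(E, ℂ) →ₗ[ℂ] F)
    (hf : Continuous f) :
    ∃ (s : Finset (ℕ × ℕ))
      (φ : ∀ i : s, BoundedContinuousFunction E (MultForm E i.1.2) →L[ℂ] F),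
      ∀ u, f u = ∑ i : s, φ i (weightedDeriv E i.1.1 i.1.2 u) := by
  classical
  -- `‖f ·‖` is a continuous seminorm, hence at most a multiple of a finite supremum of Schwartz
  -- seminorms, and that supremum is bounded by the norm of the tuple of weighted derivatives in the
  -- finite product.
  obtain ⟨s, C, -, hC⟩ := Seminorm.bound_of_continuous (schwartz_withSeminorms ℂ E ℂ)
    ((normSeminorm ℂ F).comp f) (continuous_norm.comp hf)
  obtain ⟨φ, hφ⟩ := LinearMap.exists_eq_comp_of_norm_le
    (LinearMap.pi fun i : s => weightedDeriv E i.1.1 i.1.2) f (C := C) (fun u => by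
    refine (hC u).trans ?_
    rw [smul_apply, NNReal.smul_def, smul_eq_mul]
    gcongr
    refine Seminorm.finset_sup_apply_le
      (norm_nonneg ((LinearMap.pi fun i : s => weightedDeriv E i.1.1 i.1.2) u)) fun i hi => ?_
    refine le_trans (le_of_eq (norm_weightedDeriv i.1 i.2 u).symm)
      (norm_le_pi_norm (fun i : s => weightedDeriv E i.1.1 i.1.2 u) ⟨i, hi⟩))
  refine ⟨s, fun i => φ.comp (ContinuousLinearMap.single ℂ
    (fun i : s => BoundedContinuousFunction E (MultForm E i.1.2)) i), fun u => ?_⟩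
  rw [hφ u]
  simp only [ContinuousLinearMap.comp_apply]
  rw [← map_sum]
  congr 1
  exact (Finset.univ_sum_single (fun i : s => weightedDeriv E i.1.1 i.1.2 u)).symm

section

variable {E : Type} [NormedAddCommGroup E]
    [NormedSpace ℝ E] [FiniteDimensional ℝ E] [MeasurableSpace E] [BorelSpace E] {μ : Measure E}
    [μ.IsAddHaarMeasure]

theorem continuous_weightedDeriv (k l : ℕ) : Continuous (weightedDeriv E k l) := by
  refine WithSeminorms.continuous_of_isBounded (schwartz_withSeminorms ℂ E ℂ)
    (norm_withSeminorms ℂ _) (weightedDeriv E k l) fun _ => ⟨{(k, l)}, 1, fun u => ?_⟩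
  simp [norm_weightedDeriv]

/-- The sup norm of the weighted derivative of a translate grows at most like `‖y‖ ^ k`, which the
rapid decay of `g` absorbs. -/
theorem integrable_smul_weightedDeriv_translate (g u : 𝓢(E, ℂ)) (k l : ℕ) :
    Integrable (fun y => g y • weightedDeriv E k l (compSubConstCLM ℂ y u)) μ := by
  have hcont : Continuous fun y => weightedDeriv E k l (compSubConstCLM ℂ y u) :=
    (continuous_weightedDeriv k l).comp (continuous_translate u)
  have h1 : Integrable (fun y => 2 ^ k * (SchwartzMap.seminorm ℝ k l u * (‖y‖ ^ 0 * ‖g y‖) +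
      (‖y‖ ^ k * ‖g y‖) * SchwartzMap.seminorm ℝ 0 l u)) μ :=
    (((g.integrable_pow_mul μ 0).const_mul _).add
      ((g.integrable_pow_mul μ k).mul_const _)).const_mul _
  refine h1.mono' (g.continuous.smul hcont).aestronglyMeasurable (.of_forall fun y => ?_)
  rw [norm_smul]
  have h2 : ‖weightedDeriv E k l (compSubConstCLM ℂ y u)‖ ≤
      2 ^ k * (SchwartzMap.seminorm ℝ k l u + ‖y‖ ^ k * SchwartzMap.seminorm ℝ 0 l u) := by
    refine (BoundedContinuousFunction.norm_le (by positivity)).2 fun x => ?_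
    rw [weightedDeriv_apply, norm_smul, Complex.norm_real, norm_pow, norm_norm]
    refine le_trans (le_of_eq ?_) (pow_norm_mul_iteratedFDeriv_sub_le u k l x y)
    rw [← iteratedFDeriv_comp_sub l y x]
    rfl
  calc _ ≤ ‖g y‖ * (2 ^ k * (SchwartzMap.seminorm ℝ k l u +
        ‖y‖ ^ k * SchwartzMap.seminorm ℝ 0 l u)) := by gcongr
    _ = _ := by ring

/-- Evaluation at a point is continuous on bounded continuous functions, so it passes through the
Bochner integral, and the identity reduces to differentiation under the integral sign. -/
theorem weightedDeriv_eq_integral (g u G : 𝓢(E, ℂ)) (hG : ∀ x, G x = ∫ y, g y • u (x - y) ∂μ)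
    (k l : ℕ) :
    weightedDeriv E k l G = ∫ y, g y • weightedDeriv E k l (compSubConstCLM ℂ y u) ∂μ := by
  ext1 x
  have h1 := (BoundedContinuousFunction.evalCLM ℂ (β := MultForm E l) x).integral_comp_comm
    (integrable_smul_weightedDeriv_translate (μ := μ) g u k l)
  refine Eq.trans ?_ h1
  have h2 : (G : E → ℂ) = fun x => ∫ y, g y • u (x - y) ∂μ := funext hG
  have h3 : derivForm l G x = ∫ y, g y • derivForm l (compSubConstCLM ℂ y u) x ∂μ := by
    have h4 := iteratedFDeriv_integral_smul_translate (μ := μ) g.integrable l u x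
    rw [← h2] at h4
    refine h4.trans (integral_congr_ae (.of_forall fun y => ?_))
    have h5 : iteratedFDeriv ℝ l (compSubConstCLM ℂ y u) x = _ := iteratedFDeriv_comp_sub l y x
    change _ = g y • iteratedFDeriv ℝ l (compSubConstCLM ℂ y u) x
    rw [h5]
    rfl
  rw [weightedDeriv_apply, h3, ← integral_smul]
  refine integral_congr_ae (.of_forall fun y => ?_)
  change _ = g y • ((‖x‖ ^ k : ℝ) : ℂ) • derivForm l (compSubConstCLM ℂ y u) x
  rw [smul_comm]

/-- Continuous linear maps on the Schwartz space commute with convolutions. -/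
theorem integral_smul_map_translate
    {F : Type*} [NormedAddCommGroup F] [NormedSpace ℂ F] [FiniteDimensional ℂ F]
    (f : 𝓢(E, ℂ) →ₗ[ℂ] F) (hf : Continuous f) (g u G : 𝓢(E, ℂ))
    (hG : ∀ x, G x = ∫ y, g y • u (x - y) ∂μ) :
    f G = ∫ y, g y • f (compSubConstCLM ℂ y u) ∂μ := by
  -- The Schwartz space is not normed, so the vector-valued integrals are taken in the Banach spaces
  -- through which `f` factors, where each `φ i` commutes with them.
  obtain ⟨s, φ, hφ⟩ := exists_eq_sum_weightedDeriv f hf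
  have : CompleteSpace F := FiniteDimensional.complete ℂ F
  have hint : ∀ i : s, Integrable
      (fun y => φ i (g y • weightedDeriv E i.1.1 i.1.2 (compSubConstCLM ℂ y u))) μ := fun i =>
    (φ i).integrable_comp (integrable_smul_weightedDeriv_translate g u i.1.1 i.1.2)
  rw [hφ]
  simp_rw [hφ, Finset.smul_sum, ← map_smul]
  rw [integral_finsetSum _ fun i _ => by simpa using hint i]
  refine Finset.sum_congr rfl fun i _ => ?_
  rw [weightedDeriv_eq_integral (μ := μ) g u G hG]
  refine ((φ i).integral_comp_comm
    (integrable_smul_weightedDeriv_translate g u i.1.1 i.1.2)).symm.trans ?_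
  simp

end

end Superposition

end SchwartzMap

/-! ### Convolution inequalities. -/

/-- A form of Jensen's inequality for an unnormalised weight. -/
theorem ENNReal.lintegral_mul_rpow_le {α : Type*} [MeasurableSpace α] (μ : Measure α)
    {q : ℝ} (hq : 1 ≤ q) {k b : α → ℝ≥0∞} (hk : AEMeasurable k μ) (hb : AEMeasurable b μ) :
    (∫⁻ x, k x * b x ∂μ) ^ q ≤ (∫⁻ x, k x ∂μ) ^ (q - 1) * ∫⁻ x, k x * b x ^ q ∂μ := by
  rcases hq.eq_or_lt with rfl | hq
  · simp
  have hq0 : 0 < q := by linarith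
  have hc : (q / (q - 1)).HolderConjugate q := (Real.HolderConjugate.conjExponent hq).symm
  -- Hölder with exponents `q/(q-1)` and `q` for the splitting `k b = k^{(q-1)/q} · (k^{1/q} b)`.
  have h := ENNReal.lintegral_mul_le_Lp_mul_Lq μ hc (f := fun x => k x ^ ((q - 1) / q))
    (g := fun x => k x ^ (1 / q) * b x) (hk.pow_const _) ((hk.pow_const _).mul hb)
  have e1 : ∀ x, ((fun x => k x ^ ((q - 1) / q)) * fun x => k x ^ (1 / q) * b x) x
      = k x * b x := by
    intro x
    rw [Pi.mul_apply, ← mul_assoc, ← ENNReal.rpow_add_of_nonneg _ _ (by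
      apply div_nonneg <;> linarith) (by positivity)]
    rw [← add_div, sub_add_cancel, div_self hq0.ne', ENNReal.rpow_one]
  have e2 : ∀ x, (k x ^ ((q - 1) / q)) ^ (q / (q - 1)) = k x := by
    intro x
    rw [← ENNReal.rpow_mul, div_mul_div_cancel₀ hq0.ne', div_self (by linarith), ENNReal.rpow_one]
  have e3 : ∀ x, (k x ^ (1 / q) * b x) ^ q = k x * b x ^ q := by
    intro x
    rw [ENNReal.mul_rpow_of_nonneg _ _ hq0.le, ← ENNReal.rpow_mul, one_div_mul_cancel hq0.ne',
      ENNReal.rpow_one]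
  simp only [e1, e2, e3] at h
  calc _ ≤ ((∫⁻ x, k x ∂μ) ^ (1 / (q / (q - 1))) * (∫⁻ x, k x * b x ^ q ∂μ) ^ (1 / q)) ^ q := by
        gcongr
    _ = _ := by
      rw [ENNReal.mul_rpow_of_nonneg _ _ hq0.le, ← ENNReal.rpow_mul, ← ENNReal.rpow_mul,
        one_div_mul_cancel hq0.ne', ENNReal.rpow_one, one_div_div, div_mul_cancel₀ _ hq0.ne']

/-- Young's inequality for the convolution with an integrable kernel. -/
theorem MeasureTheory.eLpNorm_integral_smul_sub_le {E F : Type*} [NormedAddCommGroup E]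
    [NormedSpace ℝ E] [FiniteDimensional ℝ E] [MeasurableSpace E] [BorelSpace E] {μ : Measure E}
    [μ.IsAddHaarMeasure] [NormedAddCommGroup F] [NormedSpace ℂ F] {k : E → ℂ} {a : E → F}
    (hk : Continuous k) (ha : Continuous a) {p : ℝ≥0∞} (hp : 1 ≤ p) :
    eLpNorm (fun x => ∫ y, k y • a (x - y) ∂μ) p μ ≤ (∫⁻ y, ‖k y‖ₑ ∂μ) * eLpNorm a p μ := by
  have h0 : ∀ x, ‖∫ y, k y • a (x - y) ∂μ‖ₑ ≤ ∫⁻ y, ‖k y‖ₑ * ‖a (x - y)‖ₑ ∂μ := by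
    intro x
    refine (enorm_integral_le_lintegral_enorm _).trans (le_of_eq ?_)
    simp_rw [enorm_smul]
  have hkm : Measurable fun y => ‖k y‖ₑ := hk.enorm.measurable
  rcases eq_or_ne p ⊤ with rfl | hp'
  · simp only [eLpNorm_exponent_top]
    refine essSup_le_of_ae_le _ (.of_forall fun x => (h0 x).trans ?_)
    have h1 : ∀ᵐ y ∂μ, ‖a (x - y)‖ₑ ≤ eLpNormEssSup a μ :=
      (quasiMeasurePreserving_sub_left μ x).ae (ae_le_eLpNormEssSup (f := a))
    calc _ ≤ ∫⁻ y, ‖k y‖ₑ * eLpNormEssSup a μ ∂μ := by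
          refine lintegral_mono_ae ?_
          filter_upwards [h1] with y hy
          gcongr
      _ = _ := lintegral_mul_const _ hkm
  have hp0 : p ≠ 0 := (zero_lt_one.trans_le hp).ne'
  have hr1 : 1 ≤ p.toReal := by
    rw [← ENNReal.toReal_one]; exact (ENNReal.toReal_le_toReal (by simp) hp').2 hp
  set r := p.toReal with hr
  have hr0 : 0 < r := by linarith
  rw [eLpNorm_eq_lintegral_rpow_enorm_toReal hp0 hp',
    eLpNorm_eq_lintegral_rpow_enorm_toReal hp0 hp', ← hr]
  set K := ∫⁻ y, ‖k y‖ₑ ∂μ with hK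
  -- Jensen with the weight `‖k‖` of mass `K`, then Tonelli and translation invariance of `μ`.
  have h2 : ∫⁻ x, ‖∫ y, k y • a (x - y) ∂μ‖ₑ ^ r ∂μ ≤ K ^ r * ∫⁻ x, ‖a x‖ₑ ^ r ∂μ := by
    calc _ ≤ ∫⁻ x, K ^ (r - 1) * ∫⁻ y, ‖k y‖ₑ * ‖a (x - y)‖ₑ ^ r ∂μ ∂μ := by
          refine lintegral_mono fun x => ?_
          refine (ENNReal.rpow_le_rpow (h0 x) hr0.le).trans ?_
          exact ENNReal.lintegral_mul_rpow_le μ hr1 hkm.aemeasurable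
            (ha.comp (continuous_const.sub continuous_id)).enorm.measurable.aemeasurable
      _ = K ^ (r - 1) * ∫⁻ x, ∫⁻ y, ‖k y‖ₑ * ‖a (x - y)‖ₑ ^ r ∂μ ∂μ := by
          refine lintegral_const_mul _ ?_
          refine Measurable.lintegral_prod_right' (f := fun z : E × E =>
            ‖k z.2‖ₑ * ‖a (z.1 - z.2)‖ₑ ^ r) ?_
          exact (hk.comp continuous_snd).enorm.measurable.mul
            ((ha.comp (continuous_fst.sub continuous_snd)).enorm.measurable.pow_const _)
      _ = K ^ (r - 1) * ∫⁻ y, ∫⁻ x, ‖k y‖ₑ * ‖a (x - y)‖ₑ ^ r ∂μ ∂μ := by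
          rw [lintegral_lintegral_swap]
          exact ((hk.comp continuous_snd).enorm.measurable.mul
            ((ha.comp (continuous_fst.sub continuous_snd)).enorm.measurable.pow_const
              _)).aemeasurable
      _ = K ^ (r - 1) * ∫⁻ y, ‖k y‖ₑ * ∫⁻ x, ‖a x‖ₑ ^ r ∂μ ∂μ := by
          congr 1
          refine lintegral_congr fun y => ?_
          have hm : Measurable fun x => ‖a (x - y)‖ₑ ^ r :=
            (ha.comp (continuous_id.sub continuous_const)).enorm.measurable.pow_const _
          rw [lintegral_const_mul _ hm]
          congr 1
          exact lintegral_sub_right_eq_self (fun x => ‖a x‖ₑ ^ r) y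
      _ = K ^ (r - 1) * (K * ∫⁻ x, ‖a x‖ₑ ^ r ∂μ) := by
          rw [lintegral_mul_const _ hkm]
      _ = _ := by
          rw [← mul_assoc]
          congr 1
          nth_rw 2 [← ENNReal.rpow_one K]
          rw [← ENNReal.rpow_add_of_nonneg _ _ (by linarith) zero_le_one, sub_add_cancel]
  calc _ ≤ (K ^ r * ∫⁻ x, ‖a x‖ₑ ^ r ∂μ) ^ (1 / r) := by gcongr
    _ = _ := by
      rw [ENNReal.mul_rpow_of_nonneg _ _ (by positivity), ← ENNReal.rpow_mul,
        mul_one_div_cancel hr0.ne', ENNReal.rpow_one]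

/-! ### Fourier multipliers acting on tempered distributions. -/

theorem SchwartzMap.fourierInv_mul_apply {E : Type*} [NormedAddCommGroup E]
    [InnerProductSpace ℝ E] [FiniteDimensional ℝ E] [MeasurableSpace E] [BorelSpace E]
    {h m k : 𝓢(E, ℂ)} (hk : ∀ ξ, k ξ = h ξ * m ξ) (z : E) :
    (𝓕⁻ k) z = ∫ y, (𝓕⁻ h) y * (𝓕⁻ m) (z - y) := by
  have h1 : 𝓕⁻ k = SchwartzMap.convolution (ContinuousLinearMap.mul ℂ ℂ) (𝓕⁻ h) (𝓕⁻ m) := by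
    have h3 : 𝓕 (𝓕⁻ k) =
        𝓕 (SchwartzMap.convolution (ContinuousLinearMap.mul ℂ ℂ) (𝓕⁻ h) (𝓕⁻ m)) := by
      rw [SchwartzMap.fourier_convolution]
      simp only [FourierTransform.fourier_fourierInv_eq]
      ext ξ
      simp [hk ξ, SchwartzMap.pairing_apply_apply]
    have h4 := congrArg (fun w : 𝓢(E, ℂ) => 𝓕⁻ w) h3
    simpa only [FourierTransform.fourierInv_fourier_eq] using h4
  rw [h1, SchwartzMap.convolution_apply]
  rfl

/-- This is `(𝓕⁻ k) * f = (𝓕⁻ h) * ((𝓕⁻ m) * f)`, which is how products of symbols are used without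
forming the Fourier transform of `f`. The reflections come from the kernel `y ↦ u (x - y)` of a
convolution. -/
theorem SchwartzMap.map_fourierInv_mul {E : Type} {F : Type*} [NormedAddCommGroup E]
    [InnerProductSpace ℝ E] [FiniteDimensional ℝ E] [MeasurableSpace E] [BorelSpace E]
    [NormedAddCommGroup F] [NormedSpace ℂ F] [FiniteDimensional ℂ F]
    {h m k : 𝓢(E, ℂ)} (hk : ∀ ξ, k ξ = h ξ * m ξ) (f : 𝓢(E, ℂ) →ₗ[ℂ] F) (hf : Continuous f)
    (x : E) :
    f (compCLMOfContinuousLinearEquiv ℂ (ContinuousLinearEquiv.neg ℝ)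
        (compSubConstCLM ℂ (-x) (𝓕⁻ k))) =
      ∫ y, (𝓕⁻ h) y • f (compCLMOfContinuousLinearEquiv ℂ (ContinuousLinearEquiv.neg ℝ)
        (compSubConstCLM ℂ (-(x - y)) (𝓕⁻ m))) := by
  let refl := compCLMOfContinuousLinearEquiv (F := ℂ) ℂ
    (ContinuousLinearEquiv.neg ℝ (M := E))
  have h3 := integral_smul_map_translate (μ := volume) f hf
    (refl (𝓕⁻ h)) (refl (compSubConstCLM ℂ (-x) (𝓕⁻ m)))
    (refl (compSubConstCLM ℂ (-x) (𝓕⁻ k))) (by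
      intro z
      simp only [refl, compCLMOfContinuousLinearEquiv_apply, Function.comp_apply,
        ContinuousLinearEquiv.coe_neg, compSubConstCLM_apply, Pi.neg_apply, id, smul_eq_mul]
      rw [fourierInv_mul_apply hk, ← integral_neg_eq_self]
      refine integral_congr_ae (.of_forall fun y => ?_)
      simp only
      congr 2
      abel)
  refine h3.trans ?_
  rw [← integral_neg_eq_self]
  refine integral_congr_ae (.of_forall fun y => ?_)
  simp only [refl, compCLMOfContinuousLinearEquiv_apply, Function.comp_apply,
    ContinuousLinearEquiv.coe_neg, neg_neg, Pi.neg_apply, id]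
  congr 2
  ext z
  simp only [compCLMOfContinuousLinearEquiv_apply, Function.comp_apply,
    ContinuousLinearEquiv.coe_neg, compSubConstCLM_apply, Pi.neg_apply, id]
  congr 1
  abel

namespace Kinetic

variable {d : ℕ} {F : Type*} [NormedAddCommGroup F] [NormedSpace ℂ F]

/-- If `u` is reflected first, `x` enters only as a translation, and translation is continuous into
the Schwartz space. -/
theorem continuous_conv (u : 𝓢(Phase d, ℂ)) (f : 𝓢'(Phase d, F)) : Continuous (conv u f) := by
  have h1 : ∀ x, conv u f x = f (SchwartzMap.compSubConstCLM ℂ x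
      (SchwartzMap.compCLMOfContinuousLinearEquiv ℂ (ContinuousLinearEquiv.neg ℝ) u)) := by
    intro x
    rw [conv]
    congr 1
    ext y
    rw [conv_kernel_apply]
    simp
  rw [funext h1]
  exact f.continuous.comp (SchwartzMap.continuous_translate _)

theorem conv_fourierInv_mul [FiniteDimensional ℂ F] {h m k : 𝓢(Phase d, ℂ)}
    (hk : ∀ ξ, k ξ = h ξ * m ξ) (f : 𝓢'(Phase d, F)) (x : Phase d) :
    conv (𝓕⁻ k) f x = ∫ y, (𝓕⁻ h) y • conv (𝓕⁻ m) f (x - y) :=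
  SchwartzMap.map_fourierInv_mul hk f.toLinearMap f.continuous x

/-- The `L¹` norm of the inverse Fourier transform of a symbol. -/
noncomputable def kernelNorm (h : 𝓢(Phase d, ℂ)) : ℝ≥0∞ := ∫⁻ y, ‖(𝓕⁻ h) y‖ₑ

theorem kernelNorm_lt_top (h : 𝓢(Phase d, ℂ)) : kernelNorm h < ⊤ :=
  (𝓕⁻ h).integrable.hasFiniteIntegral

/-- The multiplier bound behind every block estimate: to control `k` by `m`, it suffices to exhibit
a Schwartz quotient `h` and to estimate its kernel in `L¹`. -/
theorem eLpNorm_conv_mul_le [FiniteDimensional ℂ F] {h m k : 𝓢(Phase d, ℂ)}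
    (hk : ∀ ξ, k ξ = h ξ * m ξ) (f : 𝓢'(Phase d, F)) {p : ℝ≥0∞} (hp : 1 ≤ p) :
    eLpNorm (conv (𝓕⁻ k) f) p volume ≤ kernelNorm h * eLpNorm (conv (𝓕⁻ m) f) p volume := by
  rw [funext (conv_fourierInv_mul hk f)]
  exact eLpNorm_integral_smul_sub_le (𝓕⁻ h).continuous (continuous_conv _ f) hp

end Kinetic

/-! ### Fourier transform under symmetric linear maps. -/

section LinearChangeOfVariables

variable {E : Type*} [NormedAddCommGroup E] [InnerProductSpace ℝ E] [FiniteDimensional ℝ E]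
  [MeasurableSpace E] [BorelSpace E]

theorem ContinuousLinearEquiv.map_volume (A : E ≃L[ℝ] E) :
    Measure.map A.toHomeomorph.toMeasurableEquiv volume =
      ENNReal.ofReal |(LinearMap.det (A : E →ₗ[ℝ] E))⁻¹| • (volume : Measure E) :=
  Measure.map_linearMap_addHaar_eq_smul_addHaar volume
    (LinearEquiv.isUnit_det' A.toLinearEquiv).ne_zero

theorem ContinuousLinearEquiv.lintegral_comp (A : E ≃L[ℝ] E) (g : E → ℝ≥0∞) :
    ∫⁻ x, g (A x) = ENNReal.ofReal |(LinearMap.det (A : E →ₗ[ℝ] E))⁻¹| * ∫⁻ x, g x := by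
  have := lintegral_map_equiv (μ := volume) g A.toHomeomorph.toMeasurableEquiv
  rw [A.map_volume, lintegral_smul_measure] at this
  exact this.symm

theorem ContinuousLinearEquiv.integral_comp_eq {F : Type*} [NormedAddCommGroup F] [NormedSpace ℝ F]
    (A : E ≃L[ℝ] E) (g : E → F) :
    ∫ x, g (A x) = |(LinearMap.det (A : E →ₗ[ℝ] E))⁻¹| • ∫ x, g x := by
  have := integral_map_equiv (μ := volume) A.toHomeomorph.toMeasurableEquiv g
  rw [A.map_volume, integral_smul_measure, ENNReal.toReal_ofReal (abs_nonneg _)] at this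
  exact this.symm

/-- The Fourier transform of a function composed with a symmetric linear map. -/
theorem Real.fourierInv_comp_symmetric {F : Type*} [NormedAddCommGroup F] [NormedSpace ℂ F]
    (A : E ≃L[ℝ] E) (hA : ∀ x y, inner ℝ (A x) y = inner ℝ x (A y)) (m : E → F) (y : E) :
    𝓕⁻ (fun ξ => m (A ξ)) y =
      |(LinearMap.det (A : E →ₗ[ℝ] E))⁻¹| • 𝓕⁻ m (A.symm y) := by
  rw [Real.fourierInv_eq', Real.fourierInv_eq', ← A.integral_comp_eq]
  congr 1
  ext ξ
  rw [hA, A.apply_symm_apply]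

theorem Real.fourier_comp_symmetric {F : Type*} [NormedAddCommGroup F] [NormedSpace ℂ F]
    (A : E ≃L[ℝ] E) (hA : ∀ x y, inner ℝ (A x) y = inner ℝ x (A y)) (m : E → F) (y : E) :
    𝓕 (fun ξ => m (A ξ)) y =
      |(LinearMap.det (A : E →ₗ[ℝ] E))⁻¹| • 𝓕 m (A.symm y) := by
  rw [Real.fourier_eq', Real.fourier_eq', ← A.integral_comp_eq]
  congr 1
  ext ξ
  rw [hA, A.apply_symm_apply]

/-- The inverse transform of `m ∘ A` is `|det A|⁻¹` times the inverse transform of `m` composed with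
`A⁻¹`, and this is exactly the `L¹`-preserving normalisation. -/
theorem SchwartzMap.lintegral_fourierInv_comp_symmetric (A : E ≃L[ℝ] E)
    (hA : ∀ x y, inner ℝ (A x) y = inner ℝ x (A y)) (m : 𝓢(E, ℂ)) :
    ∫⁻ y, ‖(𝓕⁻ (compCLMOfContinuousLinearEquiv ℂ A m)) y‖ₑ = ∫⁻ y, ‖(𝓕⁻ m) y‖ₑ := by
  have h1 : ∀ y, (𝓕⁻ (compCLMOfContinuousLinearEquiv ℂ A m)) y =
      |(LinearMap.det (A : E →ₗ[ℝ] E))⁻¹| • (𝓕⁻ m) (A.symm y) := by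
    intro y
    rw [fourierInv_coe, fourierInv_coe]
    exact Real.fourierInv_comp_symmetric A hA m y
  have h0 : LinearMap.det (A : E →ₗ[ℝ] E) ≠ 0 := (LinearEquiv.isUnit_det' A.toLinearEquiv).ne_zero
  have h2 : LinearMap.det (A.symm : E →ₗ[ℝ] E) = (LinearMap.det (A : E →ₗ[ℝ] E))⁻¹ :=
    LinearEquiv.det_coe_symm A.toLinearEquiv
  simp_rw [h1, enorm_smul]
  rw [lintegral_const_mul' _ _ enorm_ne_top, A.symm.lintegral_comp fun y => ‖(𝓕⁻ m : 𝓢(E, ℂ)) y‖ₑ, h2,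
    ← mul_assoc, Real.enorm_of_nonneg (abs_nonneg _), ← ENNReal.ofReal_mul (abs_nonneg _),
    ← abs_mul, inv_inv, inv_mul_cancel₀ h0]
  simp

end LinearChangeOfVariables

/-! ### Anisotropic dilations. -/

namespace Kinetic

variable {d : ℕ}

/-- The anisotropic dilation `(σ x₁, σ³ x₂)`. -/
noncomputable def scale (σ : ℝ) (hσ : 0 < σ) : Phase d ≃L[ℝ] Phase d :=
  ((WithLp.prodContinuousLinearEquiv 2 ℝ (EuclideanSpace ℝ (Fin d))
    (EuclideanSpace ℝ (Fin d))).trans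
    ((ContinuousLinearEquiv.smulLeft (Units.mk0 σ hσ.ne')).prodCongr
      (ContinuousLinearEquiv.smulLeft (Units.mk0 (σ ^ 3) (pow_pos hσ 3).ne')))).trans
    (WithLp.prodContinuousLinearEquiv 2 ℝ _ _).symm

theorem scale_apply {σ : ℝ} (hσ : 0 < σ) (x : Phase d) :
    scale σ hσ x = WithLp.toLp 2 (σ • x.fst, σ ^ 3 • x.snd) := rfl

@[simp]
theorem fst_scale {σ : ℝ} (hσ : 0 < σ) (x : Phase d) : (scale σ hσ x).fst = σ • x.fst := rfl

@[simp]
theorem snd_scale {σ : ℝ} (hσ : 0 < σ) (x : Phase d) : (scale σ hσ x).snd = σ ^ 3 • x.snd := rfl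

theorem phase_ext {x y : Phase d} (h1 : x.fst = y.fst) (h2 : x.snd = y.snd) : x = y := by
  apply (WithLp.equiv 2 _).injective
  exact Prod.ext h1 h2

theorem inner_scale {σ : ℝ} (hσ : 0 < σ) (x y : Phase d) :
    inner ℝ (scale σ hσ x) y = inner ℝ x (scale σ hσ y) := by
  simp only [WithLp.prod_inner_apply, scale_apply]
  simp [inner_smul_left, inner_smul_right]

theorem scale_scale {σ τ : ℝ} (hσ : 0 < σ) (hτ : 0 < τ) (x : Phase d) :
    scale σ hσ (scale τ hτ x) = scale (σ * τ) (mul_pos hσ hτ) x := by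
  apply phase_ext <;> simp [smul_smul, mul_pow]

theorem scale_smul {σ : ℝ} (hσ : 0 < σ) (c : ℝ) (x : Phase d) :
    scale σ hσ (c • x) = c • scale σ hσ x := map_smul _ _ _

theorem anisoNorm_scale {σ : ℝ} (hσ : 0 < σ) (x : Phase d) :
    anisoNorm (scale σ hσ x) = σ * anisoNorm x := by
  rw [anisoNorm, anisoNorm, fst_scale, snd_scale, norm_smul, norm_smul, norm_pow,
    Real.norm_of_nonneg hσ.le, Real.mul_rpow (by positivity) (norm_nonneg _), ← Real.rpow_natCast,
    ← Real.rpow_mul hσ.le]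
  norm_num
  ring

theorem dil_eq_scale (s : ℝ) (x : Phase d) :
    dil s x = scale (2 ^ s) (Real.rpow_pos_of_pos two_pos s) x := by
  apply phase_ext
  · rfl
  · rw [snd_scale, ← Real.rpow_natCast, ← Real.rpow_mul two_pos.le, mul_comm]
    rfl

/-- The symbol `ξ ↦ m (σ ξ₁, σ³ ξ₂)`. -/
noncomputable def scaleSymbol (σ : ℝ) (hσ : 0 < σ) (m : 𝓢(Phase d, ℂ)) : 𝓢(Phase d, ℂ) :=
  SchwartzMap.compCLMOfContinuousLinearEquiv ℂ (scale σ hσ) m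

@[simp]
theorem scaleSymbol_apply {σ : ℝ} (hσ : 0 < σ) (m : 𝓢(Phase d, ℂ)) (ξ : Phase d) :
    scaleSymbol σ hσ m ξ = m (scale σ hσ ξ) := rfl

theorem kernelNorm_scaleSymbol {σ : ℝ} (hσ : 0 < σ) (m : 𝓢(Phase d, ℂ)) :
    kernelNorm (scaleSymbol σ hσ m) = kernelNorm m :=
  SchwartzMap.lintegral_fourierInv_comp_symmetric _ (inner_scale hσ) m

end Kinetic

/-! ### The polynomials in the symbols of the time derivatives. -/

namespace Kinetic

/-- The value at `x` of the bivariate polynomial with coefficients `p`. -/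
noncomputable def polyEval (x : ℝ × ℝ) : (ℕ × ℕ →₀ ℝ) →ₗ[ℝ] ℝ :=
  Finsupp.linearCombination ℝ fun t => x.1 ^ t.1 * x.2 ^ t.2

/-- Multiplication by `-(s + 3 t)`. -/
noncomputable def polyMul : (ℕ × ℕ →₀ ℝ) →ₗ[ℝ] (ℕ × ℕ →₀ ℝ) :=
  Finsupp.linearCombination ℝ fun t =>
    -Finsupp.single (t.1 + 1, t.2) 1 - (3 : ℝ) • Finsupp.single (t.1, t.2 + 1) 1

/-- The operator `s ∂_s + 3 t ∂_t - n`. -/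
noncomputable def polyEuler (n : ℕ) : (ℕ × ℕ →₀ ℝ) →ₗ[ℝ] (ℕ × ℕ →₀ ℝ) :=
  Finsupp.linearCombination ℝ fun t =>
    ((t.1 + 3 * t.2 : ℝ) - n) • Finsupp.single t 1

/-- The polynomials with
`∂_v ^ n exp (-(a v + b v³)) = v⁻ⁿ p_n(a v, b v³) exp (-(a v + b v³))`. -/
noncomputable def gaussPoly : ℕ → (ℕ × ℕ →₀ ℝ)
  | 0 => Finsupp.single (0, 0) 1
  | n + 1 => polyEuler n (gaussPoly n) + polyMul (gaussPoly n)

/-- The leading part of `gaussPoly`. -/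
noncomputable def gaussPolyTop : ℕ → (ℕ × ℕ →₀ ℝ)
  | 0 => Finsupp.single (0, 0) 1
  | n + 1 => polyMul (gaussPolyTop n)

theorem map_mem_supported {T : (ℕ × ℕ →₀ ℝ) →ₗ[ℝ] (ℕ × ℕ →₀ ℝ)} {A B : Set (ℕ × ℕ)}
    (h : ∀ t ∈ A, T (Finsupp.single t 1) ∈ Finsupp.supported ℝ ℝ B) {p : ℕ × ℕ →₀ ℝ}
    (hp : p ∈ Finsupp.supported ℝ ℝ A) : T p ∈ Finsupp.supported ℝ ℝ B := by
  rw [Finsupp.supported_eq_span_single] at hp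
  induction hp using Submodule.span_induction with
  | mem x hx => obtain ⟨t, ht, rfl⟩ := hx; exact h t ht
  | zero => simp
  | add x y _ _ hx hy => rw [map_add]; exact add_mem hx hy
  | smul c x _ hx => rw [map_smul]; exact Submodule.smul_mem _ _ hx

theorem polyMul_mem {A B : Set (ℕ × ℕ)} (h1 : ∀ t ∈ A, (t.1 + 1, t.2) ∈ B)
    (h2 : ∀ t ∈ A, (t.1, t.2 + 1) ∈ B) {p : ℕ × ℕ →₀ ℝ} (hp : p ∈ Finsupp.supported ℝ ℝ A) :
    polyMul p ∈ Finsupp.supported ℝ ℝ B := by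
  refine map_mem_supported (fun t ht => ?_) hp
  rw [polyMul, Finsupp.linearCombination_single, one_smul]
  exact sub_mem (neg_mem (Finsupp.single_mem_supported ℝ _ (h1 t ht)))
    (Submodule.smul_mem _ _ (Finsupp.single_mem_supported ℝ _ (h2 t ht)))

/-- Monomials are eigenvectors of `polyEuler n` with eigenvalue `t.1 + 3 * t.2 - n`, so those of
weight exactly `n` are killed. -/
theorem polyEuler_mem (n : ℕ) {A B : Set (ℕ × ℕ)}
    (h : ∀ t ∈ A, t.1 + 3 * t.2 ≠ n → t ∈ B) {p : ℕ × ℕ →₀ ℝ}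
    (hp : p ∈ Finsupp.supported ℝ ℝ A) : polyEuler n p ∈ Finsupp.supported ℝ ℝ B := by
  refine map_mem_supported (fun t ht => ?_) hp
  rw [polyEuler, Finsupp.linearCombination_single, one_smul]
  by_cases h0 : t.1 + 3 * t.2 = n
  · have : (t.1 + 3 * t.2 : ℝ) - n = 0 := by rw [← h0]; push_cast; ring
    rw [this, zero_smul]
    exact zero_mem _
  · exact Submodule.smul_mem _ _ (Finsupp.single_mem_supported ℝ _ (h t ht h0))

/-- Source of the gain at low frequencies. In the recursion `polyEuler n` removes the weight `n`,
and `polyMul` raises weights by `1` or `3`, so the minimal weight grows with each derivative. -/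
theorem gaussPoly_mem_supported (n : ℕ) :
    gaussPoly n ∈ Finsupp.supported ℝ ℝ {t : ℕ × ℕ | n ≤ t.1 + 3 * t.2} := by
  induction n with
  | zero => exact Finsupp.single_mem_supported ℝ _ (by simp)
  | succ n ih =>
    refine add_mem (polyEuler_mem n (fun t ht h => ?_) ih) (polyMul_mem ?_ ?_ ih)
    · simp only [Set.mem_ofPred_eq] at ht ⊢; omega
    · intro t ht; simp only [Set.mem_ofPred_eq] at ht ⊢; omega
    · intro t ht; simp only [Set.mem_ofPred_eq] at ht ⊢; omega

theorem gaussPolyTop_mem_supported (n : ℕ) :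
    gaussPolyTop n ∈ Finsupp.supported ℝ ℝ {t : ℕ × ℕ | t.1 + t.2 ≤ n} := by
  induction n with
  | zero => exact Finsupp.single_mem_supported ℝ _ (by simp)
  | succ n ih =>
    refine polyMul_mem ?_ ?_ ih
    · intro t ht; simp only [Set.mem_ofPred_eq] at ht ⊢; omega
    · intro t ht; simp only [Set.mem_ofPred_eq] at ht ⊢; omega

/-- `polyEuler` does not raise the ordinary degree `t.1 + t.2`; only the `polyMul` terms reach
degree `n`. -/
theorem gaussPoly_sub_top_mem_supported (n : ℕ) :
    gaussPoly n - gaussPolyTop n ∈ Finsupp.supported ℝ ℝ {t : ℕ × ℕ | t.1 + t.2 < n} := by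
  induction n with
  | zero => simp [gaussPoly, gaussPolyTop]
  | succ n ih =>
    have e : gaussPoly (n + 1) - gaussPolyTop (n + 1) =
        polyEuler n (gaussPolyTop n) + polyEuler n (gaussPoly n - gaussPolyTop n) +
          polyMul (gaussPoly n - gaussPolyTop n) := by
      simp only [gaussPoly, gaussPolyTop, map_sub]
      abel
    rw [e]
    refine add_mem (add_mem (polyEuler_mem n (fun t ht h => ?_) (gaussPolyTop_mem_supported n))
      (polyEuler_mem n (fun t ht h => ?_) ih)) (polyMul_mem ?_ ?_ ih)
    · simp only [Set.mem_ofPred_eq] at ht ⊢; omega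
    · simp only [Set.mem_ofPred_eq] at ht ⊢; omega
    · intro t ht; simp only [Set.mem_ofPred_eq] at ht ⊢; omega
    · intro t ht; simp only [Set.mem_ofPred_eq] at ht ⊢; omega

theorem polyEval_single (x : ℝ × ℝ) (t : ℕ × ℕ) (c : ℝ) :
    polyEval x (Finsupp.single t c) = c * (x.1 ^ t.1 * x.2 ^ t.2) := by
  rw [polyEval, Finsupp.linearCombination_single, smul_eq_mul]

theorem polyEval_polyMul (x : ℝ × ℝ) (p : ℕ × ℕ →₀ ℝ) :
    polyEval x (polyMul p) = -(x.1 + 3 * x.2) * polyEval x p := by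
  induction p using Finsupp.induction_linear with
  | zero => simp
  | add f g hf hg => rw [map_add, map_add, hf, hg, map_add]; ring
  | single t c =>
    rw [polyMul, Finsupp.linearCombination_single, map_smul, map_sub, map_neg, map_smul]
    simp only [polyEval_single, smul_eq_mul]
    ring

theorem polyEval_gaussPolyTop (x : ℝ × ℝ) (n : ℕ) :
    polyEval x (gaussPolyTop n) = (-(x.1 + 3 * x.2)) ^ n := by
  induction n with
  | zero => simp [gaussPolyTop, polyEval_single]
  | succ n ih => rw [gaussPolyTop, polyEval_polyMul, ih, pow_succ]; ring

theorem hasDerivAt_polyEval (a b : ℝ) {v : ℝ} (hv : 0 < v) (n : ℕ) (p : ℕ × ℕ →₀ ℝ) :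
    HasDerivAt (fun v => v⁻¹ ^ n * polyEval (a * v, b * v ^ 3) p)
      (v⁻¹ ^ (n + 1) * polyEval (a * v, b * v ^ 3) (polyEuler n p)) v := by
  induction p using Finsupp.induction_linear with
  | zero => simpa using hasDerivAt_const v (0 : ℝ)
  | add f g hf hg =>
    simp only [map_add, mul_add]
    exact hf.add hg
  | single t c =>
    obtain ⟨i, k⟩ := t
    have h1 : HasDerivAt (fun u : ℝ => u⁻¹) (-(v⁻¹) ^ 2) v := by
      simpa using hasDerivAt_inv hv.ne'
    have h2 := h1.pow n
    have h3 : HasDerivAt (fun u : ℝ => u ^ (i + 3 * k)) ((i + 3 * k : ℕ) * v ^ (i + 3 * k - 1)) v :=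
      hasDerivAt_pow _ v
    have h4 := (h2.mul h3).const_mul (c * (a ^ i * b ^ k))
    have e : (fun v => v⁻¹ ^ n * polyEval (a * v, b * v ^ 3) (Finsupp.single (i, k) c)) =
        fun u => c * (a ^ i * b ^ k) * ((((fun u : ℝ => u⁻¹) ^ n) * (fun u : ℝ => u ^ (i + 3 * k)) : ℝ → ℝ) u) := by
      funext u
      simp only [polyEval_single, Pi.mul_apply, Pi.pow_apply]
      rw [mul_pow, mul_pow, ← pow_mul]
      ring
    rw [e]
    refine h4.congr_deriv ?_
    rw [polyEuler, Finsupp.linearCombination_single, map_smul, map_smul, polyEval_single]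
    simp only [smul_eq_mul, Pi.pow_apply]
    have h5 : ((i + 3 * k : ℕ) : ℝ) * v ^ (i + 3 * k - 1) =
        (i + 3 * k : ℝ) * (v⁻¹ * v ^ (i + 3 * k)) := by
      rcases Nat.eq_zero_or_pos (i + 3 * k) with h0 | h0
      · rw [h0]
        have : (i + 3 * k : ℝ) = 0 := by exact_mod_cast h0
        rw [this]; simp
      · obtain ⟨m, hm⟩ := Nat.exists_eq_succ_of_ne_zero h0.ne'
        rw [hm, Nat.succ_sub_one, pow_succ]
        have : (i + 3 * k : ℝ) = (m.succ : ℕ) := by rw [← hm]; push_cast; ring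
        rw [this]
        field_simp
    have h6 : (n : ℝ) * v⁻¹ ^ (n - 1) * (v⁻¹ ^ 2) = n * (v⁻¹ * v⁻¹ ^ n) := by
      rcases n with _ | n
      · simp
      · rw [Nat.succ_sub_one]; push_cast; ring
    rw [h5]
    calc _ = c * (a ^ i * b ^ k) * (-(n * v⁻¹ ^ (n - 1) * (v⁻¹ ^ 2)) * v ^ (i + 3 * k) +
          v⁻¹ ^ n * ((i + 3 * k) * (v⁻¹ * v ^ (i + 3 * k)))) := by ring
      _ = _ := by
        rw [h6, mul_pow, mul_pow, ← pow_mul]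
        ring

theorem hasDerivAt_gaussPoly (a b : ℝ) {v : ℝ} (hv : 0 < v) (n : ℕ) :
    HasDerivAt
      (fun v => v⁻¹ ^ n * polyEval (a * v, b * v ^ 3) (gaussPoly n) * Real.exp (-(a * v + b * v ^ 3)))
      (v⁻¹ ^ (n + 1) * polyEval (a * v, b * v ^ 3) (gaussPoly (n + 1)) *
        Real.exp (-(a * v + b * v ^ 3))) v := by
  have h1 : HasDerivAt (fun v : ℝ => -(a * v + b * v ^ 3)) (-(a + 3 * b * v ^ 2)) v := by
    have := (((hasDerivAt_id v).const_mul a).add ((hasDerivAt_pow 3 v).const_mul b)).neg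
    refine this.congr_deriv ?_
    push_cast; ring
  refine ((hasDerivAt_polyEval a b hv n (gaussPoly n)).mul h1.exp).congr_deriv ?_
  rw [gaussPoly, map_add, polyEval_polyMul]
  have : v⁻¹ ^ n = v⁻¹ ^ (n + 1) * v := by
    rw [pow_succ, mul_assoc, inv_mul_cancel₀ hv.ne', mul_one]
  rw [this]
  ring

/-- The extra factor `s + t` expresses degree at most `n - 1` without natural subtraction, and
includes `n = 0`. -/
theorem exists_abs_polyEval_mul_le {n : ℕ} {p : ℕ × ℕ →₀ ℝ}
    (hp : p ∈ Finsupp.supported ℝ ℝ {t : ℕ × ℕ | t.1 + t.2 < n}) :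
    ∃ C : ℝ, 0 ≤ C ∧ ∀ s t : ℝ, 0 ≤ s → 0 ≤ t → 1 ≤ s + t →
      |polyEval (s, t) p| * (s + t) ≤ C * (s + t) ^ n := by
  rw [Finsupp.supported_eq_span_single] at hp
  induction hp using Submodule.span_induction with
  | mem x hx =>
    obtain ⟨⟨i, k⟩, ht, rfl⟩ := hx
    refine ⟨1, zero_le_one, fun s t hs ht' h1 => ?_⟩
    simp only [Set.mem_ofPred_eq] at ht
    rw [polyEval_single, one_mul, one_mul, abs_of_nonneg (by positivity)]
    calc s ^ i * t ^ k * (s + t) ≤ (s + t) ^ i * (s + t) ^ k * (s + t) := by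
          gcongr <;> linarith
      _ = (s + t) ^ (i + k + 1) := by ring
      _ ≤ (s + t) ^ n := pow_le_pow_right₀ h1 ht
  | zero => exact ⟨0, le_rfl, by simp⟩
  | add x y _ _ hx hy =>
    obtain ⟨C, hC, hx⟩ := hx
    obtain ⟨D, hD, hy⟩ := hy
    refine ⟨C + D, add_nonneg hC hD, fun s t hs ht h1 => ?_⟩
    rw [map_add]
    calc _ ≤ (|polyEval (s, t) x| + |polyEval (s, t) y|) * (s + t) := by
          gcongr; exact abs_add_le _ _
      _ ≤ _ := by
          rw [add_mul, add_mul]; exact add_le_add (hx s t hs ht h1) (hy s t hs ht h1)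
  | smul c x _ hx =>
    obtain ⟨C, hC, hx⟩ := hx
    refine ⟨|c| * C, by positivity, fun s t hs ht h1 => ?_⟩
    rw [map_smul, smul_eq_mul, abs_mul, mul_assoc, mul_assoc]
    exact mul_le_mul_of_nonneg_left (hx s t hs ht h1) (abs_nonneg c)

/-- `gaussPoly` does not vanish far away in the positive quadrant. -/
theorem exists_gaussPoly_ne_zero (n : ℕ) :
    ∃ R : ℝ, 0 < R ∧ ∀ s t : ℝ, 0 ≤ s → 0 ≤ t → R ≤ s + t →
      polyEval (s, t) (gaussPoly n) ≠ 0 := by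
  obtain ⟨C, hC, h⟩ := exists_abs_polyEval_mul_le (gaussPoly_sub_top_mem_supported n)
  refine ⟨C + 1, by positivity, fun s t hs ht hR h0 => ?_⟩
  -- At a zero of `gaussPoly n` the remainder equals the leading part `(s + 3t)^n ≥ (s + t)^n` in
  -- absolute value, so `s + t ≤ C`, against `s + t ≥ C + 1`.
  have h1 := h s t hs ht (by linarith)
  rw [map_sub, h0, zero_sub, abs_neg, polyEval_gaussPolyTop, abs_pow, abs_neg,
    abs_of_nonneg (by positivity)] at h1
  have h2 : (s + t) ^ n ≤ (s + 3 * t) ^ n := by gcongr; linarith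
  have h3 : 0 < (s + t) ^ n := pow_pos (by linarith) n
  have h4 : (s + t) ^ n * (s + t) ≤ C * (s + t) ^ n :=
    (mul_le_mul_of_nonneg_right h2 (by linarith)).trans h1
  nlinarith

end Kinetic

/-! ### Fourier transform of the Gaussian kernel and of its time derivatives. -/

namespace Kinetic

variable {d : ℕ}

theorem det_scale {σ : ℝ} (hσ : 0 < σ) :
    LinearMap.det (scale (d := d) σ hσ : Phase d →ₗ[ℝ] Phase d) = σ ^ (4 * d) := by
  let f : EuclideanSpace ℝ (Fin d) →ₗ[ℝ] EuclideanSpace ℝ (Fin d) := σ • LinearMap.id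
  let g : EuclideanSpace ℝ (Fin d) →ₗ[ℝ] EuclideanSpace ℝ (Fin d) := σ ^ 3 • LinearMap.id
  have h1 := LinearMap.det_conj (f.prodMap g)
    (WithLp.linearEquiv 2 ℝ (EuclideanSpace ℝ (Fin d) × EuclideanSpace ℝ (Fin d))).symm
  refine Eq.trans ?_ (h1.trans ?_)
  · rfl
  · rw [LinearMap.det_prodMap]
    simp only [f, g, LinearMap.det_smul, LinearMap.det_id, finrank_euclideanSpace,
      Fintype.card_fin]
    ring

theorem finrank_phase : Module.finrank ℝ (Phase d) = 2 * d := by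
  rw [(WithLp.linearEquiv 2 ℝ
    (EuclideanSpace ℝ (Fin d) × EuclideanSpace ℝ (Fin d))).finrank_eq]
  simp [two_mul]

theorem scale_symm {σ : ℝ} (hσ : 0 < σ) (x : Phase d) :
    (scale σ⁻¹ (inv_pos.2 hσ)).symm x = scale σ hσ x := by
  rw [ContinuousLinearEquiv.symm_apply_eq, scale_scale]
  apply phase_ext <;> simp [inv_mul_cancel₀ hσ.ne']

theorem norm_scale_sq {σ : ℝ} (hσ : 0 < σ) (x : Phase d) :
    ‖scale σ hσ x‖ ^ 2 = ‖x.fst‖ ^ 2 * σ ^ 2 + ‖x.snd‖ ^ 2 * (σ ^ 2) ^ 3 := by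
  rw [WithLp.prod_norm_sq_eq_of_L2, fst_scale, snd_scale, norm_smul, norm_smul,
    Real.norm_of_nonneg hσ.le, Real.norm_of_nonneg (pow_nonneg hσ.le 3)]
  ring

/-- The exponent is `‖scale (√v)⁻¹ z‖ ^ 2`, so the kernel is a dilated isotropic Gaussian. The
Jacobian `v ^ (2 * d)` cancels the normalisation in `v`, and `π ^ d / (2π) ^ d` leaves `(1 / 2) ^
d`. -/
theorem fourier_kolmogorovGaussian {v : ℝ} (hv : 0 < v) (ξ : Phase d) :
    𝓕 (fun z : Phase d => (kolmogorovGaussian d 1 v z : ℂ)) ξ =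
      (((1 / 2) ^ d * Real.exp (-(Real.pi ^ 2 * ‖ξ.fst‖ ^ 2 * v + Real.pi ^ 2 * ‖ξ.snd‖ ^ 2 * v ^ 3)) : ℝ) : ℂ) := by
  have hs : 0 < √v := Real.sqrt_pos.2 hv
  have hsv : (√v) ^ 2 = v := Real.sq_sqrt hv.le
  set c : ℝ := 1 / ((2 * Real.pi * 1) ^ d * v ^ (2 * d)) with hc
  have e1 : (fun z : Phase d => (kolmogorovGaussian d 1 v z : ℂ)) =
      fun z => ((c : ℂ) • fun z : Phase d => Complex.exp (-1 * ‖z‖ ^ 2))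
        (scale (√v)⁻¹ (inv_pos.2 hs) z) := by
    funext z
    rw [Pi.smul_apply, smul_eq_mul, kolmogorovGaussian, Complex.ofReal_mul, ← hc]
    congr 1
    rw [Complex.ofReal_exp]
    congr 1
    have := norm_scale_sq (inv_pos.2 hs) z
    rw [inv_pow, hsv] at this
    rw [← Complex.ofReal_pow, this]
    push_cast
    rw [one_mul, one_mul]
    field_simp
  have e2 : 𝓕 ((c : ℂ) • fun z : Phase d => Complex.exp (-1 * ‖z‖ ^ 2)) (scale (√v) hs ξ) =
      (c : ℂ) * ((Real.pi : ℂ) ^ d * Complex.exp (-Real.pi ^ 2 * ‖scale (√v) hs ξ‖ ^ 2)) := by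
    have h1 := fourier_gaussian_innerProductSpace (b := 1) (by simp) (scale (√v) hs ξ)
    rw [finrank_phase] at h1
    have h2 : ((2 * d : ℕ) : ℂ) / 2 = (d : ℕ) := by push_cast; ring
    rw [h2, Complex.cpow_natCast, div_one, div_one] at h1
    rw [← h1, Real.fourier_eq', Real.fourier_eq', ← integral_const_mul]
    refine integral_congr_ae (.of_forall fun z => ?_)
    simp only [Pi.smul_apply, smul_eq_mul]
    ring
  rw [e1, Real.fourier_comp_symmetric _ (inner_scale _), scale_symm hs, det_scale, e2]
  have e3 : (√v) ^ (4 * d) = v ^ (2 * d) := by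
    rw [show 4 * d = 2 * (2 * d) by ring, pow_mul, hsv]
  rw [inv_pow, inv_inv, e3, abs_of_nonneg (by positivity)]
  have e4 : Complex.exp (-Real.pi ^ 2 * ‖scale (√v) hs ξ‖ ^ 2) = ((Real.exp
      (-(Real.pi ^ 2 * ‖ξ.fst‖ ^ 2 * v + Real.pi ^ 2 * ‖ξ.snd‖ ^ 2 * v ^ 3)) : ℝ) : ℂ) := by
    rw [Complex.ofReal_exp]
    congr 1
    rw [← Complex.ofReal_pow ‖scale (√v) hs ξ‖, norm_scale_sq hs, hsv]
    push_cast
    ring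
  rw [e4, ← Complex.ofReal_pow, ← Complex.ofReal_mul, ← Complex.ofReal_mul, Complex.real_smul,
    ← Complex.ofReal_mul]
  congr 1
  rw [hc]
  have : 0 < Real.pi := Real.pi_pos
  have h2 : (1 / 2 : ℝ) ^ d * 2 ^ d = 1 := by rw [← mul_pow]; norm_num
  field_simp
  rw [mul_pow]
  linear_combination (-Real.pi ^ d) * h2

/-- A bound uniform for `u` near `v`, as needed for differentiating under the integral: the
exponential increases with `u`, and `u⁻¹ ≤ 4 (2v)⁻¹`. -/
theorem gaussMonomial_le {v u : ℝ} (hv : 0 < v) (h1 : v / 2 < u) (h2 : u < 2 * v)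
    (t : ℕ × ℕ × ℕ) (z : Phase d) :
    |gaussMonomial d t u z| ≤ 4 ^ t.1 * gaussMonomial d t (2 * v) z := by
  have hu : 0 < u := by linarith
  have h3 : (2 * v)⁻¹ ≤ u⁻¹ := inv_anti₀ hu h2.le
  have h4 : u⁻¹ ≤ 4 * (2 * v)⁻¹ := by
    have := inv_anti₀ (by positivity) h1.le
    refine this.trans (le_of_eq ?_)
    field_simp
    norm_num
  have h5 : 0 < (2 * v)⁻¹ := by positivity
  have h6 : 0 < u⁻¹ := by positivity
  unfold gaussMonomial
  rw [abs_of_nonneg (by positivity)]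
  calc _ ≤ (4 * (2 * v)⁻¹) ^ t.1 * ((‖z.fst‖ ^ 2) ^ t.2.1 * (‖z.snd‖ ^ 2) ^ t.2.2) *
      Real.exp (-(‖z.fst‖ ^ 2 * (2 * v)⁻¹ + ‖z.snd‖ ^ 2 * (2 * v)⁻¹ ^ 3)) := by gcongr
    _ = _ := by rw [mul_pow]; ring

theorem exists_integrable_bound {h : ℝ → Phase d → ℝ} (hh : h ∈ gaussSpan d) {v : ℝ}
    (hv : 0 < v) : ∃ b : Phase d → ℝ, Integrable b ∧
      ∀ u ∈ Set.Ioo (v / 2) (2 * v), ∀ z, |h u z| ≤ b z := by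
  induction hh using Submodule.span_induction with
  | mem x hx =>
    obtain ⟨t, rfl⟩ := hx
    refine ⟨fun z => 4 ^ t.1 * gaussMonomial d t (2 * v) z, ?_,
      fun u hu z => gaussMonomial_le hv hu.1 hu.2 t z⟩
    obtain ⟨s, hs⟩ := exists_schwartz_of_mem_gaussSpan
      (Submodule.subset_span ⟨t, rfl⟩ : gaussMonomial d t ∈ gaussSpan d)
      (show 0 < 2 * v by positivity)
    have h1 := s.integrable (μ := volume).re
    refine Integrable.const_mul (h1.congr (.of_forall fun z => ?_)) _
    simp [hs z]
  | zero => exact ⟨fun _ => 0, integrable_zero _ _ _, by simp⟩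
  | add x y _ _ hx hy =>
    obtain ⟨b, hb, hx⟩ := hx
    obtain ⟨c, hc, hy⟩ := hy
    refine ⟨fun z => b z + c z, hb.add hc, fun u hu z => ?_⟩
    exact (abs_add_le _ _).trans (add_le_add (hx u hu z) (hy u hu z))
  | smul r x _ hx =>
    obtain ⟨b, hb, hx⟩ := hx
    refine ⟨fun z => |r| * b z, hb.const_mul _, fun u hu z => ?_⟩
    rw [Pi.smul_apply, Pi.smul_apply, smul_eq_mul, abs_mul]
    exact mul_le_mul_of_nonneg_left (hx u hu z) (abs_nonneg r)

theorem hasDerivAt_fourier_of_mem_gaussSpan {h h' : ℝ → Phase d → ℝ} (hh : h ∈ gaussSpan d)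
    (hh' : h' ∈ gaussSpan d) (hd : ∀ u, 0 < u → ∀ z, HasDerivAt (fun u => h u z) (h' u z) u)
    (ξ : Phase d) {v : ℝ} (hv : 0 < v) :
    HasDerivAt (fun u => 𝓕 (fun z => (h u z : ℂ)) ξ) (𝓕 (fun z => (h' v z : ℂ)) ξ) v := by
  obtain ⟨b, hb, hle⟩ := exists_integrable_bound hh' hv
  have hint : ∀ g ∈ gaussSpan d, ∀ u : ℝ, 0 < u →
      Integrable (fun z : Phase d => Complex.exp (↑(-2 * Real.pi * inner ℝ z ξ) * Complex.I) •
        (g u z : ℂ)) := by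
    intro g hg u hu
    obtain ⟨s, hs⟩ := exists_schwartz_of_mem_gaussSpan hg hu
    have h1 := (Real.fourierIntegral_convergent_iff (μ := volume) (f := s) ξ).2 s.integrable
    refine h1.congr (.of_forall fun z => ?_)
    simp only [hs z, Circle.smul_def, Real.fourierChar_apply]
    congr 3
    push_cast
    ring
  simp only [Real.fourier_eq']
  refine (hasDerivAt_integral_of_dominated_loc_of_deriv_le (bound := b)
    (s := Set.Ioo (v / 2) (2 * v)) (Ioo_mem_nhds (by linarith) (by linarith))
    ?_ (hint h hh v hv) (F' := fun u z =>
      Complex.exp (↑(-2 * Real.pi * inner ℝ z ξ) * Complex.I) • (h' u z : ℂ))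
    (hint h' hh' v hv).aestronglyMeasurable ?_ hb ?_).2
  · filter_upwards [lt_mem_nhds hv] with u hu
    exact (hint h hh u hu).aestronglyMeasurable
  · refine .of_forall fun z u hu => ?_
    rw [norm_smul, Complex.norm_exp_ofReal_mul_I, one_mul, Complex.norm_real]
    exact hle u hu z
  · refine .of_forall fun z u hu => ?_
    have := (hd u (by linarith [hu.1]) z).ofReal_comp
    exact this.const_smul (Complex.exp (↑(-2 * Real.pi * inner ℝ z ξ) * Complex.I))

theorem hasDerivAt_fourier_gaussianTimeDeriv (n : ℕ) (ξ : Phase d) {v : ℝ} (hv : 0 < v) :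
    HasDerivAt (fun u => 𝓕 (fun z : Phase d => (gaussianTimeDeriv d n u z : ℂ)) ξ)
      (𝓕 (fun z : Phase d => (gaussianTimeDeriv d (n + 1) v z : ℂ)) ξ) v := by
  obtain ⟨h, hh, he⟩ := exists_gaussianTimeDeriv_eq d n
  obtain ⟨h', hh', hd⟩ := exists_deriv_mem_gaussSpan hh
  have he' : ∀ z, gaussianTimeDeriv d (n + 1) v z = h' v z := by
    intro z
    rw [gaussianTimeDeriv, iteratedDeriv_succ, ← (hd v hv z).deriv]
    apply Filter.EventuallyEq.deriv_eq
    filter_upwards [lt_mem_nhds hv] with u hu using he u hu z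
  simp only [he']
  refine (hasDerivAt_fourier_of_mem_gaussSpan hh hh' hd ξ hv).congr_of_eventuallyEq ?_
  filter_upwards [lt_mem_nhds hv] with u hu
  simp only [he u hu]

theorem fourier_gaussianTimeDeriv (n : ℕ) (ξ : Phase d) {v : ℝ} (hv : 0 < v) :
    𝓕 (fun z : Phase d => (gaussianTimeDeriv d n v z : ℂ)) ξ =
      (((1 / 2) ^ d * (v⁻¹ ^ n * polyEval (Real.pi ^ 2 * ‖ξ.fst‖ ^ 2 * v,
        Real.pi ^ 2 * ‖ξ.snd‖ ^ 2 * v ^ 3) (gaussPoly n) *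
        Real.exp (-(Real.pi ^ 2 * ‖ξ.fst‖ ^ 2 * v + Real.pi ^ 2 * ‖ξ.snd‖ ^ 2 * v ^ 3))) : ℝ) : ℂ) := by
  induction n generalizing v with
  | zero =>
    have h0 : ∀ z, gaussianTimeDeriv d 0 v z = kolmogorovGaussian d 1 v z := fun z => by
      rw [gaussianTimeDeriv, iteratedDeriv_zero]
    simp only [h0, fourier_kolmogorovGaussian hv]
    simp [gaussPoly, polyEval_single]
  | succ n ih =>
    have h1 := hasDerivAt_fourier_gaussianTimeDeriv n ξ hv
    have h2 := ((hasDerivAt_gaussPoly (Real.pi ^ 2 * ‖ξ.fst‖ ^ 2) (Real.pi ^ 2 * ‖ξ.snd‖ ^ 2)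
      hv n).const_mul ((1 / 2 : ℝ) ^ d)).ofReal_comp
    -- The two sides of the formula of order `n` agree at all times near `v`, so their derivatives
    -- at `v` coincide.
    refine h1.unique (h2.congr_of_eventuallyEq ?_)
    filter_upwards [lt_mem_nhds hv] with u hu using ih hu

/-- The symbol of `∂_v ^ n g(v, ·)` at `v = 1`. -/
noncomputable def gaussSymbol (d n : ℕ) : 𝓢(Phase d, ℂ) := 𝓕 (thermicKernel d n 1)

theorem fourier_thermicKernel_apply (n : ℕ) {v : ℝ} (hv : 0 < v) (ξ : Phase d) :
    (𝓕 (thermicKernel d n v)) ξ = (((1 / 2) ^ d * (v⁻¹ ^ n * polyEval (Real.pi ^ 2 * ‖ξ.fst‖ ^ 2 * v,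
        Real.pi ^ 2 * ‖ξ.snd‖ ^ 2 * v ^ 3) (gaussPoly n) *
        Real.exp (-(Real.pi ^ 2 * ‖ξ.fst‖ ^ 2 * v + Real.pi ^ 2 * ‖ξ.snd‖ ^ 2 * v ^ 3))) : ℝ) : ℂ) := by
  rw [SchwartzMap.fourier_coe, ← fourier_gaussianTimeDeriv n ξ hv,
    funext fun z => thermicKernel_apply d n hv z]

theorem gaussSymbol_apply (n : ℕ) (ξ : Phase d) :
    gaussSymbol d n ξ = (((1 / 2) ^ d * (polyEval (Real.pi ^ 2 * ‖ξ.fst‖ ^ 2,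
        Real.pi ^ 2 * ‖ξ.snd‖ ^ 2) (gaussPoly n) *
        Real.exp (-(Real.pi ^ 2 * ‖ξ.fst‖ ^ 2 + Real.pi ^ 2 * ‖ξ.snd‖ ^ 2))) : ℝ) : ℂ) := by
  rw [gaussSymbol, fourier_thermicKernel_apply n one_pos]
  simp

/-- Self-similarity: time `v` enters only through the dilation by `√v` and the factor `v⁻ⁿ`, which
reduces all times to `v = 1`. -/
theorem fourier_thermicKernel (n : ℕ) {v : ℝ} (hv : 0 < v) :
    𝓕 (thermicKernel d n v) =
      ((v⁻¹ ^ n : ℝ) : ℂ) • scaleSymbol (√v) (Real.sqrt_pos.2 hv) (gaussSymbol d n) := by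
  ext ξ
  have hsv : (√v) ^ 2 = v := Real.sq_sqrt hv.le
  have h3 : ((√v) ^ 3) ^ 2 = v ^ 3 := by rw [← pow_mul, mul_comm 3 2, pow_mul, hsv]
  rw [fourier_thermicKernel_apply n hv, smul_apply, scaleSymbol_apply, gaussSymbol_apply,
    smul_eq_mul, ← Complex.ofReal_mul]
  congr 1
  rw [fst_scale, snd_scale, norm_smul, norm_smul, mul_pow, mul_pow, norm_pow,
    Real.norm_of_nonneg (Real.sqrt_nonneg v), hsv, h3]
  have e1 : Real.pi ^ 2 * (v * ‖ξ.fst‖ ^ 2) = Real.pi ^ 2 * ‖ξ.fst‖ ^ 2 * v := by ring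
  have e2 : Real.pi ^ 2 * (v ^ 3 * ‖ξ.snd‖ ^ 2) = Real.pi ^ 2 * ‖ξ.snd‖ ^ 2 * v ^ 3 := by ring
  rw [e1, e2]
  ring

end Kinetic

/-! ### Calculus of symbols and `L¹` norms of their kernels. -/

namespace Kinetic

variable {d : ℕ}

/-- The product of two symbols. -/
noncomputable def symMul (h m : 𝓢(Phase d, ℂ)) : 𝓢(Phase d, ℂ) :=
  SchwartzMap.pairing (ContinuousLinearMap.mul ℂ ℂ) h m

@[simp]
theorem symMul_apply (h m : 𝓢(Phase d, ℂ)) (ξ : Phase d) : symMul h m ξ = h ξ * m ξ := rfl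

theorem kernelNorm_eq (h : 𝓢(Phase d, ℂ)) : kernelNorm h = ∫⁻ y, ‖(𝓕⁻ h : 𝓢(Phase d, ℂ)) y‖ₑ := rfl

/-- The kernel of a product is the convolution of the kernels; this is Young's inequality with `p =
1`. -/
theorem kernelNorm_symMul_le (h m : 𝓢(Phase d, ℂ)) :
    kernelNorm (symMul h m) ≤ kernelNorm h * kernelNorm m := by
  have h1 := eLpNorm_integral_smul_sub_le (μ := volume) (𝓕⁻ h : 𝓢(Phase d, ℂ)).continuous
    (𝓕⁻ m : 𝓢(Phase d, ℂ)).continuous (p := 1) le_rfl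
  rw [eLpNorm_one_eq_lintegral_enorm, eLpNorm_one_eq_lintegral_enorm] at h1
  refine le_trans (le_of_eq ?_) h1
  rw [kernelNorm_eq]
  refine lintegral_congr fun z => ?_
  rw [SchwartzMap.fourierInv_mul_apply (fun ξ => symMul_apply h m ξ)]
  rfl

theorem kernelNorm_add_le (h m : 𝓢(Phase d, ℂ)) :
    kernelNorm (h + m) ≤ kernelNorm h + kernelNorm m := by
  simp only [kernelNorm_eq]
  rw [← lintegral_add_left (𝓕⁻ h : 𝓢(Phase d, ℂ)).continuous.enorm.measurable,
    FourierTransform.fourierInv_add]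
  exact lintegral_mono fun y => enorm_add_le _ _

theorem kernelNorm_smul (c : ℂ) (h : 𝓢(Phase d, ℂ)) :
    kernelNorm (c • h) = ‖c‖ₑ * kernelNorm h := by
  simp only [kernelNorm_eq]
  rw [FourierTransform.fourierInv_smul, ← lintegral_const_mul' _ _ enorm_ne_top]
  refine lintegral_congr fun y => ?_
  rw [smul_apply, enorm_smul]

theorem kernelNorm_zero : kernelNorm (0 : 𝓢(Phase d, ℂ)) = 0 := by
  simpa using kernelNorm_smul 0 (0 : 𝓢(Phase d, ℂ))

/-! ### Polynomial multiples of the Gaussian symbol -/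

/-- The monomial `(π² |ξ₁|²) ^ i (π² |ξ₂|²) ^ k`. -/
noncomputable def monoSymbol (t : ℕ × ℕ) (ξ : Phase d) : ℝ :=
  (Real.pi ^ 2 * ‖ξ.fst‖ ^ 2) ^ t.1 * (Real.pi ^ 2 * ‖ξ.snd‖ ^ 2) ^ t.2

theorem hasTemperateGrowth_norm_fst_sq :
    (fun z : Phase d => (‖z.fst‖ ^ 2 : ℝ)).HasTemperateGrowth :=
  (Function.hasTemperateGrowth_norm_sq (H := EuclideanSpace ℝ (Fin d))).comp
    ((ContinuousLinearMap.fst ℝ _ _).comp (WithLp.prodContinuousLinearEquiv 2 ℝ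
      (EuclideanSpace ℝ (Fin d)) (EuclideanSpace ℝ (Fin d))).toContinuousLinearMap
      ).hasTemperateGrowth

theorem hasTemperateGrowth_norm_snd_sq :
    (fun z : Phase d => (‖z.snd‖ ^ 2 : ℝ)).HasTemperateGrowth :=
  (Function.hasTemperateGrowth_norm_sq (H := EuclideanSpace ℝ (Fin d))).comp
    ((ContinuousLinearMap.snd ℝ _ _).comp (WithLp.prodContinuousLinearEquiv 2 ℝ
      (EuclideanSpace ℝ (Fin d)) (EuclideanSpace ℝ (Fin d))).toContinuousLinearMap
      ).hasTemperateGrowth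

theorem hasTemperateGrowth_monoSymbol (t : ℕ × ℕ) :
    (monoSymbol (d := d) t).HasTemperateGrowth :=
  (((Function.HasTemperateGrowth.const (Real.pi ^ 2)).mul hasTemperateGrowth_norm_fst_sq).pow
    _).mul (((Function.HasTemperateGrowth.const (Real.pi ^ 2)).mul
      hasTemperateGrowth_norm_snd_sq).pow _)

/-- The product of a real function of temperate growth with a symbol. -/
noncomputable def realMul (g : Phase d → ℝ) (m : 𝓢(Phase d, ℂ)) : 𝓢(Phase d, ℂ) :=
  SchwartzMap.smulLeftCLM ℂ g m

theorem realMul_apply {g : Phase d → ℝ} (hg : g.HasTemperateGrowth) (m : 𝓢(Phase d, ℂ))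
    (ξ : Phase d) : realMul g m ξ = (g ξ : ℂ) * m ξ := by
  rw [realMul, SchwartzMap.smulLeftCLM_apply_apply hg, Complex.real_smul]

theorem monoSymbol_scale {σ : ℝ} (hσ : 0 < σ) (t : ℕ × ℕ) (ξ : Phase d) :
    monoSymbol t (scale σ hσ ξ) = (σ ^ 2) ^ (t.1 + 3 * t.2) * monoSymbol t ξ := by
  rw [monoSymbol, monoSymbol, fst_scale, snd_scale, norm_smul, norm_smul,
    Real.norm_of_nonneg hσ.le, Real.norm_of_nonneg (pow_nonneg hσ.le 3)]
  simp only [mul_pow, pow_add, pow_mul]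
  ring

/-- The symbol `p(π² |ξ₁|², π² |ξ₂|²) ĝ(1, ξ)`. -/
noncomputable def polyGauss (d : ℕ) : (ℕ × ℕ →₀ ℝ) →ₗ[ℝ] 𝓢(Phase d, ℂ) :=
  Finsupp.linearCombination ℝ fun t => realMul (monoSymbol t) (gaussSymbol d 0)

theorem polyGauss_apply (p : ℕ × ℕ →₀ ℝ) (ξ : Phase d) :
    polyGauss d p ξ = (polyEval (Real.pi ^ 2 * ‖ξ.fst‖ ^ 2, Real.pi ^ 2 * ‖ξ.snd‖ ^ 2) p : ℝ) *
      gaussSymbol d 0 ξ := by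
  induction p using Finsupp.induction_linear with
  | zero => simp
  | add f g hf hg => rw [map_add, map_add, add_apply, hf, hg]; push_cast; ring
  | single t c =>
    rw [polyGauss, Finsupp.linearCombination_single, polyEval_single, smul_apply,
      realMul_apply (hasTemperateGrowth_monoSymbol t), monoSymbol, Complex.real_smul]
    push_cast
    ring

theorem gaussSymbol_eq_polyGauss (n : ℕ) : gaussSymbol d n = polyGauss d (gaussPoly n) := by
  ext ξ
  rw [polyGauss_apply, gaussSymbol_apply, gaussSymbol_apply]
  simp only [gaussPoly, polyEval_single]
  push_cast
  ring

theorem gaussSymbol_zero_ne_zero (ξ : Phase d) : gaussSymbol d 0 ξ ≠ 0 := by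
  rw [gaussSymbol_apply, Complex.ofReal_ne_zero]
  simp only [gaussPoly, polyEval_single]
  have := Real.exp_pos (-(Real.pi ^ 2 * ‖ξ.fst‖ ^ 2 + Real.pi ^ 2 * ‖ξ.snd‖ ^ 2))
  positivity

/-- Low frequencies: the Gaussian symbol of order `n` vanishes like `σ ^ (2 n)`. -/
theorem exists_kernelNorm_polyGauss_le (Φ : 𝓢(Phase d, ℂ)) {n : ℕ} {p : ℕ × ℕ →₀ ℝ}
    (hp : p ∈ Finsupp.supported ℝ ℝ {t : ℕ × ℕ | n ≤ t.1 + 3 * t.2}) :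
    ∃ C : ℝ≥0, ∀ (σ τ : ℝ) (hσ : 0 < σ) (hτ : 0 < τ), σ ≤ τ →
      kernelNorm (symMul (scaleSymbol σ hσ (polyGauss d p)) (scaleSymbol τ hτ Φ)) ≤
        C * ENNReal.ofReal (((σ / τ) ^ 2) ^ n) := by
  rw [Finsupp.supported_eq_span_single] at hp
  induction hp using Submodule.span_induction with
  | mem x hx =>
    obtain ⟨t, ht, rfl⟩ := hx
    simp only [Set.mem_ofPred_eq] at ht
    refine ⟨(kernelNorm (gaussSymbol d 0)).toNNReal *
      (kernelNorm (realMul (monoSymbol t) Φ)).toNNReal, fun σ τ hσ hτ hστ => ?_⟩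
    -- The monomial is homogeneous of degree `2 (t.1 + 3 t.2)`, so it can be moved from the Gaussian
    -- at scale `σ` to the cutoff at scale `τ`, leaving a power of `σ / τ ≤ 1`; both remaining
    -- factors have scale-invariant kernel norms.
    have e : symMul (scaleSymbol σ hσ (polyGauss d (Finsupp.single t 1))) (scaleSymbol τ hτ Φ) =
        ((((σ / τ) ^ 2) ^ (t.1 + 3 * t.2) : ℝ) : ℂ) • symMul (scaleSymbol σ hσ (gaussSymbol d 0))
          (scaleSymbol τ hτ (realMul (monoSymbol t) Φ)) := by
      ext ξ
      simp only [symMul_apply, scaleSymbol_apply, smul_apply, smul_eq_mul]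
      rw [realMul_apply (hasTemperateGrowth_monoSymbol t), polyGauss,
        Finsupp.linearCombination_single, one_smul, realMul_apply (hasTemperateGrowth_monoSymbol t),
        monoSymbol_scale, monoSymbol_scale]
      have : ((σ ^ 2) ^ (t.1 + 3 * t.2) : ℝ) = ((σ / τ) ^ 2) ^ (t.1 + 3 * t.2) *
          (τ ^ 2) ^ (t.1 + 3 * t.2) := by
        rw [← mul_pow, ← mul_pow, div_mul_cancel₀ _ hτ.ne']
      rw [this]
      push_cast
      ring
    rw [e, kernelNorm_smul]
    have h1 : (‖((((σ / τ) ^ 2) ^ (t.1 + 3 * t.2) : ℝ) : ℂ)‖ₑ : ℝ≥0∞) ≤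
        ENNReal.ofReal (((σ / τ) ^ 2) ^ n) := by
      rw [← ofReal_norm, Complex.norm_real, Real.norm_of_nonneg (by positivity)]
      refine ENNReal.ofReal_le_ofReal (pow_le_pow_of_le_one (by positivity) ?_ ht)
      exact pow_le_one₀ (by positivity) (div_le_one_of_le₀ hστ hτ.le)
    have h2 := kernelNorm_symMul_le (scaleSymbol σ hσ (gaussSymbol d 0))
      (scaleSymbol τ hτ (realMul (monoSymbol t) Φ))
    rw [kernelNorm_scaleSymbol, kernelNorm_scaleSymbol] at h2
    rw [ENNReal.coe_mul, ENNReal.coe_toNNReal (kernelNorm_lt_top _).ne,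
      ENNReal.coe_toNNReal (kernelNorm_lt_top _).ne, mul_comm]
    exact mul_le_mul' h2 h1
  | zero =>
    refine ⟨0, fun σ τ hσ hτ _ => ?_⟩
    have : symMul (scaleSymbol σ hσ (polyGauss d 0)) (scaleSymbol τ hτ Φ) = 0 := by
      ext ξ; simp
    rw [this, kernelNorm_zero]
    exact zero_le
  | add x y _ _ hx hy =>
    obtain ⟨C, hx⟩ := hx
    obtain ⟨D, hy⟩ := hy
    refine ⟨C + D, fun σ τ hσ hτ hστ => ?_⟩
    have : symMul (scaleSymbol σ hσ (polyGauss d (x + y))) (scaleSymbol τ hτ Φ) =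
        symMul (scaleSymbol σ hσ (polyGauss d x)) (scaleSymbol τ hτ Φ) +
          symMul (scaleSymbol σ hσ (polyGauss d y)) (scaleSymbol τ hτ Φ) := by
      ext ξ; simp [add_mul]
    rw [this, ENNReal.coe_add, add_mul]
    exact (kernelNorm_add_le _ _).trans (add_le_add (hx σ τ hσ hτ hστ) (hy σ τ hσ hτ hστ))
  | smul c x _ hx =>
    obtain ⟨C, hx⟩ := hx
    refine ⟨‖c‖₊ * C, fun σ τ hσ hτ hστ => ?_⟩
    have : symMul (scaleSymbol σ hσ (polyGauss d (c • x))) (scaleSymbol τ hτ Φ) =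
        (c : ℂ) • symMul (scaleSymbol σ hσ (polyGauss d x)) (scaleSymbol τ hτ Φ) := by
      ext ξ; simp [mul_assoc]
    rw [this, kernelNorm_smul, ENNReal.coe_mul, mul_assoc]
    refine mul_le_mul' (le_of_eq ?_) (hx σ τ hσ hτ hστ)
    rw [← ofReal_norm, Complex.norm_real, ofReal_norm]; rfl

/-! ### Division of compactly supported symbols -/

/-- The quotient is smooth near `tsupport Φ` because `w` does not vanish there, and it is zero
elsewhere, so it is again a compactly supported symbol. -/
theorem exists_symbol_div {Φ : 𝓢(Phase d, ℂ)} (hΦ : HasCompactSupport Φ) {w : Phase d → ℂ}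
    (hw : ContDiff ℝ ∞ w) (h0 : ∀ ξ ∈ tsupport Φ, w ξ ≠ 0) :
    ∃ Ψ : 𝓢(Phase d, ℂ), ∀ ξ, Φ ξ = Ψ ξ * w ξ := by
  have hs : ContDiff ℝ ∞ fun ξ => Φ ξ * (w ξ)⁻¹ := by
    rw [contDiff_iff_contDiffAt]
    intro ξ
    by_cases hξ : ξ ∈ tsupport Φ
    · exact (Φ.smooth ⊤).contDiffAt.mul (hw.contDiffAt.inv (h0 ξ hξ))
    · have : (fun ξ => Φ ξ * (w ξ)⁻¹) =ᶠ[nhds ξ] fun _ => 0 := by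
        filter_upwards [(isClosed_tsupport Φ).isOpen_compl.mem_nhds hξ] with η hη
        rw [image_eq_zero_of_notMem_tsupport hη, zero_mul]
      exact contDiffAt_const.congr_of_eventuallyEq this
  refine ⟨HasCompactSupport.toSchwartzMap hΦ.mul_right hs, fun ξ => ?_⟩
  change Φ ξ = Φ ξ * (w ξ)⁻¹ * w ξ
  by_cases hξ : ξ ∈ tsupport Φ
  · rw [inv_mul_cancel_right₀ (h0 ξ hξ)]
  · rw [image_eq_zero_of_notMem_tsupport hξ, zero_mul, zero_mul]

/-- The homogeneous polynomial `|ξ₁|⁶ + |ξ₂|²`. -/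
noncomputable def homPoly (ξ : Phase d) : ℝ := (‖ξ.fst‖ ^ 2) ^ 3 + ‖ξ.snd‖ ^ 2

theorem hasTemperateGrowth_homPoly : (homPoly (d := d)).HasTemperateGrowth :=
  (hasTemperateGrowth_norm_fst_sq.pow 3).add hasTemperateGrowth_norm_snd_sq

theorem homPoly_scale {σ : ℝ} (hσ : 0 < σ) (ξ : Phase d) :
    homPoly (scale σ hσ ξ) = (σ ^ 2) ^ 3 * homPoly ξ := by
  rw [homPoly, homPoly, fst_scale, snd_scale, norm_smul, norm_smul,
    Real.norm_of_nonneg hσ.le, Real.norm_of_nonneg (pow_nonneg hσ.le 3)]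
  ring

/-- High frequencies: rapid decay. -/
theorem exists_kernelNorm_high_le (Q : 𝓢(Phase d, ℂ)) {Φ : 𝓢(Phase d, ℂ)}
    (hΦ : HasCompactSupport Φ) (h0 : ∀ ξ ∈ tsupport Φ, homPoly ξ ≠ 0) (N : ℕ) :
    ∃ C : ℝ≥0, ∀ (σ τ : ℝ) (hσ : 0 < σ) (hτ : 0 < τ),
      kernelNorm (symMul (scaleSymbol σ hσ Q) (scaleSymbol τ hτ Φ)) ≤
        C * ENNReal.ofReal ((((τ / σ) ^ 2) ^ 3) ^ N) := by
  have hg := (hasTemperateGrowth_homPoly (d := d)).pow N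
  obtain ⟨Ψ, hΨ⟩ := exists_symbol_div hΦ (w := fun ξ => ((homPoly ξ ^ N : ℝ) : ℂ))
    (Complex.ofRealCLM.contDiff.comp hg.1)
    (fun ξ hξ => Complex.ofReal_ne_zero.2 (pow_ne_zero _ (h0 ξ hξ)))
  refine ⟨(kernelNorm (realMul (homPoly ^ N) Q)).toNNReal * (kernelNorm Ψ).toNNReal,
    fun σ τ hσ hτ => ?_⟩
  -- The homogeneous factor `homPoly ^ N` is divided out of `Φ`, whose support avoids its zeros, and
  -- given to `Q`; the mismatch of the scales leaves `(τ / σ) ^ (6 N)`.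
  have e : symMul (scaleSymbol σ hσ Q) (scaleSymbol τ hτ Φ) =
      (((((τ / σ) ^ 2) ^ 3) ^ N : ℝ) : ℂ) • symMul (scaleSymbol σ hσ (realMul (homPoly ^ N) Q))
        (scaleSymbol τ hτ Ψ) := by
    ext ξ
    simp only [symMul_apply, scaleSymbol_apply, smul_apply, smul_eq_mul]
    rw [realMul_apply hg, hΨ, Pi.pow_apply, homPoly_scale, homPoly_scale]
    have : (((τ ^ 2) ^ 3 * homPoly ξ) ^ N : ℝ) = (((τ / σ) ^ 2) ^ 3) ^ N *
        ((σ ^ 2) ^ 3 * homPoly ξ) ^ N := by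
      rw [← mul_pow, ← mul_assoc, ← mul_pow, ← mul_pow, div_mul_cancel₀ _ hσ.ne']
    rw [this]
    push_cast
    ring
  rw [e, kernelNorm_smul]
  have h1 : (‖(((((τ / σ) ^ 2) ^ 3) ^ N : ℝ) : ℂ)‖ₑ : ℝ≥0∞) =
      ENNReal.ofReal ((((τ / σ) ^ 2) ^ 3) ^ N) := by
    rw [← ofReal_norm, Complex.norm_real, Real.norm_of_nonneg (by positivity)]
  have h2 := kernelNorm_symMul_le (scaleSymbol σ hσ (realMul (homPoly ^ N) Q))
    (scaleSymbol τ hτ Ψ)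
  rw [kernelNorm_scaleSymbol, kernelNorm_scaleSymbol] at h2
  rw [h1, ENNReal.coe_mul, ENNReal.coe_toNNReal (kernelNorm_lt_top _).ne,
    ENNReal.coe_toNNReal (kernelNorm_lt_top _).ne, mul_comm]
  gcongr

end Kinetic

namespace Kinetic

variable {d : ℕ}

/-! ### The dyadic symbols -/

theorem continuous_anisoNorm : Continuous (anisoNorm (d := d)) := by
  have h1 : Continuous fun x : Phase d => x.fst :=
    (WithLp.prodContinuousLinearEquiv 2 ℝ _ _).continuous.fst
  have h2 : Continuous fun x : Phase d => x.snd :=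
    (WithLp.prodContinuousLinearEquiv 2 ℝ _ _).continuous.snd
  exact h1.norm.add (h2.norm.rpow_const fun _ => Or.inr (by norm_num))

/-- The anisotropic norm of `2π ξ`. -/
noncomputable def freqNorm (ξ : Phase d) : ℝ := anisoNorm ((2 * Real.pi) • ξ)

theorem continuous_freqNorm : Continuous (freqNorm (d := d)) :=
  continuous_anisoNorm.comp (continuous_const_smul _)

theorem freqNorm_scale {σ : ℝ} (hσ : 0 < σ) (ξ : Phase d) :
    freqNorm (scale σ hσ ξ) = σ * freqNorm ξ := by
  rw [freqNorm, ← scale_smul, anisoNorm_scale, freqNorm]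

theorem freqNorm_eq (ξ : Phase d) :
    freqNorm ξ = 2 * Real.pi * ‖ξ.fst‖ + (2 * Real.pi * ‖ξ.snd‖) ^ (1 / 3 : ℝ) := by
  have h1 : ((2 * Real.pi) • ξ).fst = (2 * Real.pi) • ξ.fst := rfl
  have h2 : ((2 * Real.pi) • ξ).snd = (2 * Real.pi) • ξ.snd := rfl
  rw [freqNorm, anisoNorm, h1, h2, norm_smul, norm_smul, Real.norm_of_nonneg (by positivity)]

variable {χ : Phase d → ℝ} (hχ : IsCutoff χ)

/-- The symbol `ξ ↦ χ₀(2π ξ)`. -/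
noncomputable def cutoffSymbol : 𝓢(Phase d, ℂ) := dyadicSchwartz hχ 0

theorem cutoffSymbol_apply (ξ : Phase d) :
    cutoffSymbol hχ ξ = (χ ((2 * Real.pi) • ξ) : ℝ) := rfl

theorem cutoffSymbol_eq_one {ξ : Phase d} (h : freqNorm ξ ≤ 1) : cutoffSymbol hχ ξ = 1 := by
  rw [cutoffSymbol_apply, hχ.eq_one _ h, Complex.ofReal_one]

theorem cutoffSymbol_eq_zero {ξ : Phase d} (h : 2 < freqNorm ξ) : cutoffSymbol hχ ξ = 0 := by
  rw [cutoffSymbol_apply, hχ.eq_zero _ h, Complex.ofReal_zero]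

theorem hasCompactSupport_cutoffSymbol : HasCompactSupport (cutoffSymbol hχ) :=
  ((hχ.hasCompactSupport_dyadic 0).comp_smul (c := 2 * Real.pi) (by positivity)).comp_left
    Complex.ofReal_zero

theorem hasCompactSupport_scaleSymbol {m : 𝓢(Phase d, ℂ)} (hm : HasCompactSupport m) {σ : ℝ}
    (hσ : 0 < σ) : HasCompactSupport (scaleSymbol σ hσ m) :=
  hm.comp_homeomorph (scale σ hσ).toHomeomorph

/-- A smooth cutoff to an anisotropic annulus. -/
noncomputable def annulusSymbol (a b : ℝ) (ha : 0 < a) (hb : 0 < b) : 𝓢(Phase d, ℂ) :=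
  scaleSymbol a ha (cutoffSymbol hχ) - scaleSymbol b hb (cutoffSymbol hχ)

variable {a b : ℝ} (ha : 0 < a) (hb : 0 < b)

theorem annulusSymbol_apply (ξ : Phase d) : annulusSymbol hχ a b ha hb ξ =
    cutoffSymbol hχ (scale a ha ξ) - cutoffSymbol hχ (scale b hb ξ) := rfl

theorem annulusSymbol_eq_one {ξ : Phase d} (h1 : a * freqNorm ξ ≤ 1) (h2 : 2 < b * freqNorm ξ) :
    annulusSymbol hχ a b ha hb ξ = 1 := by
  rw [annulusSymbol_apply, cutoffSymbol_eq_one hχ (by rwa [freqNorm_scale]),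
    cutoffSymbol_eq_zero hχ (by rwa [freqNorm_scale]), sub_zero]

theorem hasCompactSupport_annulusSymbol : HasCompactSupport (annulusSymbol hχ a b ha hb) :=
  (hasCompactSupport_scaleSymbol (hasCompactSupport_cutoffSymbol hχ) ha).sub
    (hasCompactSupport_scaleSymbol (hasCompactSupport_cutoffSymbol hχ) hb)

theorem le_of_annulusSymbol_ne_zero (hab : a ≤ b) {ξ : Phase d}
    (h : annulusSymbol hχ a b ha hb ξ ≠ 0) : 1 < b * freqNorm ξ ∧ a * freqNorm ξ ≤ 2 := by
  have h0 : 0 ≤ freqNorm ξ := by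
    rw [freqNorm_eq]; positivity
  refine ⟨?_, ?_⟩
  · by_contra! hc
    apply h
    rw [annulusSymbol_apply, cutoffSymbol_eq_one hχ (by rw [freqNorm_scale]; nlinarith),
      cutoffSymbol_eq_one hχ (by rwa [freqNorm_scale]), sub_self]
  · by_contra! hc
    apply h
    rw [annulusSymbol_apply, cutoffSymbol_eq_zero hχ (by rwa [freqNorm_scale]),
      cutoffSymbol_eq_zero hχ (by rw [freqNorm_scale]; nlinarith), sub_self]

theorem le_of_mem_tsupport_annulusSymbol (hab : a ≤ b) {ξ : Phase d}
    (h : ξ ∈ tsupport (annulusSymbol hχ a b ha hb)) : 1 ≤ b * freqNorm ξ := by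
  have hc : IsClosed {ξ : Phase d | 1 ≤ b * freqNorm ξ} :=
    isClosed_le continuous_const (continuous_const.mul continuous_freqNorm)
  exact closure_minimal (fun η hη => (le_of_annulusSymbol_ne_zero hχ ha hb hab hη).1.le) hc h

theorem two_inv_pow_pos (j : ℕ) : (0 : ℝ) < 2⁻¹ ^ j := by positivity

theorem dyadicSchwartz_zero : dyadicSchwartz hχ 0 = cutoffSymbol hχ := rfl

theorem dyadicSchwartz_succ (j : ℕ) : dyadicSchwartz hχ (j + 1) =
    scaleSymbol (2⁻¹ ^ (j + 1)) (two_inv_pow_pos _) (cutoffSymbol hχ) -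
      scaleSymbol (2⁻¹ ^ j) (two_inv_pow_pos _) (cutoffSymbol hχ) := by
  have key : ∀ (s : ℝ) (k : ℕ), s = -(k : ℝ) → ∀ x : Phase d,
      dil s x = scale (2⁻¹ ^ k) (two_inv_pow_pos k) x := by
    intro s k hs x
    have : (2 : ℝ) ^ s = 2⁻¹ ^ k := by
      rw [hs, Real.rpow_neg two_pos.le, Real.rpow_natCast, inv_pow]
    rw [dil_eq_scale]
    simp only [this]
  ext ξ
  change ((χ (dil (-((j : ℝ) + 1)) ((2 * Real.pi) • ξ)) -
    χ (dil (-(j : ℝ)) ((2 * Real.pi) • ξ)) : ℝ) : ℂ) = _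
  rw [key _ (j + 1) (by push_cast; ring), key _ j rfl, scale_smul, scale_smul, Complex.ofReal_sub]
  rfl

/-- All blocks with positive index are dilates of one annular symbol, with `1/2 < 2^{-j} |2πξ|_a ≤
2` wherever the block is nonzero. -/
theorem dyadicSchwartz_succ' (j : ℕ) : dyadicSchwartz hχ (j + 1) =
    scaleSymbol (2⁻¹ ^ (j + 1)) (two_inv_pow_pos _)
      (annulusSymbol hχ 1 2 one_pos two_pos) := by
  rw [dyadicSchwartz_succ]
  ext ξ
  rw [scaleSymbol_apply, annulusSymbol_apply, scale_scale, scale_scale]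
  have h1 : (1 * 2⁻¹ ^ (j + 1) : ℝ) = 2⁻¹ ^ (j + 1) := one_mul _
  have h2 : (2 * 2⁻¹ ^ (j + 1) : ℝ) = 2⁻¹ ^ j := by rw [pow_succ]; ring
  simp only [h1, h2]
  rfl

theorem hasCompactSupport_dyadicSchwartz (j : ℕ) : HasCompactSupport (dyadicSchwartz hχ j) := by
  cases j with
  | zero => exact hasCompactSupport_cutoffSymbol hχ
  | succ j =>
    rw [dyadicSchwartz_succ']
    exact hasCompactSupport_scaleSymbol (hasCompactSupport_annulusSymbol hχ _ _) _

theorem le_of_dyadicSchwartz_ne_zero {j : ℕ} {ξ : Phase d} (h : dyadicSchwartz hχ j ξ ≠ 0) :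
    2⁻¹ ^ j * freqNorm ξ ≤ 2 := by
  cases j with
  | zero =>
    by_contra! hc
    exact h (cutoffSymbol_eq_zero hχ (by simpa using hc))
  | succ j =>
    rw [dyadicSchwartz_succ', scaleSymbol_apply] at h
    have := (le_of_annulusSymbol_ne_zero hχ _ _ one_le_two h).2
    rwa [freqNorm_scale, one_mul] at this

theorem lt_of_dyadicSchwartz_ne_zero {j : ℕ} (hj : 1 ≤ j) {ξ : Phase d}
    (h : dyadicSchwartz hχ j ξ ≠ 0) : 1 < 2 * (2⁻¹ ^ j * freqNorm ξ) := by
  obtain ⟨j, rfl⟩ := Nat.exists_eq_add_of_le' hj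
  rw [dyadicSchwartz_succ', scaleSymbol_apply] at h
  have := (le_of_annulusSymbol_ne_zero hχ _ _ one_le_two h).1
  rwa [freqNorm_scale] at this

/-! ### Estimates for a single dyadic block -/

variable {F : Type*} [NormedAddCommGroup F] [NormedSpace ℂ F] [FiniteDimensional ℂ F]

theorem sqrt_div_two_inv_pow_sq {v : ℝ} (hv : 0 < v) (j : ℕ) :
    (√v / 2⁻¹ ^ j) ^ 2 = v * 4 ^ j := by
  rw [div_pow, Real.sq_sqrt hv.le, ← pow_mul, mul_comm j, pow_mul, div_eq_mul_inv, ← inv_pow]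
  norm_num

/-- Since `m φ_j = (m Φ) φ_j`, the multiplier `m` may be localised by any wider cutoff `Φ` before
its kernel is measured. -/
theorem eLpNorm_conv_symMul_dyadic_le {j : ℕ} {Φ : 𝓢(Phase d, ℂ)}
    (h1 : ∀ ξ, dyadicSchwartz hχ j ξ ≠ 0 → Φ ξ = 1) (m : 𝓢(Phase d, ℂ)) (f : 𝓢'(Phase d, F))
    {p : ℝ≥0∞} (hp : 1 ≤ p) :
    eLpNorm (conv (𝓕⁻ (symMul m (dyadicSchwartz hχ j))) f) p volume ≤
      kernelNorm (symMul m Φ) * eLpNorm (conv (blockKernel hχ j) f) p volume := by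
  refine eLpNorm_conv_mul_le (h := symMul m Φ) (fun ξ => ?_) f hp
  by_cases h : dyadicSchwartz hχ j ξ = 0
  · simp [h]
  · simp [h1 ξ h]

theorem kernelNorm_symMul_fourier_thermicKernel (n : ℕ) {v : ℝ} (hv : 0 < v)
    (Φ : 𝓢(Phase d, ℂ)) :
    kernelNorm (symMul (𝓕 (thermicKernel d n v)) Φ) = ENNReal.ofReal (v⁻¹ ^ n) *
      kernelNorm (symMul (scaleSymbol (√v) (Real.sqrt_pos.2 hv) (gaussSymbol d n)) Φ) := by
  have : symMul (𝓕 (thermicKernel d n v)) Φ = ((v⁻¹ ^ n : ℝ) : ℂ) •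
      symMul (scaleSymbol (√v) (Real.sqrt_pos.2 hv) (gaussSymbol d n)) Φ := by
    rw [fourier_thermicKernel n hv]
    ext ξ
    simp [mul_assoc]
  rw [this, kernelNorm_smul, ← ofReal_norm, Complex.norm_real, Real.norm_of_nonneg (by positivity)]

/-- The cutoff `χ₀` is further dilated by `1/2` so that it equals `1` wherever the `j`-th block is
nonzero, the block `j = 0` included. -/
theorem exists_kernelNorm_thermic_low_le (n : ℕ) :
    ∃ C : ℝ≥0, ∀ (j : ℕ) (v : ℝ), 0 < v → v * 4 ^ j ≤ 1 →
      kernelNorm (symMul (𝓕 (thermicKernel d n v)) (scaleSymbol (2⁻¹ ^ j) (two_inv_pow_pos j)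
        (scaleSymbol 2⁻¹ (by norm_num) (cutoffSymbol hχ)))) ≤
      C * ENNReal.ofReal (v⁻¹ ^ n * (v * 4 ^ j) ^ n) := by
  obtain ⟨C, h⟩ := exists_kernelNorm_polyGauss_le
    (scaleSymbol 2⁻¹ (by norm_num) (cutoffSymbol hχ)) (gaussPoly_mem_supported n)
  refine ⟨C, fun j v hv hr => ?_⟩
  have h3 := sqrt_div_two_inv_pow_sq hv j
  have h4 := h (√v) (2⁻¹ ^ j) (Real.sqrt_pos.2 hv) (two_inv_pow_pos j) (by
    rw [← div_le_one (two_inv_pow_pos j)]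
    refine (sq_le_one_iff₀ (by positivity)).1 ?_
    rwa [h3])
  rw [h3] at h4
  rw [kernelNorm_symMul_fourier_thermicKernel n hv, gaussSymbol_eq_polyGauss,
    ENNReal.ofReal_mul (by positivity), mul_left_comm]
  exact mul_le_mul_right h4 _

/-- The annulus with parameters `1/2` and `5` covers the `j`-th block for `j ≥ 1` (`2 · 1/2 ≤ 1` and
`5 · 1/2 > 2`) and stays away from the origin, the only zero of `homPoly`. -/
theorem exists_kernelNorm_thermic_high_le (n N : ℕ) :
    ∃ C : ℝ≥0, ∀ (j : ℕ) (v : ℝ), 0 < v →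
      kernelNorm (symMul (𝓕 (thermicKernel d n v)) (scaleSymbol (2⁻¹ ^ j) (two_inv_pow_pos j)
        (annulusSymbol hχ 2⁻¹ 5 (by norm_num) (by norm_num)))) ≤
      C * ENNReal.ofReal (v⁻¹ ^ n * ((v * 4 ^ j)⁻¹ ^ 3) ^ N) := by
  obtain ⟨C, h⟩ := exists_kernelNorm_high_le (gaussSymbol d n)
    (hasCompactSupport_annulusSymbol hχ (a := 2⁻¹) (b := 5) (by norm_num) (by norm_num))
    (fun ξ hξ h0 => by
      have h1 := le_of_mem_tsupport_annulusSymbol hχ _ _ (by norm_num) hξ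
      have h2 : (‖ξ.fst‖ ^ 2) ^ 3 = 0 ∧ ‖ξ.snd‖ ^ 2 = 0 :=
        (add_eq_zero_iff_of_nonneg (by positivity) (by positivity)).1 h0
      rw [freqNorm_eq, pow_eq_zero_iff two_ne_zero |>.1 h2.2,
        pow_eq_zero_iff two_ne_zero |>.1 (pow_eq_zero_iff three_ne_zero |>.1 h2.1)] at h1
      norm_num at h1) N
  refine ⟨C, fun j v hv => ?_⟩
  have h3 : (2⁻¹ ^ j / √v) ^ 2 = (v * 4 ^ j)⁻¹ := by
    rw [← inv_div, inv_pow, sqrt_div_two_inv_pow_sq hv j]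
  have h4 := h (√v) (2⁻¹ ^ j) (Real.sqrt_pos.2 hv) (two_inv_pow_pos j)
  rw [h3] at h4
  rw [kernelNorm_symMul_fourier_thermicKernel n hv, ENNReal.ofReal_mul (by positivity),
    mul_left_comm]
  exact mul_le_mul_right h4 _

/-- The thermic kernel at time `v` acts on the `j`-th block with a gain depending on `v 4^j`. -/
theorem exists_eLpNorm_thermic_block_le (F : Type*) [NormedAddCommGroup F] [NormedSpace ℂ F]
    [FiniteDimensional ℂ F] (n N : ℕ) {p : ℝ≥0∞} (hp : 1 ≤ p) :
    ∃ C : ℝ≥0, ∀ (j : ℕ) (v : ℝ), 0 < v → v ≤ 1 → ∀ f : 𝓢'(Phase d, F),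
      eLpNorm (conv (𝓕⁻ (symMul (𝓕 (thermicKernel d n v)) (dyadicSchwartz hχ j))) f) p volume ≤
        C * ENNReal.ofReal (v⁻¹ ^ n * min ((v * 4 ^ j) ^ n) ((v * 4 ^ j)⁻¹ ^ N)) *
          eLpNorm (conv (blockKernel hχ j) f) p volume := by
  obtain ⟨C₁, h₁⟩ := exists_kernelNorm_thermic_low_le hχ n
  obtain ⟨C₂, h₂⟩ := exists_kernelNorm_thermic_high_le hχ n (N + n)
  refine ⟨max C₁ C₂, fun j v hv hv1 f => ?_⟩
  have hr0 : 0 < v * 4 ^ j := by positivity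
  rcases le_or_gt (v * 4 ^ j) 1 with hr1 | hr1
  · refine (eLpNorm_conv_symMul_dyadic_le hχ (fun ξ hξ => ?_) _ f hp).trans
      (mul_le_mul_left ((h₁ j v hv hr1).trans ?_) _)
    · rw [scaleSymbol_apply, scaleSymbol_apply]
      refine cutoffSymbol_eq_one hχ ?_
      rw [freqNorm_scale, freqNorm_scale]
      linarith [le_of_dyadicSchwartz_ne_zero hχ hξ]
    · rw [min_eq_left ((pow_le_one₀ hr0.le hr1).trans (one_le_pow₀ ((one_le_inv₀ hr0).2 hr1)))]
      exact mul_le_mul_left (ENNReal.coe_le_coe.2 (le_max_left _ _)) _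
  -- Since `v ≤ 1`, the block `j = 0` never reaches `v * 4 ^ j > 1`; hence in the high regime the
  -- block is annular.
  · have hj : 1 ≤ j := by
      rw [Nat.one_le_iff_ne_zero]
      rintro rfl
      simp only [pow_zero, mul_one] at hr1
      linarith
    refine (eLpNorm_conv_symMul_dyadic_le hχ (fun ξ hξ => ?_) _ f hp).trans
      (mul_le_mul_left ((h₂ j v hv).trans ?_) _)
    · have h4 := le_of_dyadicSchwartz_ne_zero hχ hξ
      have h5 := lt_of_dyadicSchwartz_ne_zero hχ hj hξ
      rw [scaleSymbol_apply]
      refine annulusSymbol_eq_one hχ _ _ ?_ ?_ <;> rw [freqNorm_scale] <;> linarith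
    · have hinv : (v * 4 ^ j)⁻¹ ≤ 1 := inv_le_one_of_one_le₀ hr1.le
      have hmin : (((v * 4 ^ j)⁻¹) ^ 3) ^ (N + n) ≤
          min ((v * 4 ^ j) ^ n) ((v * 4 ^ j)⁻¹ ^ N) := by
        have h6 : (((v * 4 ^ j)⁻¹) ^ 3) ^ (N + n) ≤ (v * 4 ^ j)⁻¹ ^ N := by
          rw [← pow_mul]
          exact pow_le_pow_of_le_one (by positivity) hinv (by omega)
        refine le_min (h6.trans ?_) h6
        exact (pow_le_one₀ (by positivity) hinv).trans (one_le_pow₀ hr1.le)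
      exact mul_le_mul' (ENNReal.coe_le_coe.2 (le_max_right _ _))
        (ENNReal.ofReal_le_ofReal (mul_le_mul_of_nonneg_left hmin (by positivity)))

theorem le_of_le_freqNorm {R : ℝ} (hR : 0 < R) {ξ : Phase d} (h : 4 * R + 4 ≤ freqNorm ξ) :
    R ≤ Real.pi ^ 2 * ‖ξ.fst‖ ^ 2 + Real.pi ^ 2 * ‖ξ.snd‖ ^ 2 := by
  rw [freqNorm_eq] at h
  have hpi := Real.pi_pos
  set y := (2 * Real.pi * ‖ξ.snd‖) ^ (1 / 3 : ℝ) with hy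
  have hy3 : y ^ 3 = 2 * Real.pi * ‖ξ.snd‖ := by
    rw [hy, ← Real.rpow_natCast, ← Real.rpow_mul (by positivity)]; norm_num
  have h1 : 0 ≤ Real.pi ^ 2 * ‖ξ.fst‖ ^ 2 := by positivity
  have h2 : 0 ≤ Real.pi ^ 2 * ‖ξ.snd‖ ^ 2 := by positivity
  rcases le_total (2 * R + 2) y with h3 | h3
  · have h4 : 2 * R + 2 ≤ y ^ 3 := h3.trans (le_self_pow₀ (by linarith) (by norm_num))
    have h5 : R + 1 ≤ Real.pi * ‖ξ.snd‖ := by linarith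
    nlinarith
  · have h5 : R + 1 ≤ Real.pi * ‖ξ.fst‖ := by linarith
    nlinarith

theorem contDiff_schwartz (m : 𝓢(Phase d, ℂ)) : ContDiff ℝ ∞ m := m.smooth _

/-- Each block is controlled by the thermic kernel at the corresponding time. -/
theorem exists_eLpNorm_block_le (F : Type*) [NormedAddCommGroup F] [NormedSpace ℂ F]
    [FiniteDimensional ℂ F] (n : ℕ) {p : ℝ≥0∞} (hp : 1 ≤ p) :
    ∃ (C : ℝ≥0) (m : ℕ), ∀ (j : ℕ) (v : ℝ), 1 ≤ j → 0 < v → 4 ^ m ≤ v * 4 ^ j →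
      v * 4 ^ j ≤ 4 ^ (m + 1) → ∀ f : 𝓢'(Phase d, F),
      eLpNorm (conv (blockKernel hχ j) f) p volume ≤
        C * ENNReal.ofReal (v ^ n) * eLpNorm (conv (thermicKernel d n v) f) p volume := by
  obtain ⟨R, hR, hne⟩ := exists_gaussPoly_ne_zero n
  -- On the block, `√v |2πξ|_a` lies in `(2^(m-1), 2^(m+2)]`. The annulus with `a = (4 · 2^m)⁻¹`, `b
  -- = 5 / 2^m` equals `1` there, and its support lies in `|2πξ|_a ≥ 2^m / 5 > 4R + 4`, where
  -- `gaussSymbol d n` has no zeros.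
  obtain ⟨m, hm⟩ := pow_unbounded_of_one_lt (5 * (4 * R + 4)) (one_lt_two (α := ℝ))
  have ha : (0 : ℝ) < (4 * 2 ^ m)⁻¹ := by positivity
  have hb : (0 : ℝ) < 5 / 2 ^ m := by positivity
  obtain ⟨Ψ, hΨ⟩ := exists_symbol_div (hasCompactSupport_annulusSymbol hχ ha hb)
    (contDiff_schwartz (gaussSymbol d n)) (fun ξ hξ => by
      have h1 := le_of_mem_tsupport_annulusSymbol hχ ha hb (by
        rw [← one_div, div_le_div_iff₀ (by positivity) (by positivity)]
        nlinarith [pow_pos (two_pos (α := ℝ)) m]) hξ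
      rw [div_mul_eq_mul_div, one_le_div (by positivity)] at h1
      rw [gaussSymbol_apply, Complex.ofReal_ne_zero]
      refine mul_ne_zero (by positivity) (mul_ne_zero (hne _ _ (by positivity) (by positivity)
        (le_of_le_freqNorm hR (by linarith))) (Real.exp_ne_zero _)))
  set D := annulusSymbol hχ 1 2 one_pos two_pos with hD
  refine ⟨(kernelNorm D).toNNReal * (kernelNorm Ψ).toNNReal, m, fun j v hj hv h1 h2 f => ?_⟩
  obtain ⟨i, rfl⟩ := Nat.exists_eq_add_of_le' hj
  have hσ := Real.sqrt_pos.2 hv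
  have hτ := two_inv_pow_pos (i + 1)
  set h : 𝓢(Phase d, ℂ) := ((v ^ n : ℝ) : ℂ) •
    symMul (scaleSymbol (2⁻¹ ^ (i + 1)) hτ D) (scaleSymbol (√v) hσ Ψ) with hh
  have hk : kernelNorm h ≤ ((kernelNorm D).toNNReal * (kernelNorm Ψ).toNNReal : ℝ≥0) *
      ENNReal.ofReal (v ^ n) := by
    have h3 := kernelNorm_symMul_le (scaleSymbol (2⁻¹ ^ (i + 1)) hτ D) (scaleSymbol (√v) hσ Ψ)
    rw [kernelNorm_scaleSymbol, kernelNorm_scaleSymbol] at h3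
    rw [hh, kernelNorm_smul, ← ofReal_norm, Complex.norm_real,
      Real.norm_of_nonneg (by positivity), ENNReal.coe_mul,
      ENNReal.coe_toNNReal (kernelNorm_lt_top _).ne,
      ENNReal.coe_toNNReal (kernelNorm_lt_top _).ne, mul_comm]
    gcongr
  have hsq := sqrt_div_two_inv_pow_sq hv (i + 1)
  have hlow : 2 ^ m ≤ √v / 2⁻¹ ^ (i + 1) := by
    refine (sq_le_sq₀ (by positivity) (by positivity)).1 ?_
    rw [hsq, ← pow_mul, mul_comm m, pow_mul]
    norm_num
    exact h1
  have hhigh : √v / 2⁻¹ ^ (i + 1) ≤ 2 ^ (m + 1) := by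
    refine (sq_le_sq₀ (by positivity) (by positivity)).1 ?_
    rw [hsq, ← pow_mul, mul_comm (m + 1), pow_mul]
    norm_num
    exact h2
  rw [le_div_iff₀ hτ] at hlow
  rw [div_le_iff₀ hτ] at hhigh
  -- `Ψ` is the annulus divided by `gaussSymbol d n`, so the product is the block times the annulus
  -- at scale `√v`, and the annulus is `1` on the block.
  have hfac : ∀ ξ, dyadicSchwartz hχ (i + 1) ξ = h ξ * (𝓕 (thermicKernel d n v)) ξ := by
    intro ξ
    have e : h ξ * (𝓕 (thermicKernel d n v)) ξ = dyadicSchwartz hχ (i + 1) ξ *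
        annulusSymbol hχ _ _ ha hb (scale (√v) hσ ξ) := by
      rw [hh, fourier_thermicKernel n hv, dyadicSchwartz_succ', hΨ]
      simp only [smul_apply, symMul_apply, scaleSymbol_apply, smul_eq_mul]
      have : ((v ^ n : ℝ) : ℂ) * ((v⁻¹ ^ n : ℝ) : ℂ) = 1 := by
        rw [← Complex.ofReal_mul, ← mul_pow, mul_inv_cancel₀ hv.ne', one_pow, Complex.ofReal_one]
      linear_combination (D (scale (2⁻¹ ^ (i + 1)) hτ ξ) * Ψ (scale (√v) hσ ξ) *
        gaussSymbol d n (scale (√v) hσ ξ)) * this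
    rw [e]
    by_cases h0 : dyadicSchwartz hχ (i + 1) ξ = 0
    · rw [h0, zero_mul]
    have h4 := le_of_dyadicSchwartz_ne_zero hχ h0
    have h5 := lt_of_dyadicSchwartz_ne_zero hχ hj h0
    have hN : 0 < freqNorm ξ := by
      by_contra! hc
      nlinarith
    have hM : (0 : ℝ) < 2 ^ m := by positivity
    rw [annulusSymbol_eq_one hχ ha hb, mul_one]
    · rw [freqNorm_scale, inv_mul_le_iff₀ (by positivity), mul_one]
      rw [pow_succ] at hhigh
      calc √v * freqNorm ξ ≤ 2 ^ m * 2 * 2⁻¹ ^ (i + 1) * freqNorm ξ := by gcongr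
        _ ≤ 4 * 2 ^ m := by nlinarith
    · rw [freqNorm_scale, div_mul_eq_mul_div, lt_div_iff₀ hM]
      calc 2 * 2 ^ m < 5 * (2 ^ m * (2⁻¹ ^ (i + 1) * freqNorm ξ)) := by nlinarith
        _ = 5 * (2 ^ m * 2⁻¹ ^ (i + 1) * freqNorm ξ) := by ring
        _ ≤ _ := by gcongr
  have h6 := eLpNorm_conv_mul_le hfac f hp
  rw [FourierTransform.fourierInv_fourier_eq] at h6
  exact h6.trans (by gcongr)

/-- Each block is controlled by the Gaussian average at time `1`. -/
theorem exists_eLpNorm_block_le_gaussian (F : Type*) [NormedAddCommGroup F] [NormedSpace ℂ F]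
    [FiniteDimensional ℂ F] (j : ℕ) {p : ℝ≥0∞} (hp : 1 ≤ p) :
    ∃ C : ℝ≥0, ∀ f : 𝓢'(Phase d, F), eLpNorm (conv (blockKernel hχ j) f) p volume ≤
      C * eLpNorm (conv (thermicKernel d 0 1) f) p volume := by
  obtain ⟨Ψ, hΨ⟩ := exists_symbol_div (hasCompactSupport_dyadicSchwartz hχ j)
    (contDiff_schwartz (gaussSymbol d 0)) (fun ξ _ => gaussSymbol_zero_ne_zero ξ)
  refine ⟨(kernelNorm Ψ).toNNReal, fun f => ?_⟩
  rw [ENNReal.coe_toNNReal (kernelNorm_lt_top _).ne]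
  have h6 := eLpNorm_conv_mul_le hΨ f hp
  rwa [gaussSymbol, FourierTransform.fourierInv_fourier_eq] at h6

end Kinetic

/-! ### Dilated cutoffs as an approximate identity for multiplication. -/

namespace SchwartzMap

variable {E : Type*} [NormedAddCommGroup E] [NormedSpace ℝ E]

/-- For `a = 0` the mean value inequality with `η 0 = 1` yields the factor `ε ‖x‖`; for `a > 0`
every derivative of `η ∘ A` brings out a factor `‖A‖`. -/
theorem norm_iteratedFDeriv_one_sub_comp_le (η : 𝓢(E, ℂ)) (h0 : η 0 = 1) (a : ℕ) {A : E →L[ℝ] E}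
    {ε : ℝ} (hε : 0 ≤ ε) (hε1 : ε ≤ 1) (hA : ‖A‖ ≤ ε) (x : E) :
    ‖iteratedFDeriv ℝ a (fun y => 1 - η (A y)) x‖ ≤
      (SchwartzMap.seminorm ℝ 0 a η + SchwartzMap.seminorm ℝ 0 1 η) * (ε * (1 + ‖x‖)) := by
  have hs : ∀ i, 0 ≤ SchwartzMap.seminorm ℝ 0 i η := fun i => apply_nonneg _ _
  have hb : ∀ i y, ‖iteratedFDeriv ℝ i η y‖ ≤ SchwartzMap.seminorm ℝ 0 i η := fun i y => by
    simpa using SchwartzMap.le_seminorm ℝ 0 i η y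
  have hη : ContDiff ℝ ∞ η := η.smooth _
  rcases Nat.eq_zero_or_pos a with rfl | ha
  · rw [norm_iteratedFDeriv_zero, ← h0]
    have h1 := (convex_univ (𝕜 := ℝ) (E := E)).norm_image_sub_le_of_norm_fderiv_le
      (f := η) (C := SchwartzMap.seminorm ℝ 0 1 η) (fun y _ => η.differentiableAt)
      (fun y _ => by simpa [norm_iteratedFDeriv_one] using hb 1 y) (Set.mem_univ (A x))
      (Set.mem_univ 0)
    rw [zero_sub, norm_neg] at h1
    have h2 : ‖A x‖ ≤ ε * (1 + ‖x‖) := (A.le_of_opNorm_le hA x).trans (by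
      gcongr; linarith)
    refine h1.trans (mul_le_mul ?_ h2 (norm_nonneg _) (add_nonneg (hs _) (hs _)))
    linarith [hs 0]
  · have h1 : iteratedFDeriv ℝ a (fun y => 1 - η (A y)) x =
        - iteratedFDeriv ℝ a (fun y => η (A y)) x := by
      have hg : ContDiffAt ℝ a (fun y => η (A y)) x :=
        ((hη.comp A.contDiff).of_le (mod_cast le_top)).contDiffAt
      rw [fun_iteratedFDeriv_sub_apply contDiffAt_const hg,
        iteratedFDeriv_const_of_ne ha.ne', Pi.zero_apply, zero_sub]
    have h2 := A.iteratedFDeriv_comp_right hη x (i := a) (mod_cast le_top)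
    rw [h1, norm_neg]
    change ‖iteratedFDeriv ℝ a (η ∘ A) x‖ ≤ _
    rw [h2]
    refine (ContinuousMultilinearMap.norm_compContinuousLinearMap_le _ _).trans ?_
    rw [Finset.prod_const, Finset.card_univ, Fintype.card_fin]
    refine mul_le_mul ((hb a _).trans (by linarith [hs 1])) ?_ (by positivity)
      (add_nonneg (hs _) (hs _))
    calc ‖A‖ ^ a ≤ ε ^ a := by gcongr
      _ ≤ ε := pow_le_of_le_one hε hε1 ha.ne'
      _ ≤ ε * (1 + ‖x‖) := le_mul_of_one_le_right hε (by linarith [norm_nonneg x])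

/-- Multiplication by a Schwartz function dilated to infinity approximates the identity. -/
theorem tendsto_mul_comp_dilation {ι : Type*} {l : Filter ι} (η : 𝓢(E, ℂ)) (h0 : η 0 = 1)
    (A : ι → E →L[ℝ] E) (hA : Filter.Tendsto (fun i => ‖A i‖) l (nhds 0)) (m : 𝓢(E, ℂ))
    (u : ι → 𝓢(E, ℂ)) (hu : ∀ i x, u i x = m x * η (A i x)) :
    Filter.Tendsto u l (nhds m) := by
  rw [(schwartz_withSeminorms ℝ E ℂ).tendsto_nhds _ _]
  rintro ⟨k, n⟩ ε hε
  have hs : ∀ k i (g : 𝓢(E, ℂ)), 0 ≤ SchwartzMap.seminorm ℝ k i g := fun k i g => apply_nonneg _ _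
  -- The Leibniz constants; the seminorms with weight `k + 1` absorb the growth `1 + ‖x‖` of the
  -- bound for `1 - η ∘ A i`.
  set B : ℝ := ∑ i ∈ Finset.range (n + 1), (n.choose i : ℝ) *
    ((SchwartzMap.seminorm ℝ k i m + SchwartzMap.seminorm ℝ (k + 1) i m) *
      (SchwartzMap.seminorm ℝ 0 (n - i) η + SchwartzMap.seminorm ℝ 0 1 η)) with hB
  have hB0 : 0 ≤ B := Finset.sum_nonneg fun i _ => mul_nonneg (by positivity)
    (mul_nonneg (add_nonneg (hs _ _ _) (hs _ _ _)) (add_nonneg (hs _ _ _) (hs _ _ _)))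
  have hlim : Filter.Tendsto (fun i => B * ‖A i‖) l (nhds 0) := by
    simpa using hA.const_mul B
  filter_upwards [hlim.eventually_lt_const hε, hA.eventually_lt_const one_pos] with i h1 h2
  refine lt_of_le_of_lt ?_ h1
  rw [← neg_sub, SchwartzMap.schwartzSeminormFamily_apply, map_neg_eq_map]
  refine SchwartzMap.seminorm_le_bound ℝ k n _ (by positivity) fun x => ?_
  have e : ⇑(m - u i) = fun x => m x * (1 - η (A i x)) := by
    ext y
    rw [sub_apply, hu]
    ring
  have hη : ContDiff ℝ ∞ fun y => 1 - η (A i y) :=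
    contDiff_const.sub ((η.smooth _).comp (A i).contDiff)
  rw [e]
  refine (mul_le_mul_of_nonneg_left (norm_iteratedFDeriv_mul_le (m.smooth _) hη x
    (n := n) (mod_cast le_top)) (by positivity)).trans ?_
  rw [Finset.mul_sum, hB, Finset.sum_mul]
  refine Finset.sum_le_sum fun a _ => ?_
  have h3 := norm_iteratedFDeriv_one_sub_comp_le η h0 (n - a) (norm_nonneg _) h2.le le_rfl x
  have h4 := SchwartzMap.le_seminorm ℝ k a m x
  have h5 := SchwartzMap.le_seminorm ℝ (k + 1) a m x
  calc ‖x‖ ^ k * (n.choose a * ‖iteratedFDeriv ℝ a m x‖ *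
        ‖iteratedFDeriv ℝ (n - a) (fun y => 1 - η (A i y)) x‖)
      ≤ ‖x‖ ^ k * (n.choose a * ‖iteratedFDeriv ℝ a m x‖ *
        ((SchwartzMap.seminorm ℝ 0 (n - a) η + SchwartzMap.seminorm ℝ 0 1 η) *
          (‖A i‖ * (1 + ‖x‖)))) := by gcongr
    _ = n.choose a * ((‖x‖ ^ k * ‖iteratedFDeriv ℝ a m x‖ +
          ‖x‖ ^ (k + 1) * ‖iteratedFDeriv ℝ a m x‖) *
        (SchwartzMap.seminorm ℝ 0 (n - a) η + SchwartzMap.seminorm ℝ 0 1 η)) * ‖A i‖ := by ring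
    _ ≤ _ := by
      have := add_nonneg (hs 0 (n - a) η) (hs 0 1 η)
      gcongr

end SchwartzMap

/-! ### Littlewood–Paley decomposition of a convolution. -/

namespace Kinetic

variable {d : ℕ} {χ : Phase d → ℝ} (hχ : IsCutoff χ)

theorem sum_dyadicSchwartz (J : ℕ) : ∑ j ∈ Finset.range (J + 1), dyadicSchwartz hχ j =
    scaleSymbol (2⁻¹ ^ J) (two_inv_pow_pos J) (cutoffSymbol hχ) := by
  induction J with
  | zero =>
    rw [zero_add, Finset.sum_range_one, dyadicSchwartz_zero]
    ext ξ
    rw [scaleSymbol_apply]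
    congr 1
    apply phase_ext <;> simp
  | succ J ih => rw [Finset.sum_range_succ, ih, dyadicSchwartz_succ, add_sub_cancel]

theorem norm_scale_le {σ : ℝ} (hσ : 0 < σ) (hσ1 : σ ≤ 1) :
    ‖(scale (d := d) σ hσ).toContinuousLinearMap‖ ≤ σ := by
  refine ContinuousLinearMap.opNorm_le_bound _ hσ.le fun x => ?_
  refine (sq_le_sq₀ (norm_nonneg _) (by positivity)).1 ?_
  rw [mul_pow, WithLp.prod_norm_sq_eq_of_L2, WithLp.prod_norm_sq_eq_of_L2]
  simp only [ContinuousLinearEquiv.coe_coe, fst_scale, snd_scale, norm_smul, Real.norm_eq_abs,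
    abs_pow, abs_of_pos hσ]
  have h1 : σ ^ 3 ≤ σ := pow_le_of_le_one hσ.le hσ1 (by norm_num)
  rw [mul_add, mul_pow, mul_pow]
  gcongr

theorem symMul_sum {ι : Type*} (m : 𝓢(Phase d, ℂ)) (s : Finset ι) (φ : ι → 𝓢(Phase d, ℂ)) :
    symMul m (∑ j ∈ s, φ j) = ∑ j ∈ s, symMul m (φ j) :=
  map_sum (SchwartzMap.pairing (ContinuousLinearMap.mul ℂ ℂ) m) φ s

/-- The partial sums telescope to `m` times the cutoff dilated by `2⁻ᴶ`. Convergence takes place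
among test functions, so any tempered `f` may be applied to it. -/
theorem tendsto_symMul_sum_dyadic (m : 𝓢(Phase d, ℂ)) :
    Filter.Tendsto (fun J => ∑ j ∈ Finset.range (J + 1), symMul m (dyadicSchwartz hχ j))
      Filter.atTop (nhds m) := by
  refine SchwartzMap.tendsto_mul_comp_dilation (cutoffSymbol hχ)
    (cutoffSymbol_eq_one hχ (by simp [freqNorm_eq]))
    (fun J => (scale (d := d) (2⁻¹ ^ J) (two_inv_pow_pos J)).toContinuousLinearMap) ?_ m _
    (fun J ξ => by rw [← symMul_sum, sum_dyadicSchwartz]; rfl)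
  exact squeeze_zero (fun _ => norm_nonneg _)
    (fun J => norm_scale_le _ (pow_le_one₀ (by norm_num) (by norm_num)))
    (tendsto_pow_atTop_nhds_zero_of_lt_one (by norm_num) (by norm_num))

variable {F : Type*} [NormedAddCommGroup F] [NormedSpace ℂ F]

/-- The convolution, evaluated at a point, as a function of the symbol. -/
noncomputable def convAt (f : 𝓢'(Phase d, F)) (x : Phase d) : 𝓢(Phase d, ℂ) →L[ℂ] F :=
  (f : 𝓢(Phase d, ℂ) →L[ℂ] F) ∘L
    SchwartzMap.compCLMOfContinuousLinearEquiv ℂ (ContinuousLinearEquiv.neg ℝ) ∘L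
    SchwartzMap.compSubConstCLM ℂ (-x) ∘L FourierTransform.fourierInvCLM ℂ 𝓢(Phase d, ℂ)

/-- A convolution is dominated by the sum of its dyadic pieces. -/
theorem eLpNorm_conv_le_tsum (m : 𝓢(Phase d, ℂ)) (f : 𝓢'(Phase d, F)) {p : ℝ≥0∞} (hp : 1 ≤ p) :
    eLpNorm (conv (𝓕⁻ m) f) p volume ≤
      ∑' j, eLpNorm (conv (𝓕⁻ (symMul m (dyadicSchwartz hχ j))) f) p volume := by
  have hmeas : ∀ j, AEStronglyMeasurable (conv (𝓕⁻ (symMul m (dyadicSchwartz hχ j))) f)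
      (volume : Measure (Phase d)) := fun j => (continuous_conv _ f).aestronglyMeasurable
  -- Lower semicontinuity of the `L^p` norm along the partial sums, which converge pointwise because
  -- `convAt f x` is continuous.
  refine Lp.eLpNorm_le_of_ae_tendsto (u := Filter.atTop)
    (f := fun J => ∑ j ∈ Finset.range (J + 1), conv (𝓕⁻ (symMul m (dyadicSchwartz hχ j))) f)
    (.of_forall fun J => (eLpNorm_sum_le (fun j _ => hmeas j) hp).trans
      (ENNReal.sum_le_tsum _)) (fun J => Finset.aestronglyMeasurable_sum _ fun j _ => hmeas j)
    (.of_forall fun x => ?_)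
  have h := ((convAt f x).continuous.tendsto m).comp (tendsto_symMul_sum_dyadic hχ m)
  refine h.congr fun J => ?_
  rw [Function.comp_apply, map_sum, Finset.sum_apply]
  rfl

end Kinetic

/-! ### Discrete and dyadic sums -/

namespace ENNReal

theorem mul_rpow_one_div_le {C S : ℝ≥0∞} {q : ℝ} (hq : 1 ≤ q) (hC : 1 ≤ C) :
    (C * S) ^ (1 / q) ≤ C * S ^ (1 / q) := by
  rw [ENNReal.mul_rpow_of_nonneg _ _ (by positivity)]
  gcongr
  calc C ^ (1 / q) ≤ C ^ (1 : ℝ) := ENNReal.rpow_le_rpow_of_exponent_le hC (by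
        rw [one_div]; exact inv_le_one_of_one_le₀ hq)
    _ = C := ENNReal.rpow_one C

theorem mul_rpow_rpow_one_div (C S : ℝ≥0∞) {q : ℝ} (hq : 1 ≤ q) :
    (C ^ q * S) ^ (1 / q) = C * S ^ (1 / q) := by
  rw [ENNReal.mul_rpow_of_nonneg _ _ (by positivity), ← ENNReal.rpow_mul,
    mul_one_div_cancel (by positivity), ENNReal.rpow_one]

theorem le_tsum_rpow_one_div (b : ℕ → ℝ≥0∞) {q : ℝ} (hq : 1 ≤ q) (j : ℕ) :
    b j ≤ (∑' i, b i ^ q) ^ (1 / q) := by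
  calc b j = (b j ^ q) ^ (1 / q) := by
        rw [← ENNReal.rpow_mul, mul_one_div_cancel (by positivity), ENNReal.rpow_one]
    _ ≤ _ := ENNReal.rpow_le_rpow (ENNReal.le_tsum (f := fun i => b i ^ q) j) (by positivity)

/-- Young's inequality for discrete convolutions. -/
theorem tsum_tsum_mul_rpow_le (k : ℤ → ℝ≥0∞) (b : ℕ → ℝ≥0∞) {q : ℝ} (hq : 1 ≤ q) :
    ∑' i : ℕ, (∑' j : ℕ, k (j - i) * b j) ^ q ≤ (∑' z, k z) ^ q * ∑' j, b j ^ q := by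
  set K := ∑' z, k z with hK
  have h1 : ∀ i : ℕ, ∑' j : ℕ, k (j - i) ≤ K := fun i =>
    ENNReal.tsum_comp_le_tsum_of_injective (f := fun j : ℕ => (j : ℤ) - i)
      (fun a b h => by simpa using h) k
  have h2 : ∀ j : ℕ, ∑' i : ℕ, k (j - i) ≤ K := fun j =>
    ENNReal.tsum_comp_le_tsum_of_injective (f := fun i : ℕ => (j : ℤ) - i)
      (fun a b h => by simpa using h) k
  calc ∑' i : ℕ, (∑' j : ℕ, k (j - i) * b j) ^ q
      ≤ ∑' i : ℕ, K ^ (q - 1) * ∑' j : ℕ, k (j - i) * b j ^ q := by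
        refine ENNReal.tsum_le_tsum fun i => ?_
        -- Jensen for the counting measure with the weight `k (j - i)`, whose row and column sums
        -- are both at most `K`.
        have h3 := ENNReal.lintegral_mul_rpow_le (Measure.count : Measure ℕ) hq
          (k := fun j => k (j - i)) (b := b) (measurable_of_countable _).aemeasurable
          (measurable_of_countable _).aemeasurable
        simp only [lintegral_count] at h3
        exact h3.trans (mul_le_mul_left (ENNReal.rpow_le_rpow (h1 i) (by linarith)) _)
    _ = K ^ (q - 1) * ∑' j : ℕ, (∑' i : ℕ, k (j - i)) * b j ^ q := by
        rw [ENNReal.tsum_mul_left, ENNReal.tsum_comm]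
        simp_rw [ENNReal.tsum_mul_right]
    _ ≤ K ^ (q - 1) * ∑' j : ℕ, K * b j ^ q := by
        gcongr with j
        exact h2 j
    _ = K ^ q * ∑' j, b j ^ q := by
        rw [ENNReal.tsum_mul_left, ← mul_assoc]
        congr 1
        conv_rhs => rw [← sub_add_cancel q 1, ENNReal.rpow_add_of_nonneg _ _ (by linarith) zero_le_one,
          ENNReal.rpow_one]

theorem tsum_mul_le_iSup (k : ℤ → ℝ≥0∞) (b : ℕ → ℝ≥0∞) (i : ℕ) :
    ∑' j : ℕ, k (j - i) * b j ≤ (∑' z, k z) * ⨆ j, b j := by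
  calc ∑' j : ℕ, k (j - i) * b j ≤ ∑' j : ℕ, k (j - i) * ⨆ j, b j := by
        gcongr with j
        exact le_iSup b j
    _ = (∑' j : ℕ, k (j - i)) * ⨆ j, b j := ENNReal.tsum_mul_right
    _ ≤ _ := by
        gcongr
        exact ENNReal.tsum_comp_le_tsum_of_injective (f := fun j : ℕ => (j : ℤ) - i)
          (fun a b h => by simpa using h) k

theorem tsum_int_geometric_ne_top {w : ℝ} (hw0 : 0 ≤ w) (hw1 : w < 1) :
    ∑' z : ℤ, ENNReal.ofReal (w ^ z.natAbs) ≠ ⊤ := by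
  refine Summable.tsum_ofReal_ne_top (summable_int_iff_summable_nat_and_neg.2 ⟨?_, ?_⟩) <;>
  simpa using summable_geometric_of_lt_one hw0 hw1

end ENNReal

/-! ### Discretisation of the measure `dv / v`. -/

namespace Kinetic

/-- The interval `(4^{-(i+1)}, 4^{-i}]`. -/
def quarticInterval (i : ℕ) : Set ℝ := Set.Ioc (4⁻¹ ^ (i + 1)) (4⁻¹ ^ i)

theorem measurableSet_quarticInterval (i : ℕ) : MeasurableSet (quarticInterval i) :=
  measurableSet_Ioc

theorem pos_of_mem_quarticInterval {i : ℕ} {v : ℝ} (h : v ∈ quarticInterval i) : 0 < v :=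
  (by positivity : (0 : ℝ) < 4⁻¹ ^ (i + 1)).trans h.1

theorem exists_mem_quarticInterval {v : ℝ} (h : v ∈ Set.Ioc (0 : ℝ) 1) :
    ∃ i, v ∈ quarticInterval i :=
  exists_nat_pow_near_of_lt_one h.1 h.2 (by norm_num) (by norm_num)

theorem quarticInterval_subset (i : ℕ) : quarticInterval i ⊆ Set.Ioc 0 1 := fun _ hv =>
  ⟨pos_of_mem_quarticInterval hv, hv.2.trans (pow_le_one₀ (by norm_num) (by norm_num))⟩

theorem iUnion_quarticInterval : ⋃ i, quarticInterval i = Set.Ioc (0 : ℝ) 1 := by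
  refine Set.Subset.antisymm (Set.iUnion_subset quarticInterval_subset) fun v hv => ?_
  exact Set.mem_iUnion.2 (exists_mem_quarticInterval hv)

theorem pairwise_disjoint_quarticInterval :
    Pairwise (Function.onFun Disjoint quarticInterval) := by
  have key : ∀ i k, i < k → Disjoint (quarticInterval i) (quarticInterval k) := by
    intro i k hik
    rw [Set.disjoint_left]
    intro v h1 h2
    have : (4⁻¹ : ℝ) ^ k ≤ 4⁻¹ ^ (i + 1) :=
      pow_le_pow_of_le_one (by norm_num) (by norm_num) hik
    exact absurd (h1.1.trans_le h2.2) (not_lt.2 this)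
  intro i k hik
  rcases lt_or_gt_of_ne hik with h | h
  · exact key i k h
  · exact (key k i h).symm

theorem volume_quarticInterval (i : ℕ) :
    volume (quarticInterval i) = ENNReal.ofReal (3 * 4⁻¹ ^ (i + 1)) := by
  rw [quarticInterval, Real.volume_Ioc, pow_succ]
  congr 1
  ring

theorem lintegral_Ioc_eq_tsum (g : ℝ → ℝ≥0∞) :
    ∫⁻ v in Set.Ioc (0 : ℝ) 1, g v = ∑' i, ∫⁻ v in quarticInterval i, g v := by
  rw [← iUnion_quarticInterval]
  exact lintegral_iUnion measurableSet_quarticInterval pairwise_disjoint_quarticInterval g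

/-- On the `i`-th interval `1 / v ≤ 4^(i+1)` and the length is `3 · 4^{-(i+1)}`, whence the `3`.
Only constants are compared with `g`, so no measurability of `g` is needed. -/
theorem lintegral_Ioc_le_tsum {g : ℝ → ℝ≥0∞} {M : ℕ → ℝ≥0∞}
    (h : ∀ i, ∀ v ∈ quarticInterval i, g v ≤ M i) :
    ∫⁻ v in Set.Ioc (0 : ℝ) 1, ENNReal.ofReal (1 / v) * g v ≤ 3 * ∑' i, M i := by
  rw [lintegral_Ioc_eq_tsum, ← ENNReal.tsum_mul_left]
  refine ENNReal.tsum_le_tsum fun i => ?_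
  calc ∫⁻ v in quarticInterval i, ENNReal.ofReal (1 / v) * g v
      ≤ ∫⁻ _ in quarticInterval i, ENNReal.ofReal (4 ^ (i + 1)) * M i := by
        refine setLIntegral_mono' (measurableSet_quarticInterval i) fun v hv => ?_
        refine mul_le_mul' (ENNReal.ofReal_le_ofReal ?_) (h i v hv)
        rw [one_div]
        refine inv_le_of_inv_le₀ (by positivity) ?_
        rw [← inv_pow]
        exact hv.1.le
    _ = 3 * M i := by
        rw [setLIntegral_const, volume_quarticInterval, mul_right_comm,
          ← ENNReal.ofReal_mul (by positivity), mul_left_comm, ← mul_pow]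
        norm_num

/-- Here `1 / v ≥ 4^i` gives each interval mass at least `3/4`, and `2 · 3/4 ≥ 1`. -/
theorem tsum_le_lintegral_Ioc {g : ℝ → ℝ≥0∞} {M : ℕ → ℝ≥0∞}
    (h : ∀ i, ∀ v ∈ quarticInterval i, M i ≤ g v) :
    ∑' i, M i ≤ 2 * ∫⁻ v in Set.Ioc (0 : ℝ) 1, ENNReal.ofReal (1 / v) * g v := by
  rw [lintegral_Ioc_eq_tsum, ← ENNReal.tsum_mul_left]
  refine ENNReal.tsum_le_tsum fun i => ?_
  calc M i ≤ ENNReal.ofReal (3 / 2) * M i :=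
        le_mul_of_one_le_left' (ENNReal.one_le_ofReal.2 (by norm_num))
    _ = 2 * ∫⁻ _ in quarticInterval i, ENNReal.ofReal (4 ^ i) * M i := by
        have e1 : (4 : ℝ) ^ i * (3 * 4⁻¹ ^ (i + 1)) = 3 / 4 := by
          rw [pow_succ, mul_left_comm, ← mul_assoc (4 ^ i), ← mul_pow]
          norm_num
        have e2 : ENNReal.ofReal (3 / 2) = 2 * ENNReal.ofReal (3 / 4) := by
          rw [← ENNReal.ofReal_ofNat, ← ENNReal.ofReal_mul (by norm_num)]
          norm_num
        rw [setLIntegral_const, volume_quarticInterval, mul_right_comm,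
          ← ENNReal.ofReal_mul (by positivity), e1, e2, mul_assoc]
    _ ≤ 2 * ∫⁻ v in quarticInterval i, ENNReal.ofReal (1 / v) * g v := by
        gcongr 2 * ?_
        refine setLIntegral_mono' (measurableSet_quarticInterval i) fun v hv => ?_
        refine mul_le_mul' (ENNReal.ofReal_le_ofReal ?_) (h i v hv)
        rw [one_div]
        refine le_inv_of_le_inv₀ (pos_of_mem_quarticInterval hv) ?_
        rw [← inv_pow]
        exact hv.2

end Kinetic

/-! ### Comparison of the dyadic and the thermic coefficients. -/

namespace Kinetic

variable {d : ℕ} {F : Type*} [NormedAddCommGroup F] [NormedSpace ℂ F]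

/-- The terms of the Littlewood-Paley norm. -/
noncomputable def besovCoeff {χ : Phase d → ℝ} (hχ : IsCutoff χ) (θ : ℝ) (p : ℝ≥0∞)
    (f : 𝓢'(Phase d, F)) (j : ℕ) : ℝ≥0∞ :=
  ENNReal.ofReal (2 ^ (j * θ)) * eLpNorm (conv (blockKernel hχ j) f) p volume

/-- The integrand of the thermic norm. -/
noncomputable def thermicCoeff (n : ℕ) (θ : ℝ) (p : ℝ≥0∞) (f : 𝓢'(Phase d, F)) (v : ℝ) : ℝ≥0∞ :=
  ENNReal.ofReal (v ^ (n - θ / 2)) * eLpNorm (conv (thermicKernel d n v) f) p volume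

theorem two_rpow_mul (j : ℕ) (θ : ℝ) : (2 : ℝ) ^ (j * θ) = (4 ^ j) ^ (θ / 2) := by
  rw [← Real.rpow_natCast_mul (by norm_num), show (4 : ℝ) = 2 ^ (2 : ℝ) by norm_num,
    ← Real.rpow_mul two_pos.le]
  congr 1
  ring

theorem mul_pow_bounds {i : ℕ} {v : ℝ} (hv : v ∈ quarticInterval i) (k : ℕ) :
    4 ^ k < v * 4 ^ (i + 1 + k) ∧ v * 4 ^ (i + k) ≤ 4 ^ k := by
  have e : ∀ m : ℕ, (4⁻¹ ^ m * 4 ^ (m + k) : ℝ) = 4 ^ k := fun m => by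
    rw [pow_add, ← mul_assoc, ← mul_pow]; norm_num
  exact ⟨by rw [← e (i + 1)]; gcongr; exact hv.1, by rw [← e i]; gcongr; exact hv.2⟩

/-- The gain of the thermic kernel, against the dyadic distance of `v` and `4^{-j}`. -/
theorem rpow_neg_mul_min_le {n N : ℕ} {s : ℝ} (hn : 0 < n - s) (hN : n - s ≤ N + s) {i : ℕ} {v : ℝ}
    (hv : v ∈ quarticInterval i) (j : ℕ) :
    (v * 4 ^ j) ^ (-s) * min ((v * 4 ^ j) ^ n) ((v * 4 ^ j)⁻¹ ^ N) ≤
      4 ^ (n - s) * (4 ^ (-(n - s))) ^ ((j : ℤ) - i).natAbs := by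
  have hv0 := pos_of_mem_quarticInterval hv
  have hr0 : 0 < v * 4 ^ j := by positivity
  have hw : (1 : ℝ) ≤ 4 ^ (n - s) := Real.one_le_rpow (by norm_num) hn.le
  have hpow : ∀ k : ℕ, ((4 : ℝ) ^ (-(n - s))) ^ k = (4 ^ k) ^ (-(n - s)) := fun k =>
    Real.rpow_pow_comm (by norm_num) _ _
  -- With `r = v * 4 ^ j`, the bound is `r^(n-s)` for small `r` and `r^{-(N+s)}` for large `r`; `hN`
  -- makes the second decay at least as fast, so one geometric rate serves both sides.
  rcases le_or_gt j i with hji | hji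
  · obtain ⟨k, rfl⟩ := Nat.exists_eq_add_of_le hji
    have e : ((j : ℤ) - ((j + k : ℕ) : ℤ)).natAbs = k := by omega
    have h1 : v * 4 ^ j ≤ (4 ^ k)⁻¹ := by
      rw [le_inv_comm₀ hr0 (by positivity)]
      have := (mul_pow_bounds hv 0).2
      rw [← one_div, le_div_iff₀ hr0]
      calc 4 ^ k * (v * 4 ^ j) = v * 4 ^ (j + k + 0) := by ring
        _ ≤ _ := by simpa using this
    rw [e, hpow]
    calc (v * 4 ^ j) ^ (-s) * min ((v * 4 ^ j) ^ n) ((v * 4 ^ j)⁻¹ ^ N)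
        ≤ (v * 4 ^ j) ^ (-s) * (v * 4 ^ j) ^ n := by gcongr; exact min_le_left _ _
      _ = (v * 4 ^ j) ^ (n - s) := by
          rw [← Real.rpow_natCast _ n, ← Real.rpow_add hr0]; congr 1; ring
      _ ≤ ((4 ^ k)⁻¹) ^ (n - s) := by gcongr
      _ = (4 ^ k) ^ (-(n - s)) := by
          rw [Real.inv_rpow (by positivity), Real.rpow_neg (by positivity)]
      _ ≤ _ := le_mul_of_one_le_left (by positivity) hw
  · obtain ⟨k, rfl⟩ := Nat.exists_eq_add_of_le (Nat.succ_le_of_lt hji)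
    rw [Nat.succ_eq_add_one] at *
    -- The distance is `k + 1`, but `v > 4^{-(i+1)}` only yields `v * 4 ^ j > 4 ^ k`; the missing
    -- factor is the constant `4 ^ (n - s)`.
    have e : (((i + 1 + k : ℕ) : ℤ) - i).natAbs = k + 1 := by omega
    have h1 := (mul_pow_bounds hv k).1
    have h2 : (1 : ℝ) ≤ v * 4 ^ (i + 1 + k) := (one_le_pow₀ (by norm_num)).trans h1.le
    rw [e, hpow]
    calc (v * 4 ^ (i + 1 + k)) ^ (-s) * min ((v * 4 ^ (i + 1 + k)) ^ n) ((v * 4 ^ (i + 1 + k))⁻¹ ^ N)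
        ≤ (v * 4 ^ (i + 1 + k)) ^ (-s) * (v * 4 ^ (i + 1 + k))⁻¹ ^ N := by
          gcongr; exact min_le_right _ _
      _ = (v * 4 ^ (i + 1 + k)) ^ (-(N + s)) := by
          rw [inv_pow, ← Real.rpow_natCast _ N, ← Real.rpow_neg hr0.le, ← Real.rpow_add hr0]
          congr 1; ring
      _ ≤ (v * 4 ^ (i + 1 + k)) ^ (-(n - s)) := Real.rpow_le_rpow_of_exponent_le h2 (by linarith)
      _ ≤ (4 ^ k) ^ (-(n - s)) :=
          Real.rpow_le_rpow_of_nonpos (by positivity) h1.le (by linarith)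
      _ = 4 ^ (n - s) * (4 ^ (k + 1)) ^ (-(n - s)) := by
          rw [pow_succ, Real.mul_rpow (by positivity) (by norm_num), mul_left_comm,
            ← Real.rpow_add (by norm_num), add_neg_cancel, Real.rpow_zero, mul_one]

variable {χ : Phase d → ℝ} (hχ : IsCutoff χ)

/-- The weights combine because `v^(n-ϑ/2) v⁻ⁿ = v^(-ϑ/2) = (v 4^j)^(-ϑ/2) 2^(jϑ)`: after inserting
them only `v 4^j` is left. -/
theorem ofReal_mul_eLpNorm_block (θ : ℝ) (p : ℝ≥0∞) (f : 𝓢'(Phase d, F)) {v : ℝ} (hv : 0 < v)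
    (n j : ℕ) {c : ℝ} (hc : 0 ≤ c) :
    ENNReal.ofReal (v ^ (n - θ / 2)) * (ENNReal.ofReal (v⁻¹ ^ n * c) *
      eLpNorm (conv (blockKernel hχ j) f) p volume) =
    ENNReal.ofReal ((v * 4 ^ j) ^ (-(θ / 2)) * c) * besovCoeff hχ θ p f j := by
  rw [besovCoeff, ← mul_assoc, ← mul_assoc, ← ENNReal.ofReal_mul (by positivity),
    ← ENNReal.ofReal_mul (by positivity), two_rpow_mul]
  congr 2
  have h1 : (v * 4 ^ j) ^ (-(θ / 2)) * (4 ^ j) ^ (θ / 2) = v ^ (-(θ / 2)) := by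
    rw [Real.mul_rpow hv.le (by positivity), mul_assoc, ← Real.rpow_add (by positivity),
      neg_add_cancel, Real.rpow_zero, mul_one]
  have h2 : v ^ (n - θ / 2) * v⁻¹ ^ n = v ^ (-(θ / 2)) := by
    rw [inv_pow, ← Real.rpow_natCast, ← Real.rpow_neg hv.le, ← Real.rpow_add hv]
    congr 1
    ring
  rw [mul_right_comm, h1, ← mul_assoc, h2]

theorem eLpNorm_thermic_le_tsum (n : ℕ) (v : ℝ) (f : 𝓢'(Phase d, F)) {p : ℝ≥0∞} (hp : 1 ≤ p) :
    eLpNorm (conv (thermicKernel d n v) f) p volume ≤ ∑' j,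
      eLpNorm (conv (𝓕⁻ (symMul (𝓕 (thermicKernel d n v)) (dyadicSchwartz hχ j))) f) p volume := by
  have := eLpNorm_conv_le_tsum hχ (𝓕 (thermicKernel d n v)) f hp
  rwa [FourierTransform.fourierInv_fourier_eq] at this

theorem exists_thermicCoeff_le (F : Type*) [NormedAddCommGroup F] [NormedSpace ℂ F]
    [FiniteDimensional ℂ F] (θ : ℝ) {p : ℝ≥0∞} (hp : 1 ≤ p) {n : ℕ} (hn : θ / 2 < n) :
    ∃ C : ℝ≥0, ∀ (i : ℕ), ∀ v ∈ quarticInterval i, ∀ f : 𝓢'(Phase d, F),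
      thermicCoeff n θ p f v ≤ C * ∑' j : ℕ,
        ENNReal.ofReal ((4 ^ (-(n - θ / 2))) ^ ((j : ℤ) - i).natAbs) * besovCoeff hχ θ p f j := by
  -- With `s = ϑ/2` this is the condition `n - s ≤ N + s` for equal geometric rates.
  obtain ⟨N, hN⟩ := exists_nat_ge (n - θ)
  obtain ⟨C, hC⟩ := exists_eLpNorm_thermic_block_le hχ F n N hp
  refine ⟨C * (4 ^ (n - θ / 2) : ℝ).toNNReal, fun i v hv f => ?_⟩
  have hv' := quarticInterval_subset i hv
  have hv0 := hv'.1
  rw [thermicCoeff, ← ENNReal.tsum_mul_left]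
  refine (mul_le_mul_right (eLpNorm_thermic_le_tsum hχ n v f hp) _).trans ?_
  rw [← ENNReal.tsum_mul_left]
  refine ENNReal.tsum_le_tsum fun j => ?_
  refine (mul_le_mul_right (hC j v hv0 hv'.2 f) _).trans ?_
  rw [mul_assoc, mul_left_comm, ofReal_mul_eLpNorm_block hχ θ p f hv0 n j (by positivity)]
  have key : ENNReal.ofReal ((v * 4 ^ j) ^ (-(θ / 2)) *
        min ((v * 4 ^ j) ^ n) ((v * 4 ^ j)⁻¹ ^ N)) ≤ (4 ^ (n - θ / 2) : ℝ).toNNReal *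
      ENNReal.ofReal ((4 ^ (-(n - θ / 2))) ^ ((j : ℤ) - i).natAbs) := by
    change _ ≤ ENNReal.ofReal _ * _
    rw [← ENNReal.ofReal_mul (by positivity)]
    exact ENNReal.ofReal_le_ofReal (rpow_neg_mul_min_le (by linarith) (by linarith) hv j)
  refine (mul_le_mul_right (mul_le_mul_left key _) _).trans (le_of_eq ?_)
  rw [ENNReal.coe_mul]
  ring

theorem exists_eLpNorm_gaussian_le (F : Type*) [NormedAddCommGroup F] [NormedSpace ℂ F]
    [FiniteDimensional ℂ F] (θ : ℝ) {p : ℝ≥0∞} (hp : 1 ≤ p) :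
    ∃ C : ℝ≥0, ∀ f : 𝓢'(Phase d, F),
      eLpNorm (conv (thermicKernel d 0 1) f) p volume ≤ C * ⨆ j, besovCoeff hχ θ p f j := by
  -- Chosen so that `(4^j)^(-ϑ/2 - N) ≤ 4^{-j}`, which is summable.
  obtain ⟨N, hN⟩ := exists_nat_ge (1 - θ / 2)
  obtain ⟨C, hC⟩ := exists_eLpNorm_thermic_block_le hχ F 0 N hp
  have hsum : ∑' j : ℕ, ENNReal.ofReal (4⁻¹ ^ j) ≠ ⊤ :=
    (summable_geometric_of_lt_one (by norm_num) (by norm_num)).tsum_ofReal_ne_top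
  refine ⟨C * (∑' j : ℕ, ENNReal.ofReal (4⁻¹ ^ j)).toNNReal, fun f => ?_⟩
  rw [ENNReal.coe_mul, ENNReal.coe_toNNReal hsum, mul_assoc, ← ENNReal.tsum_mul_right,
    ← ENNReal.tsum_mul_left]
  refine (eLpNorm_thermic_le_tsum hχ 0 1 f hp).trans (ENNReal.tsum_le_tsum fun j => ?_)
  refine (hC j 1 one_pos le_rfl f).trans ?_
  rw [mul_assoc]
  refine mul_le_mul_right ?_ _
  have h := ofReal_mul_eLpNorm_block hχ θ p f one_pos 0 j
    (c := min ((1 * 4 ^ j) ^ 0) ((1 * 4 ^ j)⁻¹ ^ N)) (by positivity)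
  rw [Real.one_rpow, ENNReal.ofReal_one, one_mul] at h
  rw [h]
  refine mul_le_mul' (ENNReal.ofReal_le_ofReal ?_) (le_iSup (besovCoeff hχ θ p f) j)
  have h4 : (1 : ℝ) ≤ 4 ^ j := one_le_pow₀ (by norm_num)
  rw [one_mul]
  calc ((4 : ℝ) ^ j) ^ (-(θ / 2)) * min ((4 ^ j) ^ 0) ((4 ^ j)⁻¹ ^ N)
      ≤ (4 ^ j) ^ (-(θ / 2)) * (4 ^ j)⁻¹ ^ N := by gcongr; exact min_le_right _ _
    _ = (4 ^ j) ^ (-(θ / 2) - N) := by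
        rw [inv_pow, ← Real.rpow_natCast (4 ^ j) N, ← Real.rpow_neg (by positivity),
          ← Real.rpow_add (by positivity), ← sub_eq_add_neg]
    _ ≤ (4 ^ j) ^ (-1 : ℝ) := Real.rpow_le_rpow_of_exponent_le h4 (by linarith)
    _ = 4⁻¹ ^ j := by rw [Real.rpow_neg_one, inv_pow]

theorem exists_besovCoeff_add_le (F : Type*) [NormedAddCommGroup F] [NormedSpace ℂ F]
    [FiniteDimensional ℂ F] (θ : ℝ) (n : ℕ) {p : ℝ≥0∞} (hp : 1 ≤ p) :
    ∃ (C : ℝ≥0) (m : ℕ), ∀ (i : ℕ), ∀ v ∈ quarticInterval i, ∀ f : 𝓢'(Phase d, F),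
      besovCoeff hχ θ p f (i + m) ≤ C * thermicCoeff n θ p f v := by
  obtain ⟨C, m, hC⟩ := exists_eLpNorm_block_le hχ F n hp
  -- The shift is `m + 1` because `4^m < v * 4^(i+m+1) ≤ 4^(m+1)` for `v` in the `i`-th interval.
  -- The absolute value treats both signs of `ϑ`.
  refine ⟨C * ((4 ^ (m + 1)) ^ |θ / 2| : ℝ).toNNReal, m + 1, fun i v hv f => ?_⟩
  have hv0 := pos_of_mem_quarticInterval hv
  have h1 : 4 ^ m ≤ v * 4 ^ (i + (m + 1)) := by
    have := (mul_pow_bounds hv m).1.le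
    rwa [add_right_comm, add_assoc] at this
  have h2 := (mul_pow_bounds hv (m + 1)).2
  have hr1 : 1 ≤ v * 4 ^ (i + (m + 1)) := (one_le_pow₀ (by norm_num)).trans h1
  rw [besovCoeff, thermicCoeff]
  refine (mul_le_mul_right (hC (i + (m + 1)) v (by omega) hv0 h1 h2 f) _).trans ?_
  have key : ENNReal.ofReal (2 ^ (((i + (m + 1) : ℕ) : ℝ) * θ)) * ENNReal.ofReal (v ^ n) ≤
      ((4 ^ (m + 1)) ^ |θ / 2| : ℝ).toNNReal * ENNReal.ofReal (v ^ (n - θ / 2)) := by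
    change _ ≤ ENNReal.ofReal _ * _
    rw [← ENNReal.ofReal_mul (by positivity), ← ENNReal.ofReal_mul (by positivity)]
    refine ENNReal.ofReal_le_ofReal ?_
    have h3 : (2 : ℝ) ^ (((i + (m + 1) : ℕ) : ℝ) * θ) * v ^ n =
        (v * 4 ^ (i + (m + 1))) ^ (θ / 2) * v ^ (n - θ / 2) := by
      rw [two_rpow_mul, Real.mul_rpow hv0.le (by positivity), mul_right_comm, mul_comm,
        ← Real.rpow_add hv0, ← Real.rpow_natCast v]
      congr 2
      ring
    rw [h3]
    gcongr
    calc (v * 4 ^ (i + (m + 1))) ^ (θ / 2) ≤ (v * 4 ^ (i + (m + 1))) ^ |θ / 2| :=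
          Real.rpow_le_rpow_of_exponent_le hr1 (le_abs_self _)
      _ ≤ _ := by gcongr
  calc _ = C * (ENNReal.ofReal (2 ^ (((i + (m + 1) : ℕ) : ℝ) * θ)) * ENNReal.ofReal (v ^ n)) *
        eLpNorm (conv (thermicKernel d n v) f) p volume := by ring
    _ ≤ C * (((4 ^ (m + 1)) ^ |θ / 2| : ℝ).toNNReal * ENNReal.ofReal (v ^ (n - θ / 2))) *
        eLpNorm (conv (thermicKernel d n v) f) p volume := by gcongr
    _ = _ := by rw [ENNReal.coe_mul]; ring

/-- For the finitely many blocks too low to be matched with a time in `(0, 1]`; the constants depend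
on `j` and are summed. -/
theorem exists_besovCoeff_le_gaussian (F : Type*) [NormedAddCommGroup F] [NormedSpace ℂ F]
    [FiniteDimensional ℂ F] (θ : ℝ) {p : ℝ≥0∞} (hp : 1 ≤ p) (m : ℕ) :
    ∃ C : ℝ≥0, ∀ j < m, ∀ f : 𝓢'(Phase d, F),
      besovCoeff hχ θ p f j ≤ C * eLpNorm (conv (thermicKernel d 0 1) f) p volume := by
  choose C hC using fun j => exists_eLpNorm_block_le_gaussian hχ F j hp
  refine ⟨∑ j ∈ Finset.range m, (2 ^ (j * θ) : ℝ).toNNReal * C j, fun j hj f => ?_⟩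
  refine (mul_le_mul_right (hC j f) _).trans ?_
  rw [← mul_assoc]
  gcongr
  change ((2 ^ (j * θ) : ℝ).toNNReal : ℝ≥0∞) * C j ≤ _
  rw [← ENNReal.coe_mul, ENNReal.coe_le_coe]
  exact Finset.single_le_sum (f := fun j : ℕ => (2 ^ (j * θ) : ℝ).toNNReal * C j)
    (fun _ _ => zero_le) (Finset.mem_range.2 hj)

end Kinetic

/-! ### Comparison of the norms. -/

namespace Kinetic

variable {d : ℕ}

section

variable {F : Type*} [NormedAddCommGroup F] [NormedSpace ℂ F] {χ : Phase d → ℝ} (hχ : IsCutoff χ)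

theorem lpBesovNorm_top (θ : ℝ) (p : ℝ≥0∞) (f : 𝓢'(Phase d, F)) :
    lpBesovNorm hχ θ p ⊤ f = ⨆ j, besovCoeff hχ θ p f j := if_pos rfl

theorem lpBesovNorm_of_ne_top (θ : ℝ) (p : ℝ≥0∞) {q : ℝ≥0∞} (hq : q ≠ ⊤) (f : 𝓢'(Phase d, F)) :
    lpBesovNorm hχ θ p q f = (∑' j, besovCoeff hχ θ p f j ^ q.toReal) ^ (1 / q.toReal) := if_neg hq

theorem thermicPart_top (n : ℕ) (θ : ℝ) (p : ℝ≥0∞) (f : 𝓢'(Phase d, F)) :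
    thermicPart n θ p ⊤ f = ⨆ v ∈ Set.Ioc (0 : ℝ) 1, thermicCoeff n θ p f v := if_pos rfl

theorem thermicPart_of_ne_top (n : ℕ) (θ : ℝ) (p : ℝ≥0∞) {q : ℝ≥0∞} (hq : q ≠ ⊤)
    (f : 𝓢'(Phase d, F)) :
    thermicPart n θ p q f = (∫⁻ v in Set.Ioc (0 : ℝ) 1, ENNReal.ofReal (1 / v) *
      thermicCoeff n θ p f v ^ q.toReal) ^ (1 / q.toReal) := by
  rw [thermicPart, if_neg hq]
  congr 1
  refine setLIntegral_congr_fun measurableSet_Ioc fun v hv => ?_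
  have hv0 : 0 < v := hv.1
  simp only [thermicCoeff]
  rw [ENNReal.mul_rpow_of_nonneg _ _ ENNReal.toReal_nonneg,
    ENNReal.ofReal_rpow_of_nonneg (by positivity) ENNReal.toReal_nonneg, ← Real.rpow_mul hv0.le]

theorem iSup_besovCoeff_le_lpBesovNorm (θ : ℝ) (p : ℝ≥0∞) {q : ℝ≥0∞} (hq : 1 ≤ q)
    (f : 𝓢'(Phase d, F)) : ⨆ j, besovCoeff hχ θ p f j ≤ lpBesovNorm hχ θ p q f := by
  by_cases hqt : q = ⊤
  · rw [hqt, lpBesovNorm_top]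
  · rw [lpBesovNorm_of_ne_top hχ θ p hqt]
    exact iSup_le fun j => ENNReal.le_tsum_rpow_one_div _
      (by simpa using ENNReal.toReal_mono hqt hq) j

end

variable (F : Type*) [NormedAddCommGroup F] [NormedSpace ℂ F] [FiniteDimensional ℂ F]
  {χ : Phase d → ℝ} (hχ : IsCutoff χ)

theorem exists_thermicPart_le (θ : ℝ) {p q : ℝ≥0∞} (hp : 1 ≤ p) (hq : 1 ≤ q) {n : ℕ}
    (hn : θ / 2 < n) : ∃ C : ℝ≥0, ∀ f : 𝓢'(Phase d, F),
      thermicPart n θ p q f ≤ C * lpBesovNorm hχ θ p q f := by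
  obtain ⟨C, hC⟩ := exists_thermicCoeff_le hχ F θ hp hn
  -- The base `4^{-(n-ϑ/2)}` is below `1` precisely because `n > ϑ/2`.
  set k : ℤ → ℝ≥0∞ := fun z => ENNReal.ofReal ((4 ^ (-(n - θ / 2))) ^ z.natAbs) with hk
  have hK : ∑' z, k z ≠ ⊤ := ENNReal.tsum_int_geometric_ne_top (by positivity)
    (Real.rpow_lt_one_of_one_lt_of_neg (by norm_num) (by linarith))
  refine ⟨3 * (C * (∑' z, k z).toNNReal), fun f => ?_⟩
  rw [ENNReal.coe_mul, ENNReal.coe_mul, ENNReal.coe_toNNReal hK, ENNReal.coe_ofNat]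
  by_cases hqt : q = ⊤
  · rw [hqt, thermicPart_top, lpBesovNorm_top]
    refine iSup₂_le fun v hv => ?_
    obtain ⟨i, hi⟩ := exists_mem_quarticInterval hv
    calc thermicCoeff n θ p f v ≤ C * ((∑' z, k z) * ⨆ j, besovCoeff hχ θ p f j) :=
          (hC i v hi f).trans (mul_le_mul_right (ENNReal.tsum_mul_le_iSup k _ i) _)
      _ = 1 * (C * ∑' z, k z) * ⨆ j, besovCoeff hχ θ p f j := by ring
      _ ≤ _ := by
        gcongr
        norm_num
  · rw [thermicPart_of_ne_top n θ p hqt, lpBesovNorm_of_ne_top hχ θ p hqt]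
    have hr : 1 ≤ q.toReal := by simpa using ENNReal.toReal_mono hqt hq
    set r := q.toReal
    have h1 := lintegral_Ioc_le_tsum (g := fun v => thermicCoeff n θ p f v ^ r)
      (M := fun i => (C * ∑' j : ℕ, k (j - i) * besovCoeff hχ θ p f j) ^ r)
      (fun i v hv => ENNReal.rpow_le_rpow (hC i v hv f) (by linarith))
    have h2 : ∑' i : ℕ, (C * ∑' j : ℕ, k (j - i) * besovCoeff hχ θ p f j) ^ r ≤
        (C * ∑' z, k z) ^ r * ∑' j, besovCoeff hχ θ p f j ^ r := by
      simp_rw [ENNReal.mul_rpow_of_nonneg _ _ (by linarith : (0 : ℝ) ≤ r)]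
      rw [ENNReal.tsum_mul_left, mul_assoc]
      exact mul_le_mul_right (ENNReal.tsum_tsum_mul_rpow_le k _ hr) _
    calc _ ≤ (3 * ((C * ∑' z, k z) ^ r * ∑' j, besovCoeff hχ θ p f j ^ r)) ^ (1 / r) :=
          ENNReal.rpow_le_rpow (h1.trans (mul_le_mul_right h2 _)) (by positivity)
      _ ≤ 3 * ((C * ∑' z, k z) ^ r * ∑' j, besovCoeff hχ θ p f j ^ r) ^ (1 / r) :=
          ENNReal.mul_rpow_one_div_le hr (by norm_num)
      _ = _ := by rw [ENNReal.mul_rpow_rpow_one_div _ _ hr, ← mul_assoc]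

theorem exists_thermicNorm_le (θ : ℝ) {p q : ℝ≥0∞} (hp : 1 ≤ p) (hq : 1 ≤ q) {n : ℕ}
    (hn : θ / 2 < n) : ∃ C : ℝ≥0, ∀ f : 𝓢'(Phase d, F),
      thermicNorm n θ p q f ≤ C * lpBesovNorm hχ θ p q f := by
  obtain ⟨C₁, h₁⟩ := exists_eLpNorm_gaussian_le hχ F θ hp
  obtain ⟨C₂, h₂⟩ := exists_thermicPart_le F hχ θ hp hq hn
  refine ⟨C₁ + C₂, fun f => ?_⟩
  rw [thermicNorm, ENNReal.coe_add, add_mul]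
  exact add_le_add ((h₁ f).trans (mul_le_mul_right
    (iSup_besovCoeff_le_lpBesovNorm hχ θ p hq f) _)) (h₂ f)

theorem exists_lpBesovNorm_le (θ : ℝ) {p q : ℝ≥0∞} (hp : 1 ≤ p) (hq : 1 ≤ q) (n : ℕ) :
    ∃ C : ℝ≥0, ∀ f : 𝓢'(Phase d, F),
      lpBesovNorm hχ θ p q f ≤ C * thermicNorm n θ p q f := by
  obtain ⟨C₁, m, h₁⟩ := exists_besovCoeff_add_le hχ F θ n hp
  obtain ⟨C₂, h₂⟩ := exists_besovCoeff_le_gaussian hχ F θ hp m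
  -- `m + 1` rather than `m`: a factor at least `1` satisfies `c^(1/r) ≤ c`. The `2` comes from
  -- discretising `dv / v`.
  refine ⟨(m + 1) * C₂ + 2 * C₁, fun f => ?_⟩
  have hsplit : ∀ x y : ℝ≥0∞, (m + 1) * C₂ * x + 2 * C₁ * y ≤
      (((m + 1) * C₂ + 2 * C₁ : ℝ≥0) : ℝ≥0∞) * (x + y) := by
    intro x y
    push_cast
    rw [mul_add]
    gcongr
    · exact le_self_add
    · exact le_add_self
  refine le_trans ?_ (hsplit _ _)
  by_cases hqt : q = ⊤
  · rw [hqt, thermicPart_top, lpBesovNorm_top]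
    refine iSup_le fun j => ?_
    rcases lt_or_ge j m with hj | hj
    · refine (h₂ j hj f).trans (le_add_right ?_)
      gcongr
      exact le_mul_of_one_le_left' le_add_self
    · obtain ⟨i, rfl⟩ := Nat.exists_eq_add_of_le' hj
      -- For `q = ∞` one time per block suffices; the right endpoint belongs to the interval.
      have hv : (4⁻¹ : ℝ) ^ i ∈ quarticInterval i :=
        ⟨pow_lt_pow_right_of_lt_one₀ (by norm_num) (by norm_num) (Nat.lt_succ_self i), le_rfl⟩
      refine (h₁ i _ hv f).trans (le_add_left ?_)
      gcongr
      · exact le_mul_of_one_le_left' one_le_two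
      · exact le_iSup₂ (f := fun v (_ : v ∈ Set.Ioc (0 : ℝ) 1) => thermicCoeff n θ p f v) _
          (quarticInterval_subset i hv)
  · rw [thermicPart_of_ne_top n θ p hqt, lpBesovNorm_of_ne_top hχ θ p hqt]
    have hr : 1 ≤ q.toReal := by simpa using ENNReal.toReal_mono hqt hq
    set r := q.toReal
    set g := eLpNorm (conv (thermicKernel d 0 1) f) p volume
    set I := ∫⁻ v in Set.Ioc (0 : ℝ) 1, ENNReal.ofReal (1 / v) * thermicCoeff n θ p f v ^ r with hI
    have hlow : ∑ j ∈ Finset.range m, besovCoeff hχ θ p f j ^ r ≤ (m + 1) * (C₂ * g) ^ r := by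
      calc _ ≤ ∑ j ∈ Finset.range m, (C₂ * g) ^ r := Finset.sum_le_sum fun j hj =>
            ENNReal.rpow_le_rpow (h₂ j (Finset.mem_range.1 hj) f) (by linarith)
        _ = m * (C₂ * g) ^ r := by rw [Finset.sum_const, Finset.card_range, nsmul_eq_mul]
        _ ≤ _ := by gcongr; exact le_self_add
    have hhigh : ∑' i, besovCoeff hχ θ p f (i + m) ^ r ≤ 2 * (C₁ ^ r * I) := by
      have h3 : ∫⁻ v in Set.Ioc (0 : ℝ) 1, ENNReal.ofReal (1 / v) *
          (C₁ * thermicCoeff n θ p f v) ^ r = C₁ ^ r * I := by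
        rw [hI, ← lintegral_const_mul' _ _ (ENNReal.rpow_ne_top_of_nonneg (by linarith)
          ENNReal.coe_ne_top)]
        refine lintegral_congr fun v => ?_
        rw [ENNReal.mul_rpow_of_nonneg _ _ (by linarith), mul_left_comm]
      rw [← h3]
      exact tsum_le_lintegral_Ioc fun i v hv =>
        ENNReal.rpow_le_rpow (h₁ i v hv f) (by linarith)
    rw [← Summable.sum_add_tsum_nat_add' (k := m) ENNReal.summable]
    calc _ ≤ ((m + 1) * (C₂ * g) ^ r + 2 * (C₁ ^ r * I)) ^ (1 / r) :=
          ENNReal.rpow_le_rpow (add_le_add hlow hhigh) (by positivity)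
      _ ≤ ((m + 1) * (C₂ * g) ^ r) ^ (1 / r) + (2 * (C₁ ^ r * I)) ^ (1 / r) :=
          ENNReal.rpow_add_le_add_rpow _ _ (by positivity) (by
            rw [one_div]; exact inv_le_one_of_one_le₀ hr)
      _ ≤ (m + 1) * ((C₂ * g) ^ r) ^ (1 / r) + 2 * (C₁ ^ r * I) ^ (1 / r) :=
          add_le_add (ENNReal.mul_rpow_one_div_le hr le_add_self)
            (ENNReal.mul_rpow_one_div_le hr one_le_two)
      _ = _ := by
        rw [ENNReal.mul_rpow_rpow_one_div _ _ hr, ← ENNReal.rpow_mul,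
          mul_one_div_cancel (by positivity), ENNReal.rpow_one, mul_assoc, mul_assoc]

end Kinetic

/-- For every admissible choice of the cutoff `χ₀` and of the number `n > ϑ / 2` of time
derivatives, the anisotropic Littlewood-Paley norm and the thermic norm are equivalent on all
tempered distributions (both norms may be infinite, and they are so simultaneously). -/
theorem mainTheorem9 (d : ℕ) {F : Type*} [NormedAddCommGroup F] [NormedSpace ℂ F]
    [FiniteDimensional ℂ F] (χ : Kinetic.Phase d → ℝ) (hχ : Kinetic.IsCutoff χ)
    (θ : ℝ) (p q : ℝ≥0∞) (hp : 1 ≤ p) (hq : 1 ≤ q) (n : ℕ) (hn : θ / 2 < n) :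
    ∃ C : ℝ≥0, 0 < C ∧ ∀ f : 𝓢'(Kinetic.Phase d, F),
      Kinetic.lpBesovNorm hχ θ p q f ≤ C * Kinetic.thermicNorm n θ p q f ∧
      Kinetic.thermicNorm n θ p q f ≤ C * Kinetic.lpBesovNorm hχ θ p q f := by
  obtain ⟨C₁, h₁⟩ := Kinetic.exists_lpBesovNorm_le F hχ θ hp hq n
  obtain ⟨C₂, h₂⟩ := Kinetic.exists_thermicNorm_le F hχ θ hp hq hn
  -- The `1` secures positivity of the constant.
  refine ⟨max (max C₁ C₂) 1, by positivity, fun f => ⟨(h₁ f).trans ?_, (h₂ f).trans ?_⟩⟩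
  · exact mul_le_mul_left (ENNReal.coe_le_coe.2 ((le_max_left _ _).trans (le_max_left _ _))) _
  · exact mul_le_mul_left (ENNReal.coe_le_coe.2 ((le_max_right _ _).trans (le_max_left _ _))) _
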